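/- For $n\ge 2$ call a probability measure $\gamma$ on $\mathbb{R}^n$ rotation-invariant log-concave if it has a density of the form $C_n e^{-\varphi(|x|)}$, where $|\cdot|$ is the Euclidean norm, $\varphi:[0,\infty)\to[0,\infty]$ is convex and nondecreasing (with $e^{-\infty}=0$), and $C_n=\left(\int_{\mathbb{R}^n}e^{-\varphi(|y|)}\,dy\right)^{-1}$. For a convex set $Q\subseteq\mathbb{R}^n$ let $$\gamma(\partial Q)=\liminf_{\varepsilon\to 0^+}\frac{\gamma\big((Q+\varepsilon B_2^n)\setminus Q\big)}{\varepsilon}$$ be its Minkowski surface area with respect to $\gamma$, where $B_2^n$ is the closed Euclidean unit ball, and let $\mathcal{K}_n$ be the family of all convex sets in $\mathbb{R}^n$. There are absolute constants $c,C>0$ such that for every $n\ge2$ and every rotation-invariant log-concave probability measure $\gamma$ on $\mathbb{R}^n$, if $X$ is a random vector distributed according to $\gamma$, then $|X|$ has a finite second moment, $\mathbb{E}|X|>0$, $\operatorname{Var}|X|>0$, and $$c\,\frac{\sqrt n}{\sqrt{\mathbb{E}|X|}\,\sqrt[4]{\operatorname{Var}|X|}}\;\le\;\sup_{Q\in\mathcal{K}_n}\gamma(\partial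 Q)\;\le\; C\,\frac{\sqrt n}{\sqrt{\mathbb{E}|X|}\,\sqrt[4]{\operatorname{Var}|X|}}.$$ As special cases: for every real $p\ge1$ there are constants $c(p),C(p)>0$, depending only on $p$, such that for every $n\ge2$ the probability measure $\gamma_p$ on $\mathbb{R}^n$ with density proportional to $e^{-|x|^p/p}$ is rotation-invariant log-concave and satisfies $$c(p)\,n^{\frac34-\frac1p}\le\sup_{Q\in\mathcal{K}_n}\gamma_p(\partial Q)\le C(p)\,n^{\frac34-\frac1p};$$ and there are absolute constants $c',C'>0$ such that for every $n\ge 2$ the standard Gaussian measure $\gamma_2$ on $\mathbb{R}^n$ satisfies $$c'\,n^{\frac14}\le\sup_{Q\in\mathcal{K}_n}\gamma_2(\partial Q)\le C'\,n^{\frac14}.$$ -/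

import Mathlib

open MeasureTheory ProbabilityTheory Filter Topology
open scoped NNReal ENNReal Pointwise

noncomputable section

namespace RadialSurface

/-- The function `x ↦ e^{-φ(|x|)}` on `ℝⁿ`, where `φ : [0,∞) → [0,∞]` and `e^{-∞} = 0`. -/
def weight (n : ℕ) (φ : ℝ≥0 → ℝ≥0∞) (x : EuclideanSpace ℝ (Fin n)) : ℝ≥0∞ :=
  EReal.exp (-(φ ‖x‖₊ : EReal))

/-- The measure on `ℝⁿ` with density `C_n e^{-φ(|x|)}`, where `C_n = (∫ e^{-φ(|y|)} dy)⁻¹`.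
It is a probability measure exactly when that integral is neither `0` nor `∞`. -/
def radialMeasure (n : ℕ) (φ : ℝ≥0 → ℝ≥0∞) : Measure (EuclideanSpace ℝ (Fin n)) :=
  (∫⁻ y, weight n φ y)⁻¹ • (volume : Measure (EuclideanSpace ℝ (Fin n))).withDensity (weight n φ)

/-- Rotation-invariant log-concave probability measures on `ℝⁿ`: the probability measures with
density `C_n e^{-φ(|x|)}` for a nondecreasing convex `φ : [0,∞) → [0,∞]`. -/
structure IsRotInvLogConcave {n : ℕ} (γ : Measure (EuclideanSpace ℝ (Fin n))) : Prop where
  isProbabilityMeasure : IsProbabilityMeasure γ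
  exists_potential : ∃ φ : ℝ≥0 → ℝ≥0∞,
    Monotone φ ∧ ConvexOn ℝ≥0 Set.univ φ ∧ γ = radialMeasure n φ

/-- The Minkowski surface area `liminf_{ε → 0+} γ((Q + ε B) \ Q) / ε` of `Q` with respect to `γ`,
where `B` is the closed Euclidean unit ball. -/
def surfaceArea {n : ℕ} (γ : Measure (EuclideanSpace ℝ (Fin n)))
    (Q : Set (EuclideanSpace ℝ (Fin n))) : ℝ≥0∞ :=
  liminf (fun ε : ℝ =>
      γ ((Q + ε • Metric.closedBall (0 : EuclideanSpace ℝ (Fin n)) 1) \ Q) / ENNReal.ofReal ε)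
    (𝓝[>] (0 : ℝ))

/-- The largest Minkowski surface area of a convex subset of `ℝⁿ`, as a supremum. -/
def maxSurfaceArea {n : ℕ} (γ : Measure (EuclideanSpace ℝ (Fin n))) : ℝ≥0∞ :=
  ⨆ (Q : Set (EuclideanSpace ℝ (Fin n))) (_ : Convex ℝ Q), surfaceArea γ Q

/-- The probability measure `γ_p` on `ℝⁿ` with density proportional to `e^{-|x|^p / p}`;
`γ_2` is the standard Gaussian measure. -/
def powerMeasure (n : ℕ) (p : ℝ) : Measure (EuclideanSpace ℝ (Fin n)) :=
  radialMeasure n (fun t => ENNReal.ofReal ((t : ℝ) ^ p / p))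

end RadialSurface

end

open MeasureTheory ProbabilityTheory Filter Topology
open scoped NNReal ENNReal Pointwise

noncomputable section

namespace RadialSurface

/-! ### Log-concave radial profiles and their modes -/

/-! Put m = n - 1. The norm |X| has a density f(s) = A s^m V(s) with V = e^{-φ}. Let r be its mode
and M its supremum. Log-concavity of f gives E|X| ≍ r and Var|X| ≍ 1/M², so the quantity in the
theorem is Λ = √(nM/r) up to absolute constants (`HasRadialDensity.sqrt_div_le`), and both bounds
are proved for Λ. Since V may jump to 0, the supremum need not be attained; `IsMode` keeps only the
tangent bound at r and the left-hand lower bound.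

Upper bound (`IsRadialMeasure.measure_shell_le`). A shell of width ε around Q is moved outwards
along the normals ν of the metric projection. This flow does not decrease volume, because its
inverse is nonexpansive, and the images of the shell at times 0, ε, 2ε, ... are disjoint. Where ⟨ν,
x⟩ ≥ u|x|, each ray from the origin meets the shell in length at most ε/u, which costs Mε/u. Where
⟨ν, x⟩ ≤ u|x|, the flow can run for a time t of order r / max(nu, √n) while |x| grows by a factor of
at most 1 + O(1/n); the density then drops by a bounded factor only, and counting t/ε disjoint
copies costs O(ε/t). The choice u = M/Λ balances the two at order Λε. Points with very small or very
large norm are handled by letting the flow run forever, which compares the shell with spheres and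
costs O(Mε); and M ≤ Λ.

Lower bound (`IsRadialMeasure.le_maxSurfaceArea`). Take a polytope with N independent uniform facet
directions, all facets at distance τ from 0, where τ² is a small multiple of Mr³/n. For this τ the
probability that a random halfspace cuts off x has the same order for all x with ||x| - r| < 8/M, a
set of measure at least 1/4. Choose N inverse to that probability. Then such an x is just above a
given facet, and clear of all the others, with probability of order (ε/N) nτ/r², and nτ/r² ≍ Λ.
Summing over the facets and averaging over the directions gives a polytope with surface area at
least cΛ.

For e^{-|x|^p/p} the mode is m^{1/p} and Mr ≍ √n with constants depending on p, whence Λ ≍ n^{3/4 -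
1/p}; p = 2 is identified with the standard Gaussian by its characteristic function. -/

/-- A nonnegative, nonincreasing radial profile which is log-concave on `[0,∞)`. -/
structure IsProfile (V : ℝ → ℝ) : Prop where
  nonneg : ∀ s, 0 ≤ V s
  anti : Antitone V
  logConcave : ∀ {x y t : ℝ}, 0 ≤ x → 0 ≤ y → 0 < t → t < 1 →
    V x ^ (1 - t) * V y ^ t ≤ V ((1 - t) * x + t * y)

/-- `r` is a (possibly unattained) maximum point of `s ↦ s ^ k * V s`, and `v` is the left limit
of `V` there, expressed through the tangent bound at `r` for the log-concave function `V`. -/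
structure IsMode (V : ℝ → ℝ) (k : ℕ) (r v : ℝ) : Prop where
  r_pos : 0 < r
  v_pos : 0 < v
  upper : ∀ s, 0 ≤ s → V s ≤ v * Real.exp (-(k * (s / r - 1)))
  lower : ∀ s, 0 ≤ s → s < r → v ≤ V s

theorem IsProfile.measurable {V : ℝ → ℝ} (hV : IsProfile V) : Measurable V :=
  hV.anti.measurable

/-- A log-concave profile that is not constant decays exponentially. -/
theorem IsProfile.exists_exp_decay {V : ℝ → ℝ} (hV : IsProfile V) {s₁ : ℝ} (hs₁ : 0 < s₁)
    (h : V s₁ < V 0) : ∃ c > 0, ∀ s, s₁ < s → V s ≤ V 0 * Real.exp (-(c * s)) := by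
  have h0 : 0 < V 0 := (hV.nonneg s₁).trans_lt h
  -- The midpoint between V s₁ / V 0 and 1, rather than the ratio itself, so that log q makes sense
  -- even if V s₁ = 0.
  set q : ℝ := (V s₁ / V 0 + 1) / 2 with hq
  have hq0 : 0 < q := by have := div_nonneg (hV.nonneg s₁) h0.le; positivity
  have hq1 : q < 1 := by have := (div_lt_one h0).2 h; rw [hq]; linarith
  have hVq : V s₁ ≤ V 0 * q := by
    have h1 : V s₁ / V 0 ≤ q := by have := (div_lt_one h0).2 h; rw [hq]; linarith
    rw [div_le_iff₀ h0] at h1; linarith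
  have hlog : Real.log q < 0 := Real.log_neg hq0 hq1
  refine ⟨-Real.log q / s₁, div_pos (neg_pos.2 hlog) hs₁, fun s hs => ?_⟩
  have hs0 : 0 < s := hs₁.trans hs
  have ht0 : 0 < s₁ / s := div_pos hs₁ hs0
  have ht1 : s₁ / s < 1 := (div_lt_one hs0).2 hs
  rcases (hV.nonneg s).eq_or_lt with hVs | hVs
  · rw [← hVs]; positivity
  have key := hV.logConcave le_rfl hs0.le ht0 ht1
  have e1 : (1 - s₁ / s) * 0 + s₁ / s * s = s₁ := by field_simp; ring
  rw [e1] at key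
  have key2 := Real.log_le_log (by positivity) (key.trans hVq)
  rw [Real.log_mul (by positivity) (by positivity), Real.log_rpow h0, Real.log_rpow hVs,
    Real.log_mul h0.ne' hq0.ne'] at key2
  have key3 : s₁ / s * (Real.log (V s) - Real.log (V 0)) ≤ Real.log q := by linarith
  have key4 : Real.log (V s) - Real.log (V 0) ≤ Real.log q / (s₁ / s) := by
    rw [le_div_iff₀ ht0]; linarith
  have : Real.log (V s) ≤ Real.log (V 0 * Real.exp (-(-Real.log q / s₁ * s))) := by
    rw [Real.log_mul h0.ne' (Real.exp_pos _).ne', Real.log_exp]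
    have : Real.log q / (s₁ / s) = -(-Real.log q / s₁ * s) := by field_simp
    linarith
  exact (Real.log_le_log_iff hVs (by positivity)).1 this

theorem IsProfile.tendsto_pow_mul {V : ℝ → ℝ} (hV : IsProfile V) {s₁ : ℝ} (hs₁ : 0 < s₁)
    (h : V s₁ < V 0) (k : ℕ) : Tendsto (fun s => s ^ k * V s) atTop (𝓝 0) := by
  obtain ⟨c, hc, hdec⟩ := hV.exists_exp_decay hs₁ h
  have h1 : Tendsto (fun s : ℝ => V 0 * (s ^ k * Real.exp (-c * s))) atTop (𝓝 0) := by
    have := (tendsto_rpow_mul_exp_neg_mul_atTop_nhds_zero (k : ℝ) c hc).const_mul (V 0)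
    simpa using this
  refine squeeze_zero' ?_ ?_ h1
  · filter_upwards [eventually_ge_atTop 0] with s hs
    exact mul_nonneg (pow_nonneg hs _) (hV.nonneg s)
  · filter_upwards [eventually_gt_atTop s₁] with s hs
    have := mul_le_mul_of_nonneg_left (hdec s hs) (pow_nonneg (hs₁.trans hs).le k)
    rw [neg_mul]; linarith

/-- Near-maximisers of s ^ k * V s stay bounded because V decays exponentially, so they accumulate
at some r; the supremum H need not be attained there, and v = H / r ^ k replaces V r. -/
theorem IsProfile.exists_isMode {V : ℝ → ℝ} (hV : IsProfile V) {s₀ s₁ : ℝ} (hs₀ : 0 < s₀)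
    (h₀ : 0 < V s₀) (hs₁ : 0 < s₁) (h : V s₁ < V 0) {k : ℕ} (hk : k ≠ 0) :
    ∃ r v, IsMode V k r v := by
  set g : ℝ → ℝ := fun s => s ^ k * V s with hg
  have hlim : Tendsto g atTop (𝓝 0) := hV.tendsto_pow_mul hs₁ h k
  have hg0 : 0 < g s₀ := by simp only [hg]; positivity
  have hbdd : BddAbove (g '' Set.Ici 0) := by
    obtain ⟨S, hS⟩ := eventually_atTop.1 (hlim.eventually (gt_mem_nhds one_pos))
    refine ⟨max 1 (|S| ^ k * V 0), ?_⟩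
    rintro _ ⟨s, hs, rfl⟩
    rcases le_total S s with h1 | h1
    · exact le_max_of_le_left (hS s h1).le
    · refine le_max_of_le_right ?_
      have hs' : 0 ≤ s := hs
      have : s ≤ |S| := h1.trans (le_abs_self S)
      exact mul_le_mul (pow_le_pow_left₀ hs' this k) (hV.anti hs') (hV.nonneg s) (by positivity)
  have hne : (g '' Set.Ici 0).Nonempty := ⟨_, s₀, hs₀.le, rfl⟩
  set H := sSup (g '' Set.Ici 0) with hH
  have hgH : ∀ s, 0 ≤ s → g s ≤ H := fun s hs => le_csSup hbdd ⟨s, hs, rfl⟩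
  have hHpos : 0 < H := hg0.trans_le (hgH s₀ hs₀.le)
  obtain ⟨w, -, hw, hwm⟩ := exists_seq_tendsto_sSup hne hbdd
  choose x hx0 hxw using hwm
  have hgx : Tendsto (fun j => g (x j)) atTop (𝓝 H) := by simpa only [hxw] using hw
  obtain ⟨S, hS⟩ := eventually_atTop.1 (hlim.eventually (gt_mem_nhds (half_pos hHpos)))
  have hxS : ∃ᶠ j in atTop, x j ∈ Set.Icc 0 S := by
    refine Eventually.frequently ?_
    filter_upwards [hgx.eventually (lt_mem_nhds (half_lt_self hHpos))] with j hj
    refine ⟨hx0 j, ?_⟩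
    by_contra hcon
    exact absurd (hS _ (not_le.1 hcon).le) (not_lt.2 hj.le)
  obtain ⟨r, -, ψ, hψ, hr⟩ := tendsto_subseq_of_frequently_bounded (Metric.isBounded_Icc 0 S) hxS
  rw [Function.comp_def] at hr
  have hgψ : Tendsto (fun j => g (x (ψ j))) atTop (𝓝 H) := hgx.comp hψ.tendsto_atTop
  have hr0 : 0 ≤ r := ge_of_tendsto' hr fun j => hx0 _
  have hrpos : 0 < r := by
    refine hr0.lt_of_ne fun hr' => ?_
    rw [← hr'] at hr
    have h1 : Tendsto (fun j => x (ψ j) ^ k * V 0) atTop (𝓝 0) := by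
      simpa [hk] using (hr.pow k).mul_const (V 0)
    have h2 := le_of_tendsto_of_tendsto' hgψ h1 fun j =>
      mul_le_mul_of_nonneg_left (hV.anti (hx0 _)) (pow_nonneg (hx0 _) k)
    exact absurd h2 (not_le.2 hHpos)
  set v := H / r ^ k with hv
  have hvpos : 0 < v := by positivity
  have hVv : Tendsto (fun j => V (x (ψ j))) atTop (𝓝 v) := by
    refine (hgψ.div (hr.pow k) (by positivity)).congr' ?_
    filter_upwards [hr.eventually (lt_mem_nhds hrpos)] with j hj
    simp only [hg, Pi.div_apply]
    field_simp
  refine ⟨r, v, hrpos, hvpos, fun s hs => ?_, fun s hs hsr => ?_⟩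
  · rcases (hV.nonneg s).eq_or_lt with hVs | hVs
    · rw [← hVs]; positivity
    have hpos : ∀ t : ℝ, 0 < t → t < 1 → 0 < 1 + t * (s / r - 1) := fun t h0 h1 => by
      have : 0 ≤ t * (s / r) := by positivity
      linarith
    have step : ∀ t : ℝ, 0 < t → t < 1 →
        Real.log (V s) - Real.log v ≤ -(k * ((s / r - 1) / (1 + t * (s / r - 1)))) := by
      intro t h0 h1
      have hp := hpos t h0 h1
      have hz : (1 - t) * r + t * s = r * (1 + t * (s / r - 1)) := by field_simp; ring
      have hz0 : 0 < (1 - t) * r + t * s := by rw [hz]; positivity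
      -- Log-concavity between a near-maximiser and s bounds V from below at the intermediate point,
      -- where the product is at most H. Letting t tend to 0 afterwards gives the first-order
      -- condition at the maximum.
      have l1 : v ^ (1 - t) * V s ^ t * ((1 - t) * r + t * s) ^ k ≤ H := by
        have c1 : Tendsto (fun j => V (x (ψ j)) ^ (1 - t) * V s ^ t *
            ((1 - t) * x (ψ j) + t * s) ^ k) atTop
            (𝓝 (v ^ (1 - t) * V s ^ t * ((1 - t) * r + t * s) ^ k)) :=
          ((hVv.rpow_const (Or.inr (by linarith))).mul_const _).mul
            (((hr.const_mul _).add_const _).pow k)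
        refine le_of_tendsto' c1 fun j => ?_
        have h2 : 0 ≤ (1 - t) * x (ψ j) + t * s := by
          have := hx0 (ψ j); have h3 : 0 ≤ 1 - t := by linarith
          have h4 : 0 ≤ x (ψ j) := this
          positivity
        refine le_trans ?_ (hgH _ h2)
        rw [mul_comm]
        exact mul_le_mul_of_nonneg_left (hV.logConcave (hx0 _) hs h0 h1) (pow_nonneg h2 k)
      have hHv : H = v * r ^ k := by rw [hv]; field_simp
      rw [hHv, hz, mul_pow] at l1
      have l2 : v ^ (1 - t) * V s ^ t * (1 + t * (s / r - 1)) ^ k ≤ v := by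
        have : 0 < r ^ k := by positivity
        refine le_of_mul_le_mul_right ?_ this
        linarith
      have l3 := Real.log_le_log (by positivity) l2
      rw [Real.log_mul (by positivity) (by positivity), Real.log_mul (by positivity)
        (by positivity), Real.log_rpow hvpos, Real.log_rpow hVs, Real.log_pow] at l3
      have l4 := Real.one_sub_inv_le_log_of_pos hp
      have l5 : 1 - (1 + t * (s / r - 1))⁻¹ = t * ((s / r - 1) / (1 + t * (s / r - 1))) := by
        generalize s / r - 1 = z at hp
        have := hp.ne'
        field_simp
        ring
      rw [l5] at l4
      have l6 := mul_le_mul_of_nonneg_left l4 (Nat.cast_nonneg (α := ℝ) k)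
      have l7 : t * (Real.log (V s) - Real.log v) ≤
          t * -(k * ((s / r - 1) / (1 + t * (s / r - 1)))) := by linarith
      exact le_of_mul_le_mul_left l7 h0
    have lim : Tendsto (fun t : ℝ => -(k * ((s / r - 1) / (1 + t * (s / r - 1))))) (𝓝[>] 0)
        (𝓝 (-(k * ((s / r - 1) / (1 + 0 * (s / r - 1)))))) := by
      refine Tendsto.mono_left ?_ nhdsWithin_le_nhds
      refine ContinuousAt.tendsto (f := fun t : ℝ => -(k * ((s / r - 1) / (1 + t * (s / r - 1))))) ?_
      fun_prop (disch := simp)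
    have fin : Real.log (V s) - Real.log v ≤ -(k * ((s / r - 1) / (1 + 0 * (s / r - 1)))) := by
      refine ge_of_tendsto lim ?_
      filter_upwards [Ioo_mem_nhdsGT (one_pos (α := ℝ))] with t ht
      exact step t ht.1 ht.2
    have : Real.log (V s) ≤ Real.log (v * Real.exp (-(k * (s / r - 1)))) := by
      rw [Real.log_mul hvpos.ne' (Real.exp_pos _).ne', Real.log_exp]
      simp only [zero_mul, add_zero, div_one] at fin
      linarith
    exact (Real.log_le_log_iff hVs (by positivity)).1 this
  · refine le_of_tendsto hVv ?_
    filter_upwards [hr.eventually (lt_mem_nhds hsr)] with j hj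
    exact hV.anti hj.le

/-- The logarithmic slope of a profile to the left of its mode of order `k` is at most `k / r`. -/
theorem IsMode.exp_mul_le {V : ℝ → ℝ} (hV : IsProfile V) {k : ℕ} {r v : ℝ} (h : IsMode V k r v)
    {a s : ℝ} (ha : 0 ≤ a) (has : a ≤ s) (hs : s < r) :
    V a * Real.exp (-(k * ((s - a) / r))) ≤ V s := by
  rcases has.eq_or_lt with rfl | has
  · simp
  have hVa : 0 < V a := h.v_pos.trans_le (h.lower a ha (has.trans hs))
  have hVs : 0 < V s := h.v_pos.trans_le (h.lower s (ha.trans has.le) hs)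
  -- Concavity of log V on a < s < b, with V b ≥ v and the tangent bound at a to compare V a with v.
  -- Only b < r is available, so b tends to r at the end.
  have step : ∀ b, s < b → b < r →
      Real.log (V a) - (s - a) / (b - a) * (k * (1 - a / r)) ≤ Real.log (V s) := by
    intro b hsb hbr
    have hba : 0 < b - a := by linarith
    have hVb := h.lower b (by linarith) hbr
    have ht0 : 0 < (s - a) / (b - a) := div_pos (by linarith) hba
    have ht1 : (s - a) / (b - a) < 1 := (div_lt_one hba).2 (by linarith)
    have key := hV.logConcave ha (by linarith : (0 : ℝ) ≤ b) ht0 ht1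
    have e1 : (1 - (s - a) / (b - a)) * a + (s - a) / (b - a) * b = s := by
      field_simp; ring
    have hVb0 : 0 < V b := h.v_pos.trans_le hVb
    rw [e1] at key
    have l := Real.log_le_log (by positivity) key
    rw [Real.log_mul (by positivity) (by positivity), Real.log_rpow hVa, Real.log_rpow hVb0] at l
    have u := Real.log_le_log hVa (h.upper a ha)
    rw [Real.log_mul h.v_pos.ne' (Real.exp_pos _).ne', Real.log_exp] at u
    have w := Real.log_le_log h.v_pos hVb
    have : Real.log (V a) - k * (1 - a / r) ≤ Real.log (V b) := by
      have : -(k * (a / r - 1)) = k * (1 - a / r) := by ring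
      linarith
    have := mul_le_mul_of_nonneg_left this ht0.le
    linarith
  have hr := h.r_pos
  have lim : Tendsto (fun b => Real.log (V a) - (s - a) / (b - a) * (k * (1 - a / r))) (𝓝[<] r)
      (𝓝 (Real.log (V a) - (s - a) / (r - a) * (k * (1 - a / r)))) := by
    refine Tendsto.mono_left ?_ nhdsWithin_le_nhds
    have : r - a ≠ 0 := by linarith
    refine ContinuousAt.tendsto
      (f := fun b => Real.log (V a) - (s - a) / (b - a) * (k * (1 - a / r))) ?_
    fun_prop (disch := assumption)
  have fin := le_of_tendsto lim (by
    filter_upwards [Ioo_mem_nhdsLT hs] with b hb using step b hb.1 hb.2)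
  have e2 : (s - a) / (r - a) * (k * (1 - a / r)) = k * ((s - a) / r) := by
    have : r - a ≠ 0 := by linarith
    field_simp
  rw [e2] at fin
  refine (Real.log_le_log_iff (by positivity) hVs).1 ?_
  rw [Real.log_mul hVa.ne' (Real.exp_pos _).ne', Real.log_exp]
  linarith

/-! ### One-dimensional radial laws -/

theorem lintegral_Ioc_pow (m : ℕ) {r : ℝ} (hr : 0 ≤ r) :
    ∫⁻ s in Set.Ioc 0 r, ENNReal.ofReal (s ^ m) = ENNReal.ofReal (r ^ (m + 1) / (m + 1)) := by
  rw [← ofReal_integral_eq_lintegral_ofReal]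
  · rw [← intervalIntegral.integral_of_le hr, integral_pow]
    simp
  · exact (intervalIntegral.intervalIntegrable_pow m).1
  · filter_upwards [ae_restrict_mem measurableSet_Ioc] with s hs using pow_nonneg hs.1.le m

theorem lintegral_Ioi_exp {a c : ℝ} (hc : 0 < c) :
    ∫⁻ s in Set.Ioi a, ENNReal.ofReal (Real.exp (-(c * (s - a)))) = ENNReal.ofReal (1 / c) := by
  have h : ∀ s : ℝ, Real.exp (-(c * (s - a))) = Real.exp (c * a) * Real.exp (-c * s) := fun s => by
    rw [← Real.exp_add]; ring_nf
  simp_rw [h]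
  rw [← ofReal_integral_eq_lintegral_ofReal]
  · rw [integral_const_mul, integral_exp_mul_Ioi (by linarith)]
    congr 1
    have : Real.exp (c * a) * Real.exp (-c * a) = 1 := by rw [← Real.exp_add]; simp
    rw [neg_mul] at this
    field_simp
    linarith
  · exact (integrableOn_exp_mul_Ioi (by linarith) a).const_mul _
  · exact ae_of_all _ fun s => by positivity

/-- The density `s ↦ A s ^ m V(s)` of the norm of a radial random vector. -/
def radialDensity (A : ℝ) (m : ℕ) (V : ℝ → ℝ) (s : ℝ) : ℝ := A * s ^ m * V s

/-- `V` is a profile whose radial density is a probability density with mode `r`. -/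
structure IsRadialLaw (A : ℝ) (m : ℕ) (V : ℝ → ℝ) (r v : ℝ) : Prop where
  profile : IsProfile V
  mode : IsMode V m r v
  A_pos : 0 < A
  m_ne : m ≠ 0
  mass : ∫⁻ s in Set.Ioi 0, ENNReal.ofReal (radialDensity A m V s) = 1

/-- The supremum of the radial density. -/
def peak (A : ℝ) (m : ℕ) (r v : ℝ) : ℝ := A * r ^ m * v

theorem mul_exp_one_sub_le_one (x : ℝ) : x * Real.exp (1 - x) ≤ 1 := by
  have h := Real.mul_exp_neg_le_exp_neg_one x
  have : Real.exp (1 - x) = Real.exp 1 * Real.exp (-x) := by rw [← Real.exp_add]; ring_nf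
  rw [this]
  have h1 : Real.exp 1 * Real.exp (-1) = 1 := by rw [← Real.exp_add]; simp
  nlinarith [Real.exp_pos 1]

theorem mul_exp_one_sub_le_exp (x : ℝ) : x * Real.exp (1 - x) ≤ 2 * Real.exp (-(x / 2)) := by
  have h := mul_exp_one_sub_le_one (x / 2)
  have : Real.exp (1 - x) = Real.exp (1 - x / 2) * Real.exp (-(x / 2)) := by
    rw [← Real.exp_add]; ring_nf
  rw [this]
  nlinarith [Real.exp_pos (-(x / 2))]

/-! ### Estimates of a radial density through its mode and its peak -/

namespace IsRadialLaw

variable {A : ℝ} {m : ℕ} {V : ℝ → ℝ} {r v : ℝ}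

theorem peak_pos (h : IsRadialLaw A m V r v) : 0 < peak A m r v := by
  have := h.A_pos; have := h.mode.r_pos; have := h.mode.v_pos
  unfold peak; positivity

theorem density_nonneg (h : IsRadialLaw A m V r v) {s : ℝ} (hs : 0 ≤ s) :
    0 ≤ radialDensity A m V s := by
  have := h.A_pos; have := h.profile.nonneg s
  unfold radialDensity; positivity

theorem measurable_density (h : IsRadialLaw A m V r v) : Measurable (radialDensity A m V) := by
  have := h.profile.measurable
  unfold radialDensity; fun_prop

theorem density_le (h : IsRadialLaw A m V r v) {s : ℝ} (hs : 0 ≤ s) :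
    radialDensity A m V s ≤ peak A m r v * (s / r * Real.exp (1 - s / r)) ^ m := by
  have hA := h.A_pos; have hr := h.mode.r_pos
  have h1 := h.mode.upper s hs
  have e : Real.exp (-(m * (s / r - 1))) = Real.exp (1 - s / r) ^ m := by
    rw [← Real.exp_nat_mul]; ring_nf
  rw [e] at h1
  unfold radialDensity peak
  have h2 := mul_le_mul_of_nonneg_left h1 (by positivity : 0 ≤ A * s ^ m)
  refine h2.trans (le_of_eq ?_)
  rw [mul_pow, div_pow]
  field_simp

/-- Dropping the power m loses concentration but leaves a bound that does not involve the dimension.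
-/
theorem density_le_linear (h : IsRadialLaw A m V r v) {s : ℝ} (hs : 0 ≤ s) :
    radialDensity A m V s ≤ peak A m r v * (s / r * Real.exp (1 - s / r)) := by
  have hr := h.mode.r_pos
  refine (h.density_le hs).trans (mul_le_mul_of_nonneg_left ?_ h.peak_pos.le)
  exact pow_le_of_le_one (by positivity) (mul_exp_one_sub_le_one _) h.m_ne

theorem density_le_peak (h : IsRadialLaw A m V r v) {s : ℝ} (hs : 0 ≤ s) :
    radialDensity A m V s ≤ peak A m r v :=
  (h.density_le_linear hs).trans
    (mul_le_of_le_one_right h.peak_pos.le (mul_exp_one_sub_le_one _))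

theorem setLIntegral_le_one (h : IsRadialLaw A m V r v) {S : Set ℝ} (hS : S ⊆ Set.Ioi 0) :
    ∫⁻ s in S, ENNReal.ofReal (radialDensity A m V s) ≤ 1 :=
  (lintegral_mono_set hS).trans h.mass.le

/-- The integral of A v' s ^ m over (0, r') is part of the total mass 1. Stated for arbitrary r', v'
because it is also needed at the mode of order 2m. -/
theorem mul_pow_le_of_le (h : IsRadialLaw A m V r v) {r' v' : ℝ} (hr' : 0 ≤ r') (hv' : 0 ≤ v')
    (hV : ∀ s, 0 ≤ s → s < r' → v' ≤ V s) : A * r' ^ (m + 1) * v' ≤ m + 1 := by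
  have hA := h.A_pos
  have h1 : ∫⁻ s in Set.Ioc 0 r', ENNReal.ofReal (A * v') * ENNReal.ofReal (s ^ m) ≤ 1 := by
    refine le_trans ?_ (h.setLIntegral_le_one (S := Set.Ioo 0 r') fun s hs => hs.1)
    rw [restrict_Ioo_eq_restrict_Ioc]
    refine setLIntegral_mono_ae (h.measurable_density.ennreal_ofReal.aemeasurable) ?_
    filter_upwards [compl_mem_ae_iff.2 (measure_singleton r')] with s hs' hs
    rw [← ENNReal.ofReal_mul (by positivity)]
    refine ENNReal.ofReal_le_ofReal ?_
    have := mul_le_mul_of_nonneg_left (hV s hs.1.le (lt_of_le_of_ne hs.2 hs'))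
      (by have := hs.1; positivity : 0 ≤ A * s ^ m)
    unfold radialDensity
    linarith
  rw [lintegral_const_mul _ (by fun_prop), lintegral_Ioc_pow m hr', ← ENNReal.ofReal_mul
    (by positivity), ENNReal.ofReal_le_one] at h1
  rw [mul_div_assoc', div_le_one (by positivity)] at h1
  linarith

theorem peak_mul_le (h : IsRadialLaw A m V r v) : peak A m r v * r ≤ m + 1 := by
  have := h.mul_pow_le_of_le h.mode.r_pos.le h.mode.v_pos.le h.mode.lower
  unfold peak
  rw [pow_succ] at this
  linarith

theorem one_le_peak_mul (h : IsRadialLaw A m V r v) : 1 ≤ 4 * (peak A m r v * r) := by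
  have hr := h.mode.r_pos
  have hM := h.peak_pos
  have h1 : (1 : ℝ≥0∞) ≤ ∫⁻ s in Set.Ioi 0, ENNReal.ofReal (2 * peak A m r v) *
      ENNReal.ofReal (Real.exp (-(1 / (2 * r) * (s - 0)))) := by
    rw [← h.mass]
    refine setLIntegral_mono (by fun_prop) fun s hs => ?_
    rw [← ENNReal.ofReal_mul (by positivity)]
    refine ENNReal.ofReal_le_ofReal ?_
    refine (h.density_le_linear (le_of_lt hs)).trans ?_
    have := mul_le_mul_of_nonneg_left (mul_exp_one_sub_le_exp (s / r)) hM.le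
    have e : s / r / 2 = 1 / (2 * r) * (s - 0) := by field_simp; ring
    rw [e] at this
    linarith
  rw [lintegral_const_mul _ (by fun_prop), lintegral_Ioi_exp (by positivity),
    ← ENNReal.ofReal_mul (by positivity), ENNReal.one_le_ofReal] at h1
  have e : 2 * peak A m r v * (1 / (1 / (2 * r))) = 4 * (peak A m r v * r) := by field_simp; ring
  linarith

/-- For x = s/r ≤ 1/8 one has x e^{1-x} ≤ 1/2, so the density is at most M 2^{-m}, which beats Mr ≤
m + 1. -/
theorem lintegral_near_zero_le (h : IsRadialLaw A m V r v) :
    ∫⁻ s in Set.Ioc 0 (r / 8), ENNReal.ofReal (radialDensity A m V s) ≤ ENNReal.ofReal (1 / 8) := by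
  have hr := h.mode.r_pos
  have hM := h.peak_pos
  have h1 : ∀ s ∈ Set.Ioc 0 (r / 8), ENNReal.ofReal (radialDensity A m V s) ≤
      ENNReal.ofReal (peak A m r v * (1 / 2) ^ m) := fun s hs => by
    refine ENNReal.ofReal_le_ofReal ((h.density_le hs.1.le).trans ?_)
    have hs1 := hs.1
    have hx : s / r ≤ 1 / 8 := by rw [div_le_iff₀ hr]; linarith [hs.2]
    have hx0 : 0 ≤ s / r := by positivity
    have hexp : Real.exp (1 - s / r) ≤ 4 := by
      have : Real.exp (1 - s / r) ≤ Real.exp 1 := Real.exp_le_exp.2 (by linarith)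
      linarith [Real.exp_one_lt_d9]
    have : s / r * Real.exp (1 - s / r) ≤ 1 / 2 := by nlinarith [Real.exp_pos (1 - s / r)]
    gcongr
  refine (setLIntegral_mono (by fun_prop) h1).trans ?_
  rw [setLIntegral_const, Real.volume_Ioc, ← ENNReal.ofReal_mul (by positivity)]
  refine ENNReal.ofReal_le_ofReal ?_
  have h2 : ((m : ℝ) + 1) ≤ 2 ^ m := by
    exact_mod_cast Nat.lt_two_pow_self (n := m)
  have h3 : ((m : ℝ) + 1) * (1 / 2) ^ m ≤ 1 := by
    rw [one_div, inv_pow, ← div_eq_mul_inv, div_le_one (by positivity)]; exact h2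
  have h4 := mul_le_mul_of_nonneg_right h.peak_mul_le (by positivity : (0 : ℝ) ≤ (1 / 2) ^ m)
  linarith

/-- Log-concavity of the radial density between its mode and any other point. -/
theorem rpow_mul_rpow_le (h : IsRadialLaw A m V r v) {z t : ℝ} (hz : 0 < z) (hzr : z ≠ r)
    (ht0 : 0 < t) (ht1 : t < 1) :
    peak A m r v ^ (1 - t) * radialDensity A m V z ^ t ≤
      radialDensity A m V (r + t * (z - r)) := by
  have hr := h.mode.r_pos
  have hA := h.A_pos
  have hv := h.mode.v_pos
  set y := r + t * (z - r) with hy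
  have hy0 : 0 < y := by
    have e : y = (1 - t) * r + t * z := by rw [hy]; ring
    have : 0 < 1 - t := by linarith
    rw [e]; positivity
  rcases (h.profile.nonneg z).eq_or_lt with hVz | hVz
  · have : radialDensity A m V z = 0 := by unfold radialDensity; rw [← hVz]; ring
    rw [this, Real.zero_rpow ht0.ne', mul_zero]
    exact h.density_nonneg hy0.le
  have hfz : 0 < radialDensity A m V z := by unfold radialDensity; positivity
  -- The peak may not be attained at r, so log-concavity is used between b < r and z with the weight
  -- that still produces y; then b tends to r.
  have step : ∀ b, 0 < b → b < r → 0 < (y - b) / (z - b) → (y - b) / (z - b) < 1 → z - b ≠ 0 →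
      (A * b ^ m * v) ^ (1 - (y - b) / (z - b)) * radialDensity A m V z ^ ((y - b) / (z - b)) ≤
        radialDensity A m V y := by
    intro b hb hbr ht0' ht1' hzb
    set t' := (y - b) / (z - b) with ht'
    have ey : y = (1 - t') * b + t' * z := by rw [ht']; field_simp; ring
    have h1 := h.profile.logConcave hb.le hz.le ht0' ht1'
    rw [← ey] at h1
    have h2 := Real.geom_mean_le_arith_mean2_weighted (by linarith : 0 ≤ 1 - t') ht0'.le hb.le hz.le
      (by ring)
    rw [← ey] at h2
    have hVb := h.mode.lower b hb.le hbr
    have hVb0 : 0 < V b := hv.trans_le hVb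
    have h3 : (b ^ m) ^ (1 - t') * (z ^ m) ^ t' ≤ y ^ m := by
      have := pow_le_pow_left₀ (by positivity) h2 m
      rw [mul_pow, ← Real.rpow_natCast (b ^ (1 - t')), ← Real.rpow_natCast (z ^ t'),
        ← Real.rpow_mul hb.le, ← Real.rpow_mul hz.le, mul_comm (1 - t'), mul_comm t',
        Real.rpow_mul hb.le, Real.rpow_mul hz.le, Real.rpow_natCast, Real.rpow_natCast] at this
      exact this
    have h4 : A ^ (1 - t') * A ^ t' = A := by
      rw [← Real.rpow_add hA]; simp
    have h5 : v ^ (1 - t') ≤ V b ^ (1 - t') := Real.rpow_le_rpow hv.le hVb (by linarith)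
    unfold radialDensity
    rw [Real.mul_rpow (by positivity) hv.le, Real.mul_rpow hA.le (by positivity),
      Real.mul_rpow (by positivity) hVz.le, Real.mul_rpow hA.le (by positivity)]
    calc A ^ (1 - t') * (b ^ m) ^ (1 - t') * v ^ (1 - t') * (A ^ t' * (z ^ m) ^ t' * V z ^ t')
        = (A ^ (1 - t') * A ^ t') * ((b ^ m) ^ (1 - t') * (z ^ m) ^ t') *
            (v ^ (1 - t') * V z ^ t') := by ring
      _ ≤ A * y ^ m * V y := by
          rw [h4]
          refine mul_le_mul (mul_le_mul_of_nonneg_left h3 hA.le) ?_ (by positivity) (by positivity)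
          exact (mul_le_mul_of_nonneg_right h5 (by positivity)).trans h1
  have hzr' : z - r ≠ 0 := sub_ne_zero.2 hzr
  have et : (y - r) / (z - r) = t := by rw [hy]; field_simp; ring
  have limt : Tendsto (fun b => (y - b) / (z - b)) (𝓝[<] r) (𝓝 t) := by
    rw [← et]
    refine Tendsto.mono_left ?_ nhdsWithin_le_nhds
    refine ContinuousAt.tendsto (f := fun b => (y - b) / (z - b)) ?_
    fun_prop (disch := assumption)
  have limb : Tendsto (fun b => A * b ^ m * v) (𝓝[<] r) (𝓝 (peak A m r v)) := by
    refine Tendsto.mono_left ?_ nhdsWithin_le_nhds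
    refine ContinuousAt.tendsto (f := fun b => A * b ^ m * v) ?_
    fun_prop
  have lim := (limb.rpow ((tendsto_const_nhds (x := (1 : ℝ))).sub limt) (Or.inl h.peak_pos.ne')).mul
    ((tendsto_const_nhds (x := radialDensity A m V z)).rpow limt (Or.inl hfz.ne'))
  refine le_of_tendsto lim ?_
  filter_upwards [Ioo_mem_nhdsLT hr, limt.eventually (lt_mem_nhds ht0),
    limt.eventually (gt_mem_nhds ht1), (tendsto_nhdsWithin_of_tendsto_nhds
      (continuous_const.sub continuous_id).continuousAt).eventually_ne hzr'] with b hb h0 h1 hzb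
  exact step b hb.1 hb.2 h0 h1 hzb

theorem density_le_density (h : IsRadialLaw A m V r v) {z t : ℝ} (hz : 0 < z) (hzr : z ≠ r)
    (ht0 : 0 < t) (ht1 : t < 1) :
    radialDensity A m V z ≤ radialDensity A m V (r + t * (z - r)) := by
  refine le_trans ?_ (h.rpow_mul_rpow_le hz hzr ht0 ht1)
  have h1 := h.density_le_peak hz.le
  have h0 := h.density_nonneg hz.le
  calc radialDensity A m V z
      = radialDensity A m V z ^ (1 - t) * radialDensity A m V z ^ t := by
        rw [← Real.rpow_add_of_nonneg h0 (by linarith) ht0.le]; simp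
    _ ≤ _ := mul_le_mul_of_nonneg_right (Real.rpow_le_rpow h0 h1 (by linarith)) (by positivity)

theorem sq_peak_mul_density_le (h : IsRadialLaw A m V r v) {z : ℝ} (hz : 0 < z) (hzr : z ≠ r) :
    peak A m r v ^ 2 * radialDensity A m V z ≤ radialDensity A m V (r + 1 / 3 * (z - r)) ^ 3 := by
  have h1 := h.rpow_mul_rpow_le hz hzr (t := 1 / 3) (by norm_num) (by norm_num)
  have h0 := h.density_nonneg hz.le
  have hM := h.peak_pos
  have h2 := pow_le_pow_left₀ (by positivity) h1 3
  refine le_trans (le_of_eq ?_) h2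
  rw [mul_pow, ← Real.rpow_natCast (peak A m r v ^ _), ← Real.rpow_natCast (_ ^ (1 / 3 : ℝ)),
    ← Real.rpow_mul hM.le, ← Real.rpow_mul h0]
  norm_num

/-- By unimodality the density is at least its value at z on the whole interval between z and r, and
the mass there is at most 1. -/
theorem abs_sub_mul_density_le (h : IsRadialLaw A m V r v) {z : ℝ} (hz : 0 < z) :
    |z - r| * radialDensity A m V z ≤ 1 := by
  rcases eq_or_ne z r with rfl | hzr
  · simp
  have hr := h.mode.r_pos
  have h0 := h.density_nonneg hz.le
  have h1 : ∫⁻ _ in Set.Ioo (min z r) (max z r), ENNReal.ofReal (radialDensity A m V z) ≤ 1 := by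
    refine le_trans ?_ (h.setLIntegral_le_one (S := Set.Ioo (min z r) (max z r))
      fun s hs => (lt_min hz hr).trans hs.1)
    refine setLIntegral_mono h.measurable_density.ennreal_ofReal fun s hs =>
      ENNReal.ofReal_le_ofReal ?_
    have hzr' : z - r ≠ 0 := sub_ne_zero.2 hzr
    have e : s = r + (s - r) / (z - r) * (z - r) := by field_simp; ring
    rw [e]
    rcases lt_or_gt_of_ne hzr with hlt | hlt
    · rw [min_eq_left hlt.le, max_eq_right hlt.le] at hs
      refine h.density_le_density hz hzr ?_ ?_
      · exact div_pos_of_neg_of_neg (by linarith [hs.2]) (by linarith)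
      · rw [div_lt_one_of_neg (by linarith)]; linarith [hs.1]
    · rw [min_eq_right hlt.le, max_eq_left hlt.le] at hs
      refine h.density_le_density hz hzr ?_ ?_
      · exact div_pos (by linarith [hs.1]) (by linarith)
      · rw [div_lt_one (by linarith)]; linarith [hs.2]
  rw [setLIntegral_const, Real.volume_Ioo, ← ENNReal.ofReal_mul h0, ENNReal.ofReal_le_one,
    max_sub_min_eq_abs', mul_comm] at h1
  rwa [abs_sub_comm] at h1 ⊢

/-- Compare z with y = r + (z - r)/3. Log-concavity gives M² f(z) ≤ f(y)³, and |y - r| f(y) ≤ 1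
absorbs two of the factors: (z - r)² f(z) ≤ (9 / M²) f(y). The change of variables contributes the
remaining factor 3. -/
theorem lintegral_sq_sub_le (h : IsRadialLaw A m V r v) :
    ∫⁻ s in Set.Ioi 0, ENNReal.ofReal ((s - r) ^ 2) * ENNReal.ofReal (radialDensity A m V s) ≤
      ENNReal.ofReal (27 / peak A m r v ^ 2) := by
  have hr := h.mode.r_pos
  have hM := h.peak_pos
  have hmeas := h.measurable_density
  have hcov := lintegral_image_eq_lintegral_abs_deriv_mul (f := fun z => r + 1 / 3 * (z - r))
    (f' := fun _ => 1 / 3) (measurableSet_Ioi (a := (0 : ℝ)))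
    (fun x _ => by
      simpa using ((((hasDerivAt_id x).sub_const r).const_mul
        (1 / 3 : ℝ)).const_add r).hasDerivWithinAt)
    (fun a _ b _ hab => by simpa using hab)
    (fun s => ENNReal.ofReal (radialDensity A m V s))
  have hle : ∫⁻ s in (fun z => r + 1 / 3 * (z - r)) '' Set.Ioi 0,
      ENNReal.ofReal (radialDensity A m V s) ≤ 1 := by
    refine h.setLIntegral_le_one ?_
    rintro _ ⟨z, hz, rfl⟩
    have : 0 < z := hz
    show 0 < r + 1 / 3 * (z - r)
    linarith
  rw [hcov, lintegral_const_mul _ (by fun_prop)] at hle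
  have key : ∀ z ∈ Set.Ioi (0 : ℝ), ENNReal.ofReal ((z - r) ^ 2) *
      ENNReal.ofReal (radialDensity A m V z) ≤ ENNReal.ofReal (9 / peak A m r v ^ 2) *
        ENNReal.ofReal (radialDensity A m V (r + 1 / 3 * (z - r))) := by
    intro z hz
    rw [← ENNReal.ofReal_mul (by positivity), ← ENNReal.ofReal_mul (by positivity)]
    refine ENNReal.ofReal_le_ofReal ?_
    have hz0 : 0 < z := hz
    rcases eq_or_ne z r with rfl | hzr
    · have := h.density_nonneg hr.le
      simp only [sub_self, mul_zero, add_zero, zero_pow two_ne_zero, zero_mul]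
      positivity
    have hy0 : 0 < r + 1 / 3 * (z - r) := by linarith
    have h1 := h.sq_peak_mul_density_le hz0 hzr
    have h2 := h.abs_sub_mul_density_le hy0
    have h3 := h.density_nonneg hy0.le
    set F := radialDensity A m V (r + 1 / 3 * (z - r))
    have e : r + 1 / 3 * (z - r) - r = (z - r) / 3 := by ring
    rw [e] at h2
    have h4 : ((z - r) / 3) ^ 2 * F ^ 2 ≤ 1 := by
      rw [← sq_abs, ← mul_pow]
      exact pow_le_one₀ (by positivity) h2
    rw [div_mul_eq_mul_div, le_div_iff₀ (by positivity)]
    calc (z - r) ^ 2 * radialDensity A m V z * peak A m r v ^ 2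
        = (z - r) ^ 2 * (peak A m r v ^ 2 * radialDensity A m V z) := by ring
      _ ≤ (z - r) ^ 2 * F ^ 3 := mul_le_mul_of_nonneg_left h1 (sq_nonneg _)
      _ = 9 * (((z - r) / 3) ^ 2 * F ^ 2) * F := by ring
      _ ≤ 9 * 1 * F := by gcongr
      _ = 9 * F := by ring
  refine (setLIntegral_mono (by fun_prop) key).trans ?_
  rw [lintegral_const_mul _ (by fun_prop)]
  have e : ENNReal.ofReal (9 / peak A m r v ^ 2) =
      ENNReal.ofReal (27 / peak A m r v ^ 2) * ENNReal.ofReal |1 / 3| := by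
    rw [← ENNReal.ofReal_mul (by positivity), abs_of_pos (by norm_num)]
    congr 1; ring
  rw [e, mul_assoc]
  exact mul_le_of_le_one_right zero_le hle

end IsRadialLaw

/-! ### Moments of radial laws -/

/-- `R` is a nonnegative random variable with density `radialDensity A m V`. -/
structure HasRadialDensity {Ω : Type*} [MeasurableSpace Ω] (γ : Measure Ω) (R : Ω → ℝ)
    (A : ℝ) (m : ℕ) (V : ℝ → ℝ) : Prop where
  measurable : Measurable R
  nonneg : ∀ ω, 0 ≤ R ω
  lintegral_comp : ∀ g : ℝ → ℝ≥0∞, Measurable g → ∫⁻ ω, g (R ω) ∂γ =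
    ∫⁻ s in Set.Ioi 0, g s * ENNReal.ofReal (radialDensity A m V s)

namespace HasRadialDensity

variable {Ω : Type*} [MeasurableSpace Ω] {γ : Measure Ω} {R : Ω → ℝ}
  {A : ℝ} {m : ℕ} {V : ℝ → ℝ} {r v : ℝ}

theorem measure_preimage (hR : HasRadialDensity γ R A m V) {S : Set ℝ} (hS : MeasurableSet S) :
    γ (R ⁻¹' S) = ∫⁻ s in S ∩ Set.Ioi 0, ENNReal.ofReal (radialDensity A m V s) := by
  have h1 := hR.lintegral_comp (S.indicator 1) (measurable_one.indicator hS)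
  have e1 : ∀ ω, S.indicator (1 : ℝ → ℝ≥0∞) (R ω) = (R ⁻¹' S).indicator 1 ω := fun ω => rfl
  simp_rw [e1] at h1
  rw [lintegral_indicator_one (hR.measurable hS)] at h1
  rw [h1, ← Measure.restrict_restrict hS, ← lintegral_indicator hS]
  refine lintegral_congr fun s => ?_
  by_cases hs : s ∈ S <;> simp [hs]

theorem lintegral_sq_sub_le (hR : HasRadialDensity γ R A m V) (h : IsRadialLaw A m V r v) :
    ∫⁻ ω, ENNReal.ofReal ((R ω - r) ^ 2) ∂γ ≤ ENNReal.ofReal (27 / peak A m r v ^ 2) := by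
  rw [hR.lintegral_comp (fun s => ENNReal.ofReal ((s - r) ^ 2)) (by fun_prop)]
  exact h.lintegral_sq_sub_le

theorem memLp [IsProbabilityMeasure γ] (hR : HasRadialDensity γ R A m V)
    (h : IsRadialLaw A m V r v) : MemLp R 2 γ := by
  have hm := hR.measurable
  have h1 : MemLp (fun ω => R ω - r) 2 γ := by
    rw [memLp_two_iff_integrable_sq (by fun_prop)]
    refine ⟨by fun_prop, ?_⟩
    rw [hasFiniteIntegral_iff_ofReal (ae_of_all _ fun ω => sq_nonneg _)]
    exact (hR.lintegral_sq_sub_le h).trans_lt ENNReal.ofReal_lt_top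
  have h2 := h1.add (memLp_const r)
  refine (memLp_congr_ae (ae_of_all _ fun ω => ?_)).1 h2
  simp

theorem integral_sq_sub_le (hR : HasRadialDensity γ R A m V) (h : IsRadialLaw A m V r v) :
    ∫ ω, (R ω - r) ^ 2 ∂γ ≤ 27 / peak A m r v ^ 2 := by
  have hm := hR.measurable
  rw [integral_eq_lintegral_of_nonneg_ae (ae_of_all _ fun ω => sq_nonneg _) (by fun_prop)]
  exact ENNReal.toReal_le_of_le_ofReal (by positivity) (hR.lintegral_sq_sub_le h)

theorem variance_le [IsProbabilityMeasure γ] (hR : HasRadialDensity γ R A m V)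
    (h : IsRadialLaw A m V r v) :
    Var[R; γ] ≤ 27 / peak A m r v ^ 2 := by
  have hm := hR.measurable
  rw [← variance_sub_const (by fun_prop) r]
  exact (variance_le_expectation_sq (by fun_prop)).trans (hR.integral_sq_sub_le h)

/-- A density bounded by M puts mass at most 1/2 on an interval of length 1/(2M) around the mean;
Chebyshev's inequality handles the rest. -/
theorem le_variance [IsProbabilityMeasure γ] (hR : HasRadialDensity γ R A m V)
    (h : IsRadialLaw A m V r v) :
    1 / (32 * peak A m r v ^ 2) ≤ Var[R; γ] := by
  have hM := h.peak_pos
  set M := peak A m r v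
  set a := ∫ ω, R ω ∂γ with ha
  have hc : 0 < 1 / (4 * M) := by positivity
  have hcheb := meas_ge_le_variance_div_sq (hR.memLp h) hc
  have hsmall : γ {ω | 1 / (4 * M) ≤ |R ω - a|}ᶜ ≤ ENNReal.ofReal (1 / 2) := by
    have e : {ω | 1 / (4 * M) ≤ |R ω - a|}ᶜ = R ⁻¹' (Set.Ioo (a - 1 / (4 * M)) (a + 1 / (4 * M))) := by
      ext ω
      simp only [Set.mem_compl_iff, Set.mem_ofPred_eq, not_le, Set.mem_preimage, Set.mem_Ioo, abs_lt]
      constructor <;> rintro ⟨h1, h2⟩ <;> constructor <;> linarith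
    rw [e, hR.measure_preimage measurableSet_Ioo]
    calc ∫⁻ s in Set.Ioo (a - 1 / (4 * M)) (a + 1 / (4 * M)) ∩ Set.Ioi 0,
          ENNReal.ofReal (radialDensity A m V s)
        ≤ ∫⁻ s in Set.Ioo (a - 1 / (4 * M)) (a + 1 / (4 * M)) ∩ Set.Ioi 0, ENNReal.ofReal M :=
          setLIntegral_mono (by fun_prop) fun s hs =>
            ENNReal.ofReal_le_ofReal (h.density_le_peak (le_of_lt hs.2))
      _ ≤ ∫⁻ s in Set.Ioo (a - 1 / (4 * M)) (a + 1 / (4 * M)), ENNReal.ofReal M :=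
          lintegral_mono_set Set.inter_subset_left
      _ = ENNReal.ofReal (1 / 2) := by
          rw [setLIntegral_const, Real.volume_Ioo, ← ENNReal.ofReal_mul hM.le]
          congr 1; field_simp; ring
  have hmS : MeasurableSet {ω | 1 / (4 * M) ≤ |R ω - a|} := by
    have := hR.measurable
    exact measurableSet_le (by fun_prop) (by fun_prop)
  have htot : (1 : ℝ≥0∞) ≤ ENNReal.ofReal (Var[R; γ] / (1 / (4 * M)) ^ 2) + ENNReal.ofReal (1 / 2) := by
    rw [← prob_add_prob_compl (μ := γ) hmS]
    exact add_le_add hcheb hsmall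
  have hv0 : 0 ≤ Var[R; γ] := variance_nonneg _ _
  rw [← ENNReal.ofReal_add (by positivity) (by norm_num), ENNReal.one_le_ofReal] at htot
  have e : Var[R; γ] / (1 / (4 * M)) ^ 2 = 16 * M ^ 2 * Var[R; γ] := by field_simp; ring
  rw [e] at htot
  rw [div_le_iff₀ (by positivity)]
  linarith

theorem prob_le_near_zero (hR : HasRadialDensity γ R A m V) (h : IsRadialLaw A m V r v) :
    γ {ω | R ω ≤ r / 8} ≤ ENNReal.ofReal (1 / 8) := by
  have := hR.measure_preimage (S := Set.Iic (r / 8)) measurableSet_Iic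
  refine (le_of_eq this).trans ?_
  rw [Set.inter_comm, Set.Ioi_inter_Iic]
  exact h.lintegral_near_zero_le

theorem mean_le [IsProbabilityMeasure γ] (hR : HasRadialDensity γ R A m V)
    (h : IsRadialLaw A m V r v) :
    ∫ ω, R ω ∂γ ≤ 218 * r := by
  have hr := h.mode.r_pos
  have hL := hR.memLp h
  have hI : Integrable R γ := hL.integrable (by norm_num)
  have hI2 : Integrable (fun ω => (R ω - r) ^ 2) γ := (hL.sub (memLp_const r)).integrable_sq
  -- The inequality R - r ≤ r/2 + (R - r)²/(2r); since 1 ≤ 4Mr, the second moment 27/M² is at most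
  -- 16 · 27 r² = 432 r².
  have h1 : ∫ ω, R ω ∂γ ≤ ∫ ω, (3 / 2 * r + 1 / (2 * r) * (R ω - r) ^ 2) ∂γ := by
    refine integral_mono hI ((integrable_const _).add (hI2.const_mul _)) fun ω => ?_
    have : 0 ≤ 1 / (2 * r) * (R ω - r - r) ^ 2 := by positivity
    have e : 1 / (2 * r) * (R ω - r - r) ^ 2 =
      1 / (2 * r) * (R ω - r) ^ 2 - (R ω - r) + r / 2 := by field_simp; ring
    simp only
    linarith
  rw [integral_add (integrable_const _) (hI2.const_mul _),
    integral_const_mul (1 / (2 * r)) fun ω => (R ω - r) ^ 2] at h1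
  simp only [integral_const, probReal_univ, smul_eq_mul, one_mul] at h1
  have h2 := hR.integral_sq_sub_le h
  have h3 := h.one_le_peak_mul
  have hM := h.peak_pos
  set M := peak A m r v
  have h4 : 27 / M ^ 2 ≤ 432 * r ^ 2 := by
    rw [div_le_iff₀ (by positivity)]
    nlinarith [mul_pos hM hr]
  have h5 : 1 / (2 * r) * ∫ ω, (R ω - r) ^ 2 ∂γ ≤ 1 / (2 * r) * (432 * r ^ 2) :=
    mul_le_mul_of_nonneg_left (h2.trans h4) (by positivity)
  have e : 1 / (2 * r) * (432 * r ^ 2) = 216 * r := by field_simp; ring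
  linarith

theorem le_mean [IsProbabilityMeasure γ] (hR : HasRadialDensity γ R A m V)
    (h : IsRadialLaw A m V r v) :
    r / 10 ≤ ∫ ω, R ω ∂γ := by
  have hr := h.mode.r_pos
  have hI : Integrable R γ := (hR.memLp h).integrable (by norm_num)
  have h1 := mul_meas_ge_le_integral_of_nonneg (ae_of_all _ hR.nonneg) hI (r / 8)
  have h2 := hR.prob_le_near_zero h
  have hm := hR.measurable
  have h3 : (7 / 8 : ℝ) ≤ γ.real {ω | r / 8 ≤ R ω} := by
    have hc : 1 ≤ γ.real {ω | R ω ≤ r / 8} + γ.real {ω | r / 8 ≤ R ω} := by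
      rw [← probReal_univ (μ := γ)]
      refine (measureReal_mono ?_).trans (measureReal_union_le _ _)
      intro ω _
      exact le_total (R ω) (r / 8)
    have : γ.real {ω | R ω ≤ r / 8} ≤ 1 / 8 := ENNReal.toReal_le_of_le_ofReal (by norm_num) h2
    linarith
  nlinarith

/-- Markov's inequality for (R - r)² excludes at most 27/64 and the region near 0 at most 1/8, which
leaves 29/64 ≥ 1/4. -/
theorem le_prob_near_mode [IsProbabilityMeasure γ] (hR : HasRadialDensity γ R A m V)
    (h : IsRadialLaw A m V r v) :
    ENNReal.ofReal (1 / 4) ≤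
      γ {ω | r / 8 < R ω ∧ |R ω - r| < 8 / peak A m r v} := by
  have hM := h.peak_pos
  set M := peak A m r v
  have hm := hR.measurable
  have h1 := hR.prob_le_near_zero h
  have h2 : γ {ω | ENNReal.ofReal ((8 / M) ^ 2) ≤ ENNReal.ofReal ((R ω - r) ^ 2)} ≤
      ENNReal.ofReal (27 / 64) := by
    refine (meas_ge_le_lintegral_div (by fun_prop) (by simp; positivity) (by simp)).trans ?_
    rw [ENNReal.div_le_iff (by simp; positivity) (by simp), ← ENNReal.ofReal_mul (by norm_num)]
    refine (hR.lintegral_sq_sub_le h).trans (ENNReal.ofReal_le_ofReal (le_of_eq ?_))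
    show 27 / M ^ 2 = _
    field_simp
    norm_num
  have hc : (1 : ℝ≥0∞) ≤ γ {ω | r / 8 < R ω ∧ |R ω - r| < 8 / M} +
      (ENNReal.ofReal (1 / 8) + ENNReal.ofReal (27 / 64)) := by
    refine le_trans ?_ (add_le_add le_rfl (add_le_add h1 h2))
    rw [← measure_univ (μ := γ)]
    refine (measure_mono ?_).trans ((measure_union_le _ _).trans
      (add_le_add le_rfl (measure_union_le _ _)))
    intro ω _
    by_cases c1 : R ω ≤ r / 8
    · exact Or.inr (Or.inl c1)
    by_cases c2 : |R ω - r| < 8 / M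
    · exact Or.inl ⟨not_le.1 c1, c2⟩
    · refine Or.inr (Or.inr (ENNReal.ofReal_le_ofReal ?_))
      rw [← sq_abs (R ω - r)]
      exact pow_le_pow_left₀ (by positivity) (not_lt.1 c2) 2
  rw [← ENNReal.ofReal_add (by norm_num) (by norm_num)] at hc
  have h3 : ENNReal.ofReal (1 - (1 / 8 + 27 / 64)) ≤ γ {ω | r / 8 < R ω ∧ |R ω - r| < 8 / M} := by
    rw [ENNReal.ofReal_sub _ (by norm_num), ENNReal.ofReal_one]
    exact tsub_le_iff_right.2 hc
  exact (ENNReal.ofReal_le_ofReal (by norm_num)).trans h3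

/-- The quantity `√n / (√(E R) (Var R) ^ (1/4))` is comparable to `√(n M / r)`, where `r` is the
mode and `M` the peak of the density of `R`. -/
theorem sqrt_div_le [IsProbabilityMeasure γ] (hR : HasRadialDensity γ R A m V)
    (h : IsRadialLaw A m V r v) (n : ℝ)
    (hn : 0 ≤ n) :
    √n / (√(∫ ω, R ω ∂γ) * Var[R; γ] ^ (1 / 4 : ℝ)) ≤ 10 * √(n * peak A m r v / r) ∧
      √(n * peak A m r v / r) ≤ 40 * (√n / (√(∫ ω, R ω ∂γ) * Var[R; γ] ^ (1 / 4 : ℝ))) := by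
  have hr := h.mode.r_pos
  have hM := h.peak_pos
  have m1 := hR.mean_le h
  have m2 := hR.le_mean h
  have v1 := hR.variance_le h
  have v2 := hR.le_variance h
  set M := peak A m r v
  set a := ∫ ω, R ω ∂γ
  set σ := Var[R; γ]
  have ha : 0 < a := by linarith [div_pos hr (by norm_num : (0 : ℝ) < 10)]
  have hσ : 0 < σ := lt_of_lt_of_le (by positivity) v2
  have hq : σ ^ (1 / 4 : ℝ) = √(√σ) := by
    rw [Real.sqrt_eq_rpow, Real.sqrt_eq_rpow, ← Real.rpow_mul hσ.le]; norm_num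
  rw [hq, ← Real.sqrt_mul ha.le, ← Real.sqrt_div hn]
  have s1 : √σ ≤ 6 / M := by
    rw [Real.sqrt_le_left (by positivity)]
    refine v1.trans ?_
    rw [div_pow]
    gcongr
    norm_num
  have s2 : 1 / (6 * M) ≤ √σ := by
    refine Real.le_sqrt_of_sq_le (le_trans ?_ v2)
    rw [div_pow, mul_pow, one_pow]
    gcongr
    norm_num
  have hs0 : 0 < √σ := Real.sqrt_pos.2 hσ
  constructor
  · have e : (10 : ℝ) * √(n * M / r) = √(100 * (n * M / r)) := by
      rw [Real.sqrt_mul (by norm_num), show (100 : ℝ) = 10 ^ 2 by norm_num,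
        Real.sqrt_sq (by norm_num)]
    rw [e]
    refine Real.sqrt_le_sqrt ?_
    rw [div_le_iff₀ (by positivity)]
    have h1 : r / 10 * (1 / (6 * M)) ≤ a * √σ := mul_le_mul m2 s2 (by positivity) ha.le
    calc n ≤ 100 * (n * M / r) * (r / 10 * (1 / (6 * M))) := by
          have : 100 * (n * M / r) * (r / 10 * (1 / (6 * M))) = 10 / 6 * n := by
            field_simp; ring
          rw [this]; linarith
      _ ≤ _ := mul_le_mul_of_nonneg_left h1 (by positivity)
  · have e : (40 : ℝ) * √(n / (a * √σ)) = √(1600 * (n / (a * √σ))) := by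
      rw [Real.sqrt_mul (by norm_num), show (1600 : ℝ) = 40 ^ 2 by norm_num,
        Real.sqrt_sq (by norm_num)]
    rw [e]
    refine Real.sqrt_le_sqrt ?_
    rw [mul_div_assoc', le_div_iff₀ (by positivity)]
    have h1 : a * √σ ≤ 218 * r * (6 / M) := mul_le_mul m1 s1 hs0.le (by positivity)
    calc n * M / r * (a * √σ) ≤ n * M / r * (218 * r * (6 / M)) :=
          mul_le_mul_of_nonneg_left h1 (by positivity)
      _ = 1308 * n := by field_simp; ring
      _ ≤ _ := by linarith

end HasRadialDensity

/-! ### Metric projection and the normal flow of a convex set -/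

section MetricProjection

variable {E : Type*} [NormedAddCommGroup E] [InnerProductSpace ℝ E]

/-- `p` is the metric projection onto the convex set `Q`. -/
def IsMetricProj (Q : Set E) (p : E → E) : Prop :=
  ∀ x, p x ∈ Q ∧ ∀ w ∈ Q, inner ℝ (x - p x) (w - p x) ≤ 0

theorem exists_isMetricProj [CompleteSpace E] {Q : Set E} (hQ : Convex ℝ Q) (hc : IsClosed Q)
    (hne : Q.Nonempty) : ∃ p, IsMetricProj Q p := by
  have h : ∀ x, ∃ q ∈ Q, ∀ w ∈ Q, inner ℝ (x - q) (w - q) ≤ 0 := fun x => by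
    obtain ⟨q, hq, hmin⟩ := exists_norm_eq_iInf_of_complete_convex hne hc.isComplete hQ x
    exact ⟨q, hq, (norm_eq_iInf_iff_real_inner_le_zero hQ hq).1 hmin⟩
  choose p hp hp' using h
  exact ⟨p, fun x => ⟨hp x, hp' x⟩⟩

/-- The unit normal direction at a point outside of `Q`. -/
def outerNormal (p : E → E) (x : E) : E := ‖x - p x‖⁻¹ • (x - p x)

/-- The normal flow: move the distance `t` away from `Q`. -/
def normalFlow (p : E → E) (t : ℝ) (x : E) : E := x + t • outerNormal p x

/-- The points whose distance to `Q` is in `(0, ε]`. -/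
def shell (p : E → E) (ε : ℝ) : Set E := {x | 0 < ‖x - p x‖ ∧ ‖x - p x‖ ≤ ε}

theorem norm_outerNormal {p : E → E} {x : E} (hx : 0 < ‖x - p x‖) : ‖outerNormal p x‖ = 1 := by
  rw [outerNormal, norm_smul, norm_inv, norm_norm, inv_mul_cancel₀ hx.ne']

theorem smul_outerNormal {p : E → E} {x : E} (hx : 0 < ‖x - p x‖) :
    ‖x - p x‖ • outerNormal p x = x - p x := by
  rw [outerNormal, smul_smul, mul_inv_cancel₀ hx.ne', one_smul]

namespace IsMetricProj

variable {Q : Set E} {p : E → E}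

theorem norm_sub_le (hp : IsMetricProj Q p) {q : E} (hq : q ∈ Q) (x : E) :
    ‖x - p x‖ ≤ ‖x - q‖ := by
  have h := (hp x).2 q hq
  have e : x - q = (x - p x) - (q - p x) := by abel
  have h1 : ‖x - q‖ ^ 2 = ‖x - p x‖ ^ 2 - 2 * inner ℝ (x - p x) (q - p x) + ‖q - p x‖ ^ 2 := by
    rw [e, norm_sub_sq_real]
  refine le_of_sq_le_sq ?_ (norm_nonneg _)
  nlinarith [sq_nonneg ‖q - p x‖]

theorem eq_of_inner_le (hp : IsMetricProj Q p) {q x : E} (hq : q ∈ Q)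
    (h : ∀ w ∈ Q, inner ℝ (x - q) (w - q) ≤ 0) : p x = q := by
  have h1 := (hp x).2 q hq
  have h2 := h _ (hp x).1
  have h3 : inner ℝ (q - p x) (q - p x) ≤ (0 : ℝ) := by
    have e : inner ℝ (q - p x) (q - p x) =
        inner ℝ (x - p x) (q - p x) + inner ℝ (x - q) (p x - q) := by
      rw [← neg_sub q (p x), inner_neg_right, ← sub_eq_add_neg, ← inner_sub_left]
      congr 1; abel
    linarith
  have := real_inner_self_nonpos.1 h3
  exact (sub_eq_zero.1 this).symm

theorem lipschitz (hp : IsMetricProj Q p) : LipschitzWith 1 p := by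
  refine LipschitzWith.of_dist_le_mul fun x y => ?_
  rw [NNReal.coe_one, one_mul, dist_eq_norm, dist_eq_norm]
  have h1 := (hp x).2 _ (hp y).1
  have h2 := (hp y).2 _ (hp x).1
  have e : ‖p x - p y‖ ^ 2 = inner ℝ (x - y) (p x - p y) + inner ℝ (x - p x) (p y - p x) +
      inner ℝ (y - p y) (p x - p y) := by
    rw [← neg_sub (p x) (p y), inner_neg_right, ← real_inner_self_eq_norm_sq]
    simp only [inner_sub_left]
    ring
  have h3 := real_inner_le_norm (x - y) (p x - p y)
  by_contra hcon
  push Not at hcon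
  nlinarith [norm_nonneg (x - y), norm_nonneg (p x - p y)]

theorem continuous_dist (hp : IsMetricProj Q p) : Continuous fun x => ‖x - p x‖ :=
  (continuous_id.sub hp.lipschitz.continuous).norm

theorem inner_outerNormal_nonpos (hp : IsMetricProj Q p) {w : E} (hw : w ∈ Q) (x : E) :
    inner ℝ (outerNormal p x) (w - p x) ≤ 0 := by
  rw [outerNormal, real_inner_smul_left]
  exact mul_nonpos_of_nonneg_of_nonpos (by positivity) ((hp x).2 w hw)

/-- The distance function is convex, with the outer normal as a subgradient. -/
theorem dist_add_inner_le (hp : IsMetricProj Q p) {x : E} (hx : 0 < ‖x - p x‖) (y : E) :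
    ‖x - p x‖ + inner ℝ (outerNormal p x) (y - x) ≤ ‖y - p y‖ := by
  have h1 := hp.inner_outerNormal_nonpos (hp y).1 x
  have h2 := real_inner_le_norm (outerNormal p x) (y - p y)
  rw [norm_outerNormal hx, one_mul] at h2
  have h3 : inner ℝ (outerNormal p x) (x - p x) = ‖x - p x‖ := by
    rw [outerNormal, real_inner_smul_left, real_inner_self_eq_norm_sq]
    field_simp
  have e : y - x = (y - p y) + (p y - p x) - (x - p x) := by abel
  rw [e, inner_sub_right, inner_add_right]
  linarith

theorem normalFlow_eq {x : E} (hx : 0 < ‖x - p x‖) (t : ℝ) :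
    normalFlow p t x = p x + (‖x - p x‖ + t) • outerNormal p x := by
  rw [normalFlow, add_smul, smul_outerNormal hx]
  abel

theorem proj_normalFlow (hp : IsMetricProj Q p) {x : E} (hx : 0 < ‖x - p x‖) {t : ℝ}
    (ht : 0 ≤ t) : p (normalFlow p t x) = p x := by
  refine hp.eq_of_inner_le (hp x).1 fun w hw => ?_
  rw [normalFlow_eq hx, add_sub_cancel_left, real_inner_smul_left]
  exact mul_nonpos_of_nonneg_of_nonpos (by positivity) (hp.inner_outerNormal_nonpos hw x)

theorem normalFlow_sub_proj (hp : IsMetricProj Q p) {x : E} (hx : 0 < ‖x - p x‖) {t : ℝ}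
    (ht : 0 ≤ t) :
    normalFlow p t x - p (normalFlow p t x) = (‖x - p x‖ + t) • outerNormal p x := by
  rw [hp.proj_normalFlow hx ht, normalFlow_eq hx, add_sub_cancel_left]

theorem dist_normalFlow (hp : IsMetricProj Q p) {x : E} (hx : 0 < ‖x - p x‖) {t : ℝ}
    (ht : 0 ≤ t) : ‖normalFlow p t x - p (normalFlow p t x)‖ = ‖x - p x‖ + t := by
  rw [hp.normalFlow_sub_proj hx ht, norm_smul, norm_outerNormal hx, mul_one, Real.norm_eq_abs,
    abs_of_pos (by positivity)]

theorem outerNormal_normalFlow (hp : IsMetricProj Q p) {x : E} (hx : 0 < ‖x - p x‖) {t : ℝ}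
    (ht : 0 ≤ t) : outerNormal p (normalFlow p t x) = outerNormal p x := by
  rw [outerNormal, hp.dist_normalFlow hx ht, hp.normalFlow_sub_proj hx ht, smul_smul,
    inv_mul_cancel₀ (by positivity), one_smul]

theorem normalFlow_neg_normalFlow (hp : IsMetricProj Q p) {x : E} (hx : 0 < ‖x - p x‖) {t : ℝ}
    (ht : 0 ≤ t) : normalFlow p (-t) (normalFlow p t x) = x := by
  rw [normalFlow, hp.outerNormal_normalFlow hx ht, normalFlow, neg_smul]
  abel

/-- The backward normal flow is nonexpansive where it does not reach `Q`. -/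
theorem lipschitzOnWith_normalFlow_neg (hp : IsMetricProj Q p) {t : ℝ} (ht : 0 ≤ t) :
    LipschitzOnWith 1 (normalFlow p (-t)) {y | t < ‖y - p y‖} := by
  refine LipschitzOnWith.of_dist_le_mul fun x hx y hy => ?_
  have hx' : t < ‖x - p x‖ := hx
  have hy' : t < ‖y - p y‖ := hy
  have hx0 : 0 < ‖x - p x‖ := ht.trans_lt hx'
  have hy0 : 0 < ‖y - p y‖ := ht.trans_lt hy'
  rw [NNReal.coe_one, one_mul, dist_eq_norm, dist_eq_norm]
  set a := outerNormal p x with ha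
  set b := outerNormal p y with hb
  set S := normalFlow p (-t) x - normalFlow p (-t) y with hS
  have e1 : x - y = S + t • (a - b) := by
    rw [hS, normalFlow, normalFlow, smul_sub, neg_smul, neg_smul]; abel
  have e2 : S = (p x - p y) + ((‖x - p x‖ - t) • a - (‖y - p y‖ - t) • b) := by
    rw [hS, normalFlow_eq hx0, normalFlow_eq hy0, ← sub_eq_add_neg, ← sub_eq_add_neg]; abel
  have haa : inner ℝ a a = (1 : ℝ) := by
    rw [real_inner_self_eq_norm_sq, ha, norm_outerNormal hx0, one_pow]
  have hbb : inner ℝ b b = (1 : ℝ) := by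
    rw [real_inner_self_eq_norm_sq, hb, norm_outerNormal hy0, one_pow]
  have hab : inner ℝ a b ≤ (1 : ℝ) := by
    have := real_inner_le_norm a b
    rwa [ha, hb, norm_outerNormal hx0, norm_outerNormal hy0, one_mul] at this
  have i1 : inner ℝ a (p y - p x) ≤ (0 : ℝ) := hp.inner_outerNormal_nonpos (hp y).1 x
  have i2 : inner ℝ b (p x - p y) ≤ (0 : ℝ) := hp.inner_outerNormal_nonpos (hp x).1 y
  -- The normal field is monotone along the backward images, so adding t (a - b) to their difference
  -- S cannot shorten it. Both residual distances are positive because the points lie farther than t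
  -- from Q.
  have key : (0 : ℝ) ≤ inner ℝ S (a - b) := by
    have : inner ℝ S (a - b) = -inner ℝ a (p y - p x) - inner ℝ b (p x - p y) +
        ((‖x - p x‖ - t) + (‖y - p y‖ - t)) * (1 - inner ℝ a b) := by
      rw [e2, inner_add_left, inner_sub_left ((‖x - p x‖ - t) • a), real_inner_smul_left,
        real_inner_smul_left, inner_sub_right a, inner_sub_right b, haa, hbb,
        real_inner_comm a b, real_inner_comm (a - b) (p x - p y), ← neg_sub (p x) (p y),
        inner_neg_right, inner_sub_left a b]
      ring
    rw [this]
    have : 0 ≤ ((‖x - p x‖ - t) + (‖y - p y‖ - t)) * (1 - inner ℝ a b) :=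
      mul_nonneg (by linarith) (by linarith)
    linarith
  refine le_of_sq_le_sq ?_ (norm_nonneg _)
  rw [e1, norm_add_sq_real, real_inner_smul_right]
  have : 0 ≤ ‖t • (a - b)‖ ^ 2 := sq_nonneg _
  have := mul_nonneg ht key
  linarith

theorem diff_subset_shell (hp : IsMetricProj Q p) {ε : ℝ} (hε : 0 ≤ ε) :
    (Q + ε • Metric.closedBall (0 : E) 1) \ Q ⊆ shell p ε := by
  rintro x ⟨⟨q, hq, _, ⟨b, hb, rfl⟩, rfl⟩, hx⟩
  refine ⟨norm_pos_iff.2 (sub_ne_zero.2 fun h => hx (h ▸ (hp _).1)), ?_⟩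
  refine (hp.norm_sub_le hq _).trans ?_
  have : ‖b‖ ≤ 1 := by simpa using hb
  simp only [add_sub_cancel_left, norm_smul, Real.norm_eq_abs, abs_of_nonneg hε]
  nlinarith

/-! ### Volume expansion along the normal flow -/

section Measure

variable [MeasurableSpace E] [BorelSpace E]

theorem measurableSet_shell (hp : IsMetricProj Q p) (ε : ℝ) : MeasurableSet (shell p ε) :=
  (measurableSet_lt measurable_const hp.continuous_dist.measurable).inter
    (measurableSet_le hp.continuous_dist.measurable measurable_const)

variable [FiniteDimensional ℝ E]

theorem measurable_outerNormal (hp : IsMetricProj Q p) : Measurable (outerNormal p) :=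
  hp.continuous_dist.measurable.inv.smul
    (continuous_id.sub hp.lipschitz.continuous).measurable

theorem measurable_normalFlow (hp : IsMetricProj Q p) (t : ℝ) : Measurable (normalFlow p t) :=
  measurable_id.add (hp.measurable_outerNormal.const_smul t)

/-- Lebesgue measure is a multiple of Hausdorff measure of the same dimension, which nonexpansive
maps do not increase; no differentiability is needed. -/
theorem _root_.LipschitzOnWith.volume_image_le_of_one {f : E → E} {s : Set E}
    (hf : LipschitzOnWith 1 f s) : volume (f '' s) ≤ volume s := by
  rw [← InnerProductSpace.euclideanHausdorffMeasure_eq_volume,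
    Measure.euclideanHausdorffMeasure_def, Measure.smul_apply, Measure.smul_apply]
  refine smul_le_smul_of_nonneg_left ?_ zero_le
  simpa using hf.hausdorffMeasure_image_le (Nat.cast_nonneg (Module.finrank ℝ E))

/-- The normal flow does not decrease volumes. -/
theorem setLIntegral_normalFlow_le (hp : IsMetricProj Q p) {ε t : ℝ} (ht : 0 ≤ t)
    {g : E → ℝ≥0∞} (hg : Measurable g) :
    ∫⁻ x in shell p ε, g (normalFlow p t x) ≤
      ∫⁻ y in {y | t < ‖y - p y‖ ∧ ‖y - p y‖ ≤ t + ε}, g y := by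
  have hT := hp.measurable_normalFlow t
  rw [← lintegral_map hg hT]
  refine lintegral_mono' ?_ le_rfl
  refine Measure.le_iff.2 fun B hB => ?_
  rw [Measure.map_apply hT hB, Measure.restrict_apply (hT hB), Measure.restrict_apply hB]
  set W := normalFlow p t '' (normalFlow p t ⁻¹' B ∩ shell p ε) with hW
  -- The backward flow maps W onto the original set and is 1-Lipschitz, so the original volume is at
  -- most that of W.
  have h1 : normalFlow p (-t) '' W = normalFlow p t ⁻¹' B ∩ shell p ε := by
    rw [hW, Set.image_image]
    conv_rhs => rw [← Set.image_id (normalFlow p t ⁻¹' B ∩ shell p ε)]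
    exact Set.image_congr fun x hx => hp.normalFlow_neg_normalFlow hx.2.1 ht
  have h2 : W ⊆ B ∩ {y | t < ‖y - p y‖ ∧ ‖y - p y‖ ≤ t + ε} := by
    rintro _ ⟨x, ⟨hxB, hx⟩, rfl⟩
    refine ⟨hxB, ?_⟩
    simp only [Set.mem_ofPred_eq]
    rw [hp.dist_normalFlow hx.1 ht]
    exact ⟨by linarith [hx.1], by linarith [hx.2]⟩
  rw [← h1]
  refine le_trans ?_ (measure_mono h2)
  exact ((hp.lipschitzOnWith_normalFlow_neg ht).mono
    fun y hy => (h2 hy).2.1).volume_image_le_of_one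

/-- At time jε the shell sits at distances in (jε, (j+1)ε] from Q; these layers are disjoint. Both
parts of the upper bound rest on this. -/
theorem tsum_setLIntegral_normalFlow_le (hp : IsMetricProj Q p) {ε : ℝ} (hε : 0 < ε)
    {g : E → ℝ≥0∞} (hg : Measurable g) :
    ∑' j : ℕ, ∫⁻ x in shell p ε, g (normalFlow p (j * ε) x) ≤ ∫⁻ y, g y := by
  refine (ENNReal.tsum_le_tsum fun j =>
    hp.setLIntegral_normalFlow_le (mul_nonneg (Nat.cast_nonneg j) hε.le) hg).trans ?_
  rw [← lintegral_iUnion]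
  · exact setLIntegral_le_lintegral _ _
  · intro j
    exact (measurableSet_lt measurable_const hp.continuous_dist.measurable).inter
      (measurableSet_le hp.continuous_dist.measurable measurable_const)
  · intro i j hij
    refine Set.disjoint_left.2 fun y hi hj => ?_
    rcases lt_or_gt_of_ne hij with h | h
    · have : ((i : ℝ) + 1) * ε ≤ j * ε := by
        have : (i : ℝ) + 1 ≤ j := by exact_mod_cast h
        gcongr
      linarith [hi.2, hj.1]
    · have : ((j : ℝ) + 1) * ε ≤ i * ε := by
        have : (j : ℝ) + 1 ≤ i := by exact_mod_cast h
        gcongr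
      linarith [hj.2, hi.1]

end Measure

end IsMetricProj

end MetricProjection

/-! ### Polar coordinates -/

section Polar

variable {m : ℕ}

/-- The unit sphere of `ℝ^(m+1)` as a measure. -/
abbrev sphereMeasure (m : ℕ) :
    Measure (Metric.sphere (0 : EuclideanSpace ℝ (Fin (m + 1))) 1) :=
  (volume : Measure (EuclideanSpace ℝ (Fin (m + 1)))).toSphere

/-- The surface area of the unit sphere of `ℝ^(m+1)`. -/
def sphereArea (m : ℕ) : ℝ := (sphereMeasure m).real Set.univ

theorem sphereArea_pos (m : ℕ) : 0 < sphereArea m := by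
  refine ENNReal.toReal_pos ?_ (measure_ne_top _ _)
  exact (Measure.measure_univ_ne_zero).2 (Measure.toSphere_ne_zero _)

theorem ofReal_sphereArea (m : ℕ) : ENNReal.ofReal (sphereArea m) = sphereMeasure m Set.univ :=
  ENNReal.ofReal_toReal (measure_ne_top _ _)

theorem lintegral_polar {G : EuclideanSpace ℝ (Fin (m + 1)) → ℝ≥0∞} (hG : Measurable G) :
    ∫⁻ x, G x = ∫⁻ θ, (∫⁻ s in Set.Ioi (0 : ℝ),
      ENNReal.ofReal (s ^ m) * G (s • (θ : EuclideanSpace ℝ (Fin (m + 1))))) ∂sphereMeasure m := by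
  have hmp := (volume : Measure (EuclideanSpace ℝ (Fin (m + 1)))).measurePreserving_homeomorphUnitSphereProd
  have hfin : Module.finrank ℝ (EuclideanSpace ℝ (Fin (m + 1))) - 1 = m := by simp
  rw [hfin] at hmp
  have h1 : ∫⁻ x, G x = ∫⁻ x : ({0}ᶜ : Set (EuclideanSpace ℝ (Fin (m + 1)))), G x.1
      ∂(volume.comap Subtype.val) := by
    rw [lintegral_subtype_comap (measurableSet_singleton _).compl, restrict_compl_singleton]
  have h2 := hmp.lintegral_comp_emb (Homeomorph.measurableEmbedding _)
    (fun z => G ((z.2 : ℝ) • (z.1 : EuclideanSpace ℝ (Fin (m + 1)))))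
  have h3 : ∀ x : ({0}ᶜ : Set (EuclideanSpace ℝ (Fin (m + 1)))),
      G (((homeomorphUnitSphereProd (EuclideanSpace ℝ (Fin (m + 1))) x).2 : ℝ) •
        ((homeomorphUnitSphereProd (EuclideanSpace ℝ (Fin (m + 1))) x).1 :
          EuclideanSpace ℝ (Fin (m + 1)))) = G x := by
    intro x
    congr 1
    simp only [homeomorphUnitSphereProd_apply_snd_coe, homeomorphUnitSphereProd_apply_fst_coe]
    rw [smul_smul, mul_inv_cancel₀ (norm_ne_zero_iff.2 x.2), one_smul]
  simp_rw [h3] at h2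
  rw [h1, h2, lintegral_prod _ (by fun_prop)]
  refine lintegral_congr fun θ => ?_
  rw [Measure.volumeIoiPow, lintegral_withDensity_eq_lintegral_mul _ (by fun_prop) (by fun_prop)]
  exact lintegral_subtype_comap measurableSet_Ioi
    (fun s => ENNReal.ofReal (s ^ m) * G (s • (θ : EuclideanSpace ℝ (Fin (m + 1)))))

theorem lintegral_comp_norm {g : ℝ → ℝ≥0∞} (hg : Measurable g) :
    ∫⁻ x : EuclideanSpace ℝ (Fin (m + 1)), g ‖x‖ =
      ENNReal.ofReal (sphereArea m) * ∫⁻ s in Set.Ioi (0 : ℝ), ENNReal.ofReal (s ^ m) * g s := by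
  rw [lintegral_polar (by fun_prop)]
  have h : ∀ θ : Metric.sphere (0 : EuclideanSpace ℝ (Fin (m + 1))) 1,
      ∫⁻ s in Set.Ioi (0 : ℝ), ENNReal.ofReal (s ^ m) *
        g ‖s • (θ : EuclideanSpace ℝ (Fin (m + 1)))‖ =
      ∫⁻ s in Set.Ioi (0 : ℝ), ENNReal.ofReal (s ^ m) * g s := fun θ => by
    refine setLIntegral_congr_fun measurableSet_Ioi fun s hs => ?_
    have hs0 : (0 : ℝ) < s := hs
    simp only [norm_smul, norm_eq_of_mem_sphere θ, mul_one, Real.norm_eq_abs, abs_of_pos hs0]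
  simp_rw [h]
  rw [lintegral_const, ofReal_sphereArea, mul_comm]

end Polar

/-! ### Weighted shells around convex sets compared with balls -/

theorem pow_le_sub_pow_add {s ε : ℝ} {m : ℕ} (hm : m ≠ 0) (hε : 0 ≤ ε) (hs : ε < s) :
    s ^ m ≤ (s - ε) ^ m + m * ε * s ^ (m - 1) := by
  obtain ⟨k, rfl⟩ := Nat.exists_eq_succ_of_ne_zero hm
  have hs0 : 0 < s := hε.trans_lt hs
  have h1 := one_add_mul_le_pow (a := -(ε / s)) (by
    have : ε / s ≤ 1 := (div_le_one hs0).2 hs.le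
    linarith) (k + 1)
  have h2 := mul_le_mul_of_nonneg_left h1 (by positivity : 0 ≤ s ^ (k + 1))
  have e1 : s ^ (k + 1) * (1 + -(ε / s)) ^ (k + 1) = (s - ε) ^ (k + 1) := by
    rw [← mul_pow]; congr 1; field_simp; ring
  have e2 : s ^ (k + 1) * (1 + ((k + 1 : ℕ) : ℝ) * -(ε / s)) =
      s ^ (k + 1) - ((k + 1 : ℕ) : ℝ) * ε * s ^ k := by
    rw [pow_succ]; field_simp; ring
  rw [e1, e2] at h2
  simp only [Nat.succ_eq_add_one, Nat.add_sub_cancel]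
  linarith

/-- A discrete integration by parts: shifting the second term by ε leaves s ^ m - (s - ε) ^ m
against w, at most m ε s ^ (m - 1) by Bernoulli. On (0, ε] there is no shifted term, and s ≤ mε
suffices. -/
theorem lintegral_pow_mul_sub_le {m : ℕ} (hm : m ≠ 0) {w : ℝ → ℝ≥0∞} (hw : Antitone w)
    (hfin : ∫⁻ s in Set.Ioi (0 : ℝ), ENNReal.ofReal (s ^ m) * w s ≠ ∞) {ε : ℝ} (hε : 0 < ε) :
    ∫⁻ s in Set.Ioi (0 : ℝ), ENNReal.ofReal (s ^ m) * (w s - w (s + ε)) ≤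
      ENNReal.ofReal (m * ε) * ∫⁻ s in Set.Ioi (0 : ℝ), ENNReal.ofReal (s ^ (m - 1)) * w s := by
  have hwm : Measurable w := hw.measurable
  have hle : ∀ s, ENNReal.ofReal (s ^ m) * w (s + ε) ≤ ENNReal.ofReal (s ^ m) * w s := fun s =>
    mul_le_mul_right (hw (by linarith)) _
  simp_rw [ENNReal.mul_sub fun _ _ => ENNReal.ofReal_ne_top]
  rw [lintegral_sub (by fun_prop) (ne_top_of_le_ne_top hfin (lintegral_mono hle))
    (ae_of_all _ hle), tsub_le_iff_left]
  have hshift : ∫⁻ s in Set.Ioi (0 : ℝ), ENNReal.ofReal (s ^ m) * w (s + ε) =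
      ∫⁻ s in Set.Ioi ε, ENNReal.ofReal ((s - ε) ^ m) * w s := by
    rw [← lintegral_indicator measurableSet_Ioi, ← lintegral_indicator measurableSet_Ioi,
      
      ← lintegral_add_right_eq_self ((Set.Ioi ε).indicator _) ε]
    refine lintegral_congr fun s => ?_
    by_cases hs : 0 < s
    · rw [Set.indicator_of_mem (by simpa using hs), Set.indicator_of_mem (by simpa using hs)]
      simp
    · rw [Set.indicator_of_notMem (by simpa using hs), Set.indicator_of_notMem (by simpa using hs)]
  rw [hshift, ← lintegral_const_mul _ (by fun_prop),
    ← Set.Ioc_union_Ioi_eq_Ioi hε.le, lintegral_union measurableSet_Ioi (Set.Ioc_disjoint_Ioi le_rfl),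
    lintegral_union measurableSet_Ioi (Set.Ioc_disjoint_Ioi le_rfl), add_left_comm,
    ← lintegral_add_left (by fun_prop)]
  refine add_le_add (setLIntegral_mono (by fun_prop) fun s hs => ?_)
    (setLIntegral_mono (by fun_prop) fun s hs => ?_)
  · rw [← mul_assoc, ← ENNReal.ofReal_mul (by positivity)]
    refine mul_le_mul_left (ENNReal.ofReal_le_ofReal ?_) _
    obtain ⟨k, rfl⟩ := Nat.exists_eq_succ_of_ne_zero hm
    simp only [Nat.succ_eq_add_one, Nat.add_sub_cancel]
    have hs0 := hs.1
    have h1 : s ≤ ((k + 1 : ℕ) : ℝ) * ε := by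
      have : (1 : ℝ) ≤ ((k + 1 : ℕ) : ℝ) := by push_cast; linarith [Nat.cast_nonneg (α := ℝ) k]
      nlinarith [hs.2]
    rw [pow_succ, mul_comm]
    gcongr
  · have hs' : ε < s := hs
    rw [← mul_assoc, ← add_mul, ← ENNReal.ofReal_mul (by positivity),
      ← ENNReal.ofReal_add (by have : 0 ≤ s - ε := by linarith
                               positivity) (by have : 0 ≤ s := by linarith
                                               positivity)]
    exact mul_le_mul_left (ENNReal.ofReal_le_ofReal (pow_le_sub_pow_add hm hε.le hs')) _

/-- For a nonincreasing radial weight, the weighted volume of a shell around a convex set is at most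
that obtained from a ball. -/
theorem IsMetricProj.setLIntegral_shell_le {m : ℕ} (hm : m ≠ 0)
    {Q : Set (EuclideanSpace ℝ (Fin (m + 1)))}
    {p : EuclideanSpace ℝ (Fin (m + 1)) → EuclideanSpace ℝ (Fin (m + 1))}
    (hp : IsMetricProj Q p) {w : ℝ → ℝ≥0∞} (hw : Antitone w) (hw0 : Tendsto w atTop (𝓝 0))
    (hfin : ∫⁻ s in Set.Ioi (0 : ℝ), ENNReal.ofReal (s ^ m) * w s ≠ ∞) {ε : ℝ} (hε : 0 < ε) :
    ∫⁻ x in shell p ε, w ‖x‖ ≤ ENNReal.ofReal ε * (ENNReal.ofReal (m * sphereArea m) *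
      ∫⁻ s in Set.Ioi (0 : ℝ), ENNReal.ofReal (s ^ (m - 1)) * w s) := by
  have hwm : Measurable w := hw.measurable
  set D : EuclideanSpace ℝ (Fin (m + 1)) → ℝ≥0∞ := fun y => w ‖y‖ - w (‖y‖ + ε) with hD
  have hDm : Measurable D := by fun_prop
  -- Telescoping along the flow: one step of length ε raises the norm by at most ε, so the loss of w
  -- is at most D, and w vanishes at infinity because the flow line escapes.
  have hpt : ∀ x ∈ shell p ε, w ‖x‖ ≤ ∑' j : ℕ, D (normalFlow p (j * ε) x) := by
    intro x hx
    have hind : ∀ J : ℕ, w ‖x‖ ≤ ∑ j ∈ Finset.range J, D (normalFlow p (j * ε) x) +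
        w ‖normalFlow p (J * ε) x‖ := by
      intro J
      induction J with
      | zero => simp [normalFlow]
      | succ J ih =>
        refine ih.trans ?_
        rw [Finset.sum_range_succ, add_assoc]
        refine add_le_add le_rfl ?_
        have h1 : ‖normalFlow p ((J + 1 : ℕ) * ε) x‖ ≤ ‖normalFlow p (J * ε) x‖ + ε := by
          have e : normalFlow p ((J + 1 : ℕ) * ε) x =
              normalFlow p (J * ε) x + ε • outerNormal p x := by
            simp only [normalFlow]
            push_cast
            rw [add_mul, add_smul, one_mul, add_assoc]
          rw [e]
          refine (norm_add_le _ _).trans (add_le_add le_rfl ?_)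
          rw [norm_smul, norm_outerNormal hx.1, mul_one, Real.norm_eq_abs, abs_of_pos hε]
        calc w ‖normalFlow p (J * ε) x‖ ≤ D (normalFlow p (J * ε) x) +
              w (‖normalFlow p (J * ε) x‖ + ε) := le_tsub_add
          _ ≤ _ := add_le_add le_rfl (hw h1)
    have hT : Tendsto (fun J : ℕ => ‖normalFlow p (J * ε) x‖) atTop atTop := by
      refine tendsto_atTop_mono (f := fun J : ℕ => (J : ℝ) * ε - ‖x‖) (fun J => ?_) ?_
      · have h2 : normalFlow p (J * ε) x = ((J : ℝ) * ε) • outerNormal p x - (-x) := by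
          rw [normalFlow]; abel
        rw [h2]
        refine le_trans (le_of_eq ?_) (norm_sub_norm_le _ _)
        rw [norm_smul, norm_outerNormal hx.1, mul_one, norm_neg, Real.norm_eq_abs,
          abs_of_nonneg (by positivity)]
      · exact tendsto_atTop_add_const_right _ _
          (tendsto_natCast_atTop_atTop.atTop_mul_const hε)
    have hlim := (ENNReal.summable (f := fun j : ℕ => D (normalFlow p (j * ε) x))).hasSum.tendsto_sum_nat.add
      (hw0.comp hT)
    rw [add_zero] at hlim
    exact ge_of_tendsto' hlim hind
  calc ∫⁻ x in shell p ε, w ‖x‖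
      ≤ ∫⁻ x in shell p ε, ∑' j : ℕ, D (normalFlow p (j * ε) x) :=
        setLIntegral_mono (Measurable.tsum fun j =>
          hDm.comp (hp.measurable_normalFlow _)) hpt
    _ = ∑' j : ℕ, ∫⁻ x in shell p ε, D (normalFlow p (j * ε) x) :=
        lintegral_tsum fun j => (hDm.comp (hp.measurable_normalFlow _)).aemeasurable
    _ ≤ ∫⁻ y, D y := hp.tsum_setLIntegral_normalFlow_le hε hDm
    _ = ENNReal.ofReal (sphereArea m) *
          ∫⁻ s in Set.Ioi (0 : ℝ), ENNReal.ofReal (s ^ m) * (w s - w (s + ε)) :=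
        lintegral_comp_norm (g := fun s => w s - w (s + ε)) (by fun_prop)
    _ ≤ ENNReal.ofReal (sphereArea m) * (ENNReal.ofReal (m * ε) *
          ∫⁻ s in Set.Ioi (0 : ℝ), ENNReal.ofReal (s ^ (m - 1)) * w s) :=
        mul_le_mul_right (lintegral_pow_mul_sub_le hm hw hfin hε) _
    _ = _ := by
        have := (sphereArea_pos m).le
        rw [← mul_assoc, ← mul_assoc, ← ENNReal.ofReal_mul this, ← ENNReal.ofReal_mul hε.le]
        congr 2; ring

/-! ### Rotation-invariant measures -/

/-- `γ` has density `B * V(‖x‖)` on `ℝ^(m+1)`, and its radial density has mode `r`. -/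
structure IsRadialMeasure {m : ℕ} (γ : Measure (EuclideanSpace ℝ (Fin (m + 1)))) (B : ℝ)
    (V : ℝ → ℝ) (r v : ℝ) : Prop where
  B_pos : 0 < B
  eq_withDensity : γ = volume.withDensity fun x => ENNReal.ofReal (B * V ‖x‖)
  law : IsRadialLaw (B * sphereArea m) m V r v

/-! ### The mode of order 2m and the exponential continuation beyond it -/

theorem IsRadialLaw.exists_isMode {A : ℝ} {m : ℕ} {V : ℝ → ℝ} {r v : ℝ}
    (h : IsRadialLaw A m V r v) {k : ℕ} (hk : k ≠ 0) : ∃ r' v', IsMode V k r' v' := by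
  have hr := h.mode.r_pos
  have hv := h.mode.v_pos
  refine h.profile.exists_isMode (s₀ := r / 2) (s₁ := 2 * r) (by positivity)
    (hv.trans_le (h.mode.lower _ (by positivity) (by linarith))) (by positivity) ?_ hk
  refine lt_of_le_of_lt (h.mode.upper _ (by positivity))
    (lt_of_lt_of_le ?_ (h.mode.lower 0 le_rfl hr))
  refine mul_lt_of_lt_one_right hv (Real.exp_lt_one_iff.2 ?_)
  have e : 2 * r / r - 1 = 1 := by field_simp; ring
  rw [e, mul_one, neg_lt_zero]
  exact_mod_cast Nat.pos_of_ne_zero h.m_ne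

theorem IsRadialLaw.tendsto_zero {A : ℝ} {m : ℕ} {V : ℝ → ℝ} {r v : ℝ}
    (h : IsRadialLaw A m V r v) : Tendsto V atTop (𝓝 0) := by
  have hr := h.mode.r_pos
  have hm : (0 : ℝ) < m := by exact_mod_cast Nat.pos_of_ne_zero h.m_ne
  have h1 : Tendsto (fun s : ℝ => v * Real.exp (-(m * (s / r - 1)))) atTop (𝓝 (v * 0)) := by
    refine (Real.tendsto_exp_neg_atTop_nhds_zero.comp ?_).const_mul v
    exact (tendsto_atTop_add_const_right _ (-1) (tendsto_id.atTop_div_const hr)).const_mul_atTop hm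
  rw [mul_zero] at h1
  refine squeeze_zero' (Eventually.of_forall h.profile.nonneg) ?_ h1
  filter_upwards [eventually_ge_atTop 0] with s hs using h.mode.upper s hs

/-- The profile `V`, continued exponentially beyond the mode `r` of order `k`. -/
def expContinuation (V : ℝ → ℝ) (k : ℕ) (r v s : ℝ) : ℝ :=
  if s < r then V s else v * Real.exp (-(k * (s / r - 1)))

theorem IsMode.exp_mul_le_expContinuation {V : ℝ → ℝ} (hV : IsProfile V) {k : ℕ} {r v : ℝ}
    (h : IsMode V k r v) {a s : ℝ} (ha : 0 ≤ a) (has : a ≤ s) :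
    V a * Real.exp (-(k * ((s - a) / r))) ≤ expContinuation V k r v s := by
  unfold expContinuation
  split_ifs with hs
  · exact h.exp_mul_le hV ha has hs
  · have h1 := mul_le_mul_of_nonneg_right (h.upper a ha) (Real.exp_pos (-(k * ((s - a) / r)))).le
    refine h1.trans (le_of_eq ?_)
    rw [mul_assoc, ← Real.exp_add]
    congr 2
    have := h.r_pos
    field_simp
    ring

theorem pow_le_pow_mul_exp {s r : ℝ} (hs : 0 ≤ s) (hr : 0 < r) (m : ℕ) :
    s ^ m ≤ r ^ m * Real.exp (m * (s / r - 1)) := by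
  have h1 : s / r ≤ Real.exp (s / r - 1) := by
    have := Real.add_one_le_exp (s / r - 1); linarith
  have h2 := pow_le_pow_left₀ (by positivity) h1 m
  rw [div_pow, div_le_iff₀ (by positivity), ← Real.exp_nat_mul] at h2
  linarith

theorem IsRadialLaw.mul_pow_le_peak {A : ℝ} {m : ℕ} {V : ℝ → ℝ} {r v : ℝ}
    (h : IsRadialLaw A m V r v) {k : ℕ} {r' v' : ℝ} (h' : IsMode V k r' v') :
    A * r' ^ m * v' ≤ peak A m r v := by
  have hA := h.A_pos
  have hr' := h'.r_pos
  have lim : Tendsto (fun s : ℝ => A * s ^ m * v') (𝓝[<] r') (𝓝 (A * r' ^ m * v')) := by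
    refine Tendsto.mono_left ?_ nhdsWithin_le_nhds
    refine ContinuousAt.tendsto (f := fun s : ℝ => A * s ^ m * v') ?_
    fun_prop
  refine le_of_tendsto lim ?_
  filter_upwards [Ioo_mem_nhdsLT hr'] with s hs
  have hs0 := hs.1
  refine le_trans ?_ (h.density_le_peak hs.1.le)
  exact mul_le_mul_of_nonneg_left (h'.lower s hs.1.le hs.2) (by positivity)

/-- This is why the order is doubled: the growth of s ^ j with j ≤ m uses at most half of the
exponent 2m, and the remaining rate m / r makes the tail as short as r / m. -/
theorem setLIntegral_exp_tail_le {A r v : ℝ} {m k : ℕ} (hm : m ≠ 0) (hA : 0 ≤ A) (hr : 0 < r)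
    (hv : 0 ≤ v) (k_eq : k = 2 * m) (j : ℕ) (hj : j ≤ m) :
    ∫⁻ s in Set.Ioi r, ENNReal.ofReal (A * s ^ j * (v * Real.exp (-(k * (s / r - 1))))) ≤
      ENNReal.ofReal (A * r ^ (j + 1) * v / m) := by
  have hm' : (0 : ℝ) < m := by exact_mod_cast Nat.pos_of_ne_zero hm
  have h1 : ∀ s ∈ Set.Ioi r, ENNReal.ofReal (A * s ^ j * (v * Real.exp (-(k * (s / r - 1))))) ≤
      ENNReal.ofReal (A * r ^ j * v) * ENNReal.ofReal (Real.exp (-(m / r * (s - r)))) := by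
    intro s hs
    have hs' : r < s := hs
    have hs0 : 0 < s := hr.trans hs'
    rw [← ENNReal.ofReal_mul (by positivity)]
    refine ENNReal.ofReal_le_ofReal ?_
    have h2 := pow_le_pow_mul_exp hs0.le hr j
    have h3 : (0 : ℝ) ≤ s / r - 1 := by
      rw [sub_nonneg, le_div_iff₀ hr]; linarith
    have h4 : Real.exp (j * (s / r - 1)) * Real.exp (-(k * (s / r - 1))) ≤
        Real.exp (-(m / r * (s - r))) := by
      rw [← Real.exp_add]
      refine Real.exp_le_exp.2 ?_
      have e : (m : ℝ) / r * (s - r) = m * (s / r - 1) := by field_simp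
      rw [e, k_eq]
      have : (j : ℝ) ≤ m := by exact_mod_cast hj
      push_cast
      nlinarith
    calc A * s ^ j * (v * Real.exp (-(k * (s / r - 1))))
        ≤ A * (r ^ j * Real.exp (j * (s / r - 1))) * (v * Real.exp (-(k * (s / r - 1)))) := by
          gcongr
      _ = A * r ^ j * v * (Real.exp (j * (s / r - 1)) * Real.exp (-(k * (s / r - 1)))) := by ring
      _ ≤ _ := mul_le_mul_of_nonneg_left h4 (by positivity)
  refine (setLIntegral_mono (by fun_prop) h1).trans ?_
  rw [lintegral_const_mul _ (by fun_prop), lintegral_Ioi_exp (by positivity),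
    ← ENNReal.ofReal_mul (by positivity)]
  refine ENNReal.ofReal_le_ofReal (le_of_eq ?_)
  rw [pow_succ]
  field_simp

/-- Below r' nothing has changed and the mass is at most 1; the exponential tail has at most (m +
1)/m ≤ 2. The continuation thus stays almost a probability density while its logarithmic slope never
exceeds 2m / r'. -/
theorem IsRadialLaw.lintegral_expContinuation_le {A : ℝ} {m : ℕ} {V : ℝ → ℝ} {r v : ℝ}
    (h : IsRadialLaw A m V r v) {r' v' : ℝ} (h' : IsMode V (2 * m) r' v') :
    ∫⁻ s in Set.Ioi 0, ENNReal.ofReal (A * s ^ m * expContinuation V (2 * m) r' v' s) ≤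
      ENNReal.ofReal 3 := by
  have hA := h.A_pos
  have hr' := h'.r_pos
  have hv' := h'.v_pos
  have hm' : (1 : ℝ) ≤ m := by exact_mod_cast Nat.pos_of_ne_zero h.m_ne
  rw [← Set.Ioo_union_Ici_eq_Ioi hr', lintegral_union measurableSet_Ici
    (Set.disjoint_left.2 fun s hs hs' => absurd hs.2 (not_lt.2 hs')), setLIntegral_congr (Ioi_ae_eq_Ici (a := r')).symm]
  have h1 : ∫⁻ s in Set.Ioo 0 r', ENNReal.ofReal (A * s ^ m * expContinuation V (2 * m) r' v' s) ≤
      ENNReal.ofReal 1 := by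
    rw [ENNReal.ofReal_one]
    refine le_trans (le_of_eq ?_) (h.setLIntegral_le_one (S := Set.Ioo 0 r') fun s hs => hs.1)
    refine setLIntegral_congr_fun measurableSet_Ioo fun s hs => ?_
    simp only [expContinuation, if_pos hs.2, radialDensity]
  have h2 : ∫⁻ s in Set.Ioi r', ENNReal.ofReal (A * s ^ m * expContinuation V (2 * m) r' v' s) ≤
      ENNReal.ofReal 2 := by
    have e : ∫⁻ s in Set.Ioi r', ENNReal.ofReal (A * s ^ m * expContinuation V (2 * m) r' v' s) =
        ∫⁻ s in Set.Ioi r', ENNReal.ofReal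
          (A * s ^ m * (v' * Real.exp (-((2 * m : ℕ) * (s / r' - 1))))) := by
      refine setLIntegral_congr_fun measurableSet_Ioi fun s hs => ?_
      have : ¬ s < r' := not_lt.2 (le_of_lt hs)
      simp only [expContinuation, if_neg this]
    rw [e]
    refine (setLIntegral_exp_tail_le h.m_ne hA.le hr' hv'.le rfl m le_rfl).trans
      (ENNReal.ofReal_le_ofReal ?_)
    rw [div_le_iff₀ (by linarith)]
    have := h.mul_pow_le_of_le hr'.le hv'.le h'.lower
    linarith
  refine (add_le_add h1 h2).trans (le_of_eq ?_)
  rw [← ENNReal.ofReal_add (by norm_num) (by norm_num)]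
  norm_num

/-- One of the m factors (s/r) e^{1-s/r} pays for the missing power of s; the other m - 1 are at
most 1/2 each, and m ≤ 2 ^ (m - 1). -/
theorem IsRadialLaw.lintegral_low_le {A : ℝ} {m : ℕ} {V : ℝ → ℝ} {r v : ℝ}
    (h : IsRadialLaw A m V r v) :
    ∫⁻ s in Set.Ioc 0 (r / 8), ENNReal.ofReal (m * A * s ^ (m - 1) * V s) ≤
      ENNReal.ofReal (peak A m r v) := by
  obtain ⟨k, hk⟩ := Nat.exists_eq_succ_of_ne_zero h.m_ne
  have hr := h.mode.r_pos
  have hM := h.peak_pos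
  have hA := h.A_pos
  have h1 : ∀ s ∈ Set.Ioc 0 (r / 8), ENNReal.ofReal (m * A * s ^ (m - 1) * V s) ≤
      ENNReal.ofReal (m * (peak A m r v * (4 / r * (1 / 2) ^ k))) := by
    intro s hs
    have hs0 := hs.1
    refine ENNReal.ofReal_le_ofReal ?_
    have h2 := h.density_le hs.1.le
    have hx : s / r ≤ 1 / 8 := by rw [div_le_iff₀ hr]; linarith [hs.2]
    have hx0 : 0 < s / r := by positivity
    have hexp : Real.exp (1 - s / r) ≤ 4 := by
      have : Real.exp (1 - s / r) ≤ Real.exp 1 := Real.exp_le_exp.2 (by linarith)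
      linarith [Real.exp_one_lt_d9]
    have hhalf : s / r * Real.exp (1 - s / r) ≤ 1 / 2 := by
      nlinarith [Real.exp_pos (1 - s / r)]
    have h3 : s * (m * A * s ^ (m - 1) * V s) ≤
        s * (m * (peak A m r v * (4 / r * (1 / 2) ^ k))) := by
      calc s * (m * A * s ^ (m - 1) * V s) = m * radialDensity A m V s := by
            rw [radialDensity, hk]
            simp only [Nat.succ_eq_add_one, Nat.add_sub_cancel, pow_succ]
            ring
        _ ≤ m * (peak A m r v * (s / r * Real.exp (1 - s / r)) ^ m) := by gcongr
        _ = m * (peak A m r v * ((s / r * Real.exp (1 - s / r)) *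
              (s / r * Real.exp (1 - s / r)) ^ k)) := by
            rw [← pow_succ', ← Nat.succ_eq_add_one, ← hk]
        _ ≤ m * (peak A m r v * ((s / r * 4) * (1 / 2) ^ k)) := by gcongr
        _ = _ := by ring
    exact le_of_mul_le_mul_left h3 hs0
  refine (setLIntegral_mono (by fun_prop) h1).trans ?_
  rw [setLIntegral_const, Real.volume_Ioc, ← ENNReal.ofReal_mul (by positivity)]
  refine ENNReal.ofReal_le_ofReal ?_
  have h2 : (m : ℝ) ≤ 2 ^ k := by
    rw [hk]; exact_mod_cast Nat.lt_two_pow_self (n := k)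
  have h3 : (m : ℝ) * (1 / 2) ^ k ≤ 1 := by
    rw [one_div, inv_pow, ← div_eq_mul_inv, div_le_one (by positivity)]; exact h2
  have e : m * (peak A m r v * (4 / r * (1 / 2) ^ k)) * (r / 8 - 0) =
      peak A m r v * ((m : ℝ) * (1 / 2) ^ k) / 2 := by field_simp; ring
  rw [e]
  nlinarith

/-- Capping V at v' makes each of the pieces below and above r' at most A r' ^ m v', which is a
limit of values bounded by the peak. -/
theorem IsRadialLaw.lintegral_high_le {A : ℝ} {m : ℕ} {V : ℝ → ℝ} {r v : ℝ}
    (h : IsRadialLaw A m V r v) {r' v' : ℝ} (h' : IsMode V (2 * m) r' v') :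
    ∫⁻ s in Set.Ioi 0, ENNReal.ofReal (m * A * s ^ (m - 1) * min (V s) v') ≤
      ENNReal.ofReal (2 * peak A m r v) := by
  obtain ⟨k, hk⟩ := Nat.exists_eq_succ_of_ne_zero h.m_ne
  have hr' := h'.r_pos
  have hv' := h'.v_pos
  have hA := h.A_pos
  have hm' : (0 : ℝ) < m := by exact_mod_cast Nat.pos_of_ne_zero h.m_ne
  have hf := h.mul_pow_le_peak h'
  have hpow : r' ^ (m - 1 + 1) = r' ^ m := by rw [hk]; rfl
  rw [← Set.Ioc_union_Ioi_eq_Ioi hr'.le, lintegral_union measurableSet_Ioi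
    (Set.Ioc_disjoint_Ioi le_rfl)]
  have h1 : ∫⁻ s in Set.Ioc 0 r', ENNReal.ofReal (m * A * s ^ (m - 1) * min (V s) v') ≤
      ENNReal.ofReal (peak A m r v) := by
    have h2 : ∀ s ∈ Set.Ioc 0 r', ENNReal.ofReal (m * A * s ^ (m - 1) * min (V s) v') ≤
        ENNReal.ofReal (m * A * v') * ENNReal.ofReal (s ^ (m - 1)) := fun s hs => by
      rw [← ENNReal.ofReal_mul (by positivity)]
      refine ENNReal.ofReal_le_ofReal ?_
      have hs0 := hs.1
      have := mul_le_mul_of_nonneg_left (min_le_right (V s) v')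
        (by positivity : 0 ≤ m * A * s ^ (m - 1))
      linarith
    refine (setLIntegral_mono (by fun_prop) h2).trans ?_
    rw [lintegral_const_mul _ (by fun_prop), lintegral_Ioc_pow _ hr'.le,
      ← ENNReal.ofReal_mul (by positivity), hpow]
    refine ENNReal.ofReal_le_ofReal (le_trans (le_of_eq ?_) hf)
    have : ((m - 1 : ℕ) : ℝ) + 1 = m := by rw [hk]; push_cast; simp
    rw [this]
    field_simp
  have h2 : ∫⁻ s in Set.Ioi r', ENNReal.ofReal (m * A * s ^ (m - 1) * min (V s) v') ≤
      ENNReal.ofReal (peak A m r v) := by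
    refine (setLIntegral_mono (g := fun s => ENNReal.ofReal
      (m * A * s ^ (m - 1) * (v' * Real.exp (-((2 * m : ℕ) * (s / r' - 1)))))) (by fun_prop)
      fun s hs => ENNReal.ofReal_le_ofReal ?_).trans ?_
    · have hs0 : 0 < s := hr'.trans hs
      exact mul_le_mul_of_nonneg_left ((min_le_left _ _).trans (h'.upper s hs0.le)) (by positivity)
    · refine (setLIntegral_exp_tail_le h.m_ne (by positivity) hr' hv'.le rfl (m - 1)
        (Nat.sub_le _ _)).trans (ENNReal.ofReal_le_ofReal (le_trans (le_of_eq ?_) hf))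
      rw [hpow]
      field_simp
  refine (add_le_add h1 h2).trans (le_of_eq ?_)
  have := h.peak_pos.le
  rw [← ENNReal.ofReal_add this this, two_mul]

/-! ### The upper bound for the surface area -/

namespace IsRadialMeasure

variable {m : ℕ} {γ : Measure (EuclideanSpace ℝ (Fin (m + 1)))} {B : ℝ} {V : ℝ → ℝ} {r v : ℝ}

theorem hasRadialDensity (h : IsRadialMeasure γ B V r v) :
    HasRadialDensity γ (fun x => ‖x‖) (B * sphereArea m) m V where
  measurable := measurable_norm
  nonneg := fun x => norm_nonneg x
  lintegral_comp := fun g hg => by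
    have hV := h.law.profile.measurable
    have hω := sphereArea_pos m
    have hB := h.B_pos
    rw [h.eq_withDensity, lintegral_withDensity_eq_lintegral_mul _ (by fun_prop) (by fun_prop)]
    have := lintegral_comp_norm (m := m) (g := fun s => ENNReal.ofReal (B * V s) * g s)
      (by fun_prop)
    refine this.trans ?_
    rw [← lintegral_const_mul _ (by fun_prop)]
    refine setLIntegral_congr_fun measurableSet_Ioi fun s hs => ?_
    have hs0 : 0 < s := hs
    have hVs := h.law.profile.nonneg s
    simp only [radialDensity]
    rw [← mul_assoc, ← mul_assoc, ← ENNReal.ofReal_mul hω.le, ← ENNReal.ofReal_mul (by positivity),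
      mul_comm (g s)]
    congr 2; ring

theorem isProbabilityMeasure (h : IsRadialMeasure γ B V r v) : IsProbabilityMeasure γ := by
  refine ⟨?_⟩
  have h1 := h.hasRadialDensity.measure_preimage MeasurableSet.univ
  rw [Set.preimage_univ, Set.univ_inter, h.law.mass] at h1
  exact h1

theorem apply_eq (h : IsRadialMeasure γ B V r v) {S : Set (EuclideanSpace ℝ (Fin (m + 1)))}
    (hS : MeasurableSet S) : γ S = ∫⁻ x in S, ENNReal.ofReal (B * V ‖x‖) := by
  rw [h.eq_withDensity, withDensity_apply _ hS]

variable {Q : Set (EuclideanSpace ℝ (Fin (m + 1)))}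
  {p : EuclideanSpace ℝ (Fin (m + 1)) → EuclideanSpace ℝ (Fin (m + 1))} {ε : ℝ}

theorem measurable_weight (h : IsRadialMeasure γ B V r v) :
    Measurable fun x : EuclideanSpace ℝ (Fin (m + 1)) => ENNReal.ofReal (B * V ‖x‖) := by
  have hV := h.law.profile.measurable
  fun_prop

/-- A bound for the part of the shell on which `V` agrees with a smaller antitone profile `W`. -/
theorem measure_le_of_antitone (h : IsRadialMeasure γ B V r v) (hp : IsMetricProj Q p)
    (hε : 0 < ε) {W : ℝ → ℝ} (hW : Antitone W) (hW0 : ∀ s, 0 ≤ W s) (hWV : ∀ s, 0 < s → W s ≤ V s)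
    {S : Set (EuclideanSpace ℝ (Fin (m + 1)))} (hS : MeasurableSet S) (hSW : ∀ x ∈ S, V ‖x‖ = W ‖x‖)
    {c : ℝ} (hc : ∫⁻ s in Set.Ioi 0,
      ENNReal.ofReal (m * (B * sphereArea m) * s ^ (m - 1) * W s) ≤ ENNReal.ofReal c) :
    γ (shell p ε ∩ S) ≤ ENNReal.ofReal ε * ENNReal.ofReal c := by
  have hB := h.B_pos
  have hω := sphereArea_pos m
  have hWm : Measurable W := hW.measurable
  set w : ℝ → ℝ≥0∞ := fun s => ENNReal.ofReal (B * W s) with hw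
  have hanti : Antitone w := fun a b hab =>
    ENNReal.ofReal_le_ofReal (mul_le_mul_of_nonneg_left (hW hab) hB.le)
  have hlim : Tendsto w atTop (𝓝 0) := by
    have h1 : Tendsto W atTop (𝓝 0) := by
      refine squeeze_zero' (Eventually.of_forall hW0) ?_ h.law.tendsto_zero
      filter_upwards [eventually_gt_atTop 0] with s hs using hWV s hs
    have := ENNReal.tendsto_ofReal (h1.const_mul B)
    simpa using this
  have hfin : ∫⁻ s in Set.Ioi (0 : ℝ), ENNReal.ofReal (s ^ m) * w s ≠ ∞ := by
    have h2 : ENNReal.ofReal (sphereArea m) *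
        ∫⁻ s in Set.Ioi (0 : ℝ), ENNReal.ofReal (s ^ m) * w s ≤ 1 := by
      rw [← lintegral_const_mul _ (by fun_prop), ← h.law.mass]
      refine setLIntegral_mono h.law.measurable_density.ennreal_ofReal fun s hs => ?_
      have hs0 : 0 < s := hs
      rw [hw, ← ENNReal.ofReal_mul (by positivity), ← ENNReal.ofReal_mul hω.le]
      refine ENNReal.ofReal_le_ofReal ?_
      have := mul_le_mul_of_nonneg_left (hWV s hs0) (by positivity : 0 ≤ B * sphereArea m * s ^ m)
      unfold radialDensity
      linarith
    intro htop
    rw [htop, ENNReal.mul_top (by simpa using hω)] at h2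
    exact absurd h2 (by simp)
  have hmain := hp.setLIntegral_shell_le h.law.m_ne hanti hlim hfin hε
  calc γ (shell p ε ∩ S) = ∫⁻ x in shell p ε ∩ S, ENNReal.ofReal (B * V ‖x‖) :=
        h.apply_eq ((hp.measurableSet_shell ε).inter hS)
    _ = ∫⁻ x in shell p ε ∩ S, w ‖x‖ := by
        refine setLIntegral_congr_fun ((hp.measurableSet_shell ε).inter hS) fun x hx => ?_
        simp only [hw, hSW x hx.2]
    _ ≤ ∫⁻ x in shell p ε, w ‖x‖ := lintegral_mono_set Set.inter_subset_left
    _ ≤ _ := hmain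
    _ ≤ _ := by
        refine mul_le_mul_right (le_trans (le_of_eq ?_) hc) _
        rw [← lintegral_const_mul _ (by fun_prop)]
        refine setLIntegral_congr_fun measurableSet_Ioi fun s hs => ?_
        have hs0 : 0 < s := hs
        simp only [hw]
        rw [← ENNReal.ofReal_mul (by positivity), ← ENNReal.ofReal_mul (by positivity)]
        congr 1; ring

theorem measure_low_le (h : IsRadialMeasure γ B V r v) (hp : IsMetricProj Q p) (hε : 0 < ε) :
    γ (shell p ε ∩ {x | ‖x‖ ≤ r / 8}) ≤
      ENNReal.ofReal ε * ENNReal.ofReal (peak (B * sphereArea m) m r v) := by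
  refine h.measure_le_of_antitone hp hε (W := fun s => if s ≤ r / 8 then V s else 0) ?_ ?_ ?_
    (measurableSet_le measurable_norm measurable_const) ?_ ?_
  · intro a b hab
    have h1 := h.law.profile.anti hab
    have h2 := h.law.profile.nonneg a
    simp only
    split_ifs with hb ha ha
    · exact h1
    · exact absurd (hab.trans hb) ha
    · exact h2
    · exact le_rfl
  · intro s
    have := h.law.profile.nonneg s
    split_ifs <;> simp [this]
  · intro s _
    have := h.law.profile.nonneg s
    split_ifs <;> simp [this]
  · intro x hx
    have : ‖x‖ ≤ r / 8 := hx
    simp only [if_pos this]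
  · refine le_trans (le_of_eq ?_) h.law.lintegral_low_le
    rw [← Set.Ioi_inter_Iic, Set.inter_comm, ← Measure.restrict_restrict measurableSet_Iic,
      ← lintegral_indicator measurableSet_Iic]
    refine lintegral_congr fun s => ?_
    by_cases hs : s ≤ r / 8
    · rw [Set.indicator_of_mem (by exact hs), if_pos hs]
    · rw [Set.indicator_of_notMem (by exact hs), if_neg hs]
      simp

/-- The capped profile min V v' is antitone and agrees with V beyond r', because the tangent bound
is below v' there. -/
theorem measure_high_le (h : IsRadialMeasure γ B V r v) (hp : IsMetricProj Q p) (hε : 0 < ε)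
    {r' v' : ℝ} (h' : IsMode V (2 * m) r' v') :
    γ (shell p ε ∩ {x | r' ≤ ‖x‖}) ≤
      ENNReal.ofReal ε * ENNReal.ofReal (2 * peak (B * sphereArea m) m r v) := by
  refine h.measure_le_of_antitone hp hε (W := fun s => min (V s) v')
    (fun a b hab => min_le_min (h.law.profile.anti hab) le_rfl)
    (fun s => le_min (h.law.profile.nonneg s) h'.v_pos.le) (fun s _ => min_le_left _ _)
    (measurableSet_le measurable_const measurable_norm) ?_ (h.law.lintegral_high_le h')
  intro x hx
  have hx' : r' ≤ ‖x‖ := hx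
  refine (min_eq_left ((h'.upper _ (norm_nonneg x)).trans ?_)).symm
  refine mul_le_of_le_one_right h'.v_pos.le (Real.exp_le_one_iff.2 ?_)
  have : 1 ≤ ‖x‖ / r' := (one_le_div h'.r_pos).2 hx'
  rw [neg_nonpos]
  exact mul_nonneg (by positivity) (by linarith)

/-- The part of the shell where the outer normal makes a small angle with the radius. -/
theorem measure_transversal_le (h : IsRadialMeasure γ B V r v) (hp : IsMetricProj Q p)
    {u : ℝ} (hu : 0 < u) :
    γ (shell p ε ∩ {x | u * ‖x‖ ≤ inner ℝ (outerNormal p x) x}) ≤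
      ENNReal.ofReal (peak (B * sphereArea m) m r v * (ε / u)) := by
  have hω := sphereArea_pos m
  have hB := h.B_pos
  have hM := h.law.peak_pos
  set M := peak (B * sphereArea m) m r v
  set S := shell p ε ∩ {x | u * ‖x‖ ≤ inner ℝ (outerNormal p x) x} with hS
  have hνm := hp.measurable_outerNormal
  have hSm : MeasurableSet S := (hp.measurableSet_shell ε).inter
    (measurableSet_le (by fun_prop) (hνm.inner measurable_id))
  have hVm := h.measurable_weight
  rw [h.apply_eq hSm, ← lintegral_indicator hSm, lintegral_polar (hVm.indicator hSm)]
  have hray : ∀ θ : Metric.sphere (0 : EuclideanSpace ℝ (Fin (m + 1))) 1,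
      ∫⁻ s in Set.Ioi (0 : ℝ), ENNReal.ofReal (s ^ m) * S.indicator
        (fun x => ENNReal.ofReal (B * V ‖x‖)) (s • (θ : EuclideanSpace ℝ (Fin (m + 1)))) ≤
      ENNReal.ofReal (M / sphereArea m) * ENNReal.ofReal (ε / u) := by
    intro θ
    have hθ : ‖(θ : EuclideanSpace ℝ (Fin (m + 1)))‖ = 1 := norm_eq_of_mem_sphere θ
    set J : Set ℝ := {s | 0 < s ∧ s • (θ : EuclideanSpace ℝ (Fin (m + 1))) ∈ S} with hJ
    have hJm : MeasurableSet J := measurableSet_Ioi.inter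
      (measurableSet_preimage (by fun_prop) hSm)
    have hJvol : volume J ≤ ENNReal.ofReal (ε / u) := by
      refine (Real.volume_le_diam J).trans (Metric.ediam_le ?_)
      -- The distance to Q is convex with subgradient ν, so from a onwards it grows along the ray at
      -- rate at least u; it lies in (0, ε] at both a and b.
      have key : ∀ a ∈ J, ∀ b ∈ J, a ≤ b → edist a b ≤ ENNReal.ofReal (ε / u) := by
        intro a ha b hb hab
        rw [edist_dist]
        refine ENNReal.ofReal_le_ofReal ?_
        rw [dist_comm, Real.dist_eq, abs_of_nonneg (by linarith), le_div_iff₀ hu]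
        have h1 := hp.dist_add_inner_le ha.2.1.1 (b • (θ : EuclideanSpace ℝ (Fin (m + 1))))
        have h2 : u * ‖a • (θ : EuclideanSpace ℝ (Fin (m + 1)))‖ ≤
          inner ℝ (outerNormal p (a • (θ : EuclideanSpace ℝ (Fin (m + 1)))))
            (a • (θ : EuclideanSpace ℝ (Fin (m + 1)))) := ha.2.2
        rw [norm_smul, hθ, mul_one, Real.norm_eq_abs, abs_of_pos ha.1, real_inner_smul_right,
          mul_comm] at h2
        have h3 := le_of_mul_le_mul_left h2 ha.1
        rw [← sub_smul, real_inner_smul_right] at h1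
        have h4 := hb.2.1.2
        have h5 := ha.2.1.1
        have h6 := mul_le_mul_of_nonneg_left h3 (sub_nonneg.2 hab)
        linarith
      intro a ha b hb
      rcases le_total a b with hab | hab
      · exact key a ha b hb hab
      · rw [edist_comm]; exact key b hb a ha hab
    calc ∫⁻ s in Set.Ioi (0 : ℝ), ENNReal.ofReal (s ^ m) * S.indicator
          (fun x => ENNReal.ofReal (B * V ‖x‖)) (s • (θ : EuclideanSpace ℝ (Fin (m + 1))))
        ≤ ∫⁻ s in Set.Ioi (0 : ℝ), J.indicator (fun _ => ENNReal.ofReal (M / sphereArea m)) s := by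
          refine setLIntegral_mono (measurable_const.indicator hJm) fun s hs => ?_
          have hs0 : 0 < s := hs
          by_cases hsS : s • (θ : EuclideanSpace ℝ (Fin (m + 1))) ∈ S
          · rw [Set.indicator_of_mem hsS, Set.indicator_of_mem (show s ∈ J from ⟨hs0, hsS⟩),
              norm_smul, hθ, mul_one, Real.norm_eq_abs, abs_of_pos hs0,
              ← ENNReal.ofReal_mul (by positivity)]
            refine ENNReal.ofReal_le_ofReal ?_
            rw [le_div_iff₀ hω]
            have := h.law.density_le_peak hs0.le
            unfold radialDensity at this
            linarith
          · rw [Set.indicator_of_notMem hsS, mul_zero]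
            exact zero_le
      _ ≤ ∫⁻ s, J.indicator (fun _ => ENNReal.ofReal (M / sphereArea m)) s :=
          setLIntegral_le_lintegral _ _
      _ = ENNReal.ofReal (M / sphereArea m) * volume J := by
          rw [lintegral_indicator hJm, setLIntegral_const]
      _ ≤ _ := mul_le_mul_right hJvol _
  refine (lintegral_mono hray).trans ?_
  rw [lintegral_const, ← ofReal_sphereArea, mul_right_comm, ← ENNReal.ofReal_mul (by positivity),
    div_mul_cancel₀ _ hω.ne', ENNReal.ofReal_mul hM.le]

/-- In |x + tν|² = |x|² + 2t⟨ν, x⟩ + t² the two time restrictions bound t⟨ν, x⟩ and t² by |x|²/n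
each, where n = m + 1. -/
theorem norm_normalFlow_le {x : EuclideanSpace ℝ (Fin (m + 1))} (hx : 0 < ‖x - p x‖) {u t : ℝ}
    (hxu : inner ℝ (outerNormal p x) x ≤ u * ‖x‖) (ht0 : 0 ≤ t)
    (ht1 : t * ((m + 1) * u) ≤ ‖x‖) (ht2 : t * √((m : ℝ) + 1) ≤ ‖x‖) :
    ‖normalFlow p t x‖ ≤ ‖x‖ + 3 * ‖x‖ / (2 * (m + 1)) := by
  have hn : (0 : ℝ) < m + 1 := by positivity
  have h1 : ‖normalFlow p t x‖ ^ 2 = ‖x‖ ^ 2 + 2 * t * inner ℝ (outerNormal p x) x + t ^ 2 := by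
    rw [normalFlow, norm_add_sq_real, real_inner_smul_right, norm_smul, norm_outerNormal hx,
      mul_one, Real.norm_eq_abs, sq_abs, real_inner_comm]
    ring
  have h2 : t ^ 2 * (m + 1) ≤ ‖x‖ ^ 2 := by
    have := pow_le_pow_left₀ (by positivity) ht2 2
    rwa [mul_pow, Real.sq_sqrt hn.le] at this
  have h3 : t * inner ℝ (outerNormal p x) x * (m + 1) ≤ ‖x‖ ^ 2 := by
    have a1 := mul_le_mul_of_nonneg_left hxu ht0
    have a2 := mul_le_mul_of_nonneg_right ht1 (norm_nonneg x)
    have a3 := mul_le_mul_of_nonneg_right a1 hn.le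
    linarith
  refine le_of_sq_le_sq ?_ (by positivity)
  have e : (‖x‖ + 3 * ‖x‖ / (2 * (m + 1))) ^ 2 =
      ‖x‖ ^ 2 + 3 * (‖x‖ ^ 2 / (m + 1)) + (3 * ‖x‖ / (2 * (m + 1))) ^ 2 := by
    field_simp; ring
  have h2' : t ^ 2 ≤ ‖x‖ ^ 2 / (m + 1) := by rwa [le_div_iff₀ hn]
  have h3' : t * inner ℝ (outerNormal p x) x ≤ ‖x‖ ^ 2 / (m + 1) := by rwa [le_div_iff₀ hn]
  have := sq_nonneg (3 * ‖x‖ / (2 * ((m : ℝ) + 1)))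
  rw [h1, e]
  linarith

/-- The part of the shell where the outer normal is almost orthogonal to the radius. -/
theorem measure_tangential_le (h : IsRadialMeasure γ B V r v) (hp : IsMetricProj Q p)
    (hε : 0 < ε) {r' v' : ℝ} (h' : IsMode V (2 * m) r' v') {u t : ℝ} (ht : 0 < t)
    (ht1 : t * ((m + 1) * u) ≤ r / 8) (ht2 : t * √((m : ℝ) + 1) ≤ r / 8) :
    γ (shell p ε ∩ {x | (r / 8 ≤ ‖x‖ ∧ ‖x‖ < r') ∧ inner ℝ (outerNormal p x) x ≤ u * ‖x‖}) ≤
      ENNReal.ofReal (ε * (3 * Real.exp 3 / t)) := by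
  have hB := h.B_pos
  have hω := sphereArea_pos m
  have hr' := h'.r_pos
  have hVm := h.law.profile.measurable
  have hνm := hp.measurable_outerNormal
  set Vt := expContinuation V (2 * m) r' v' with hVt
  have hVtm : Measurable Vt :=
    Measurable.ite measurableSet_Iio hVm (by fun_prop)
  set S := shell p ε ∩ {x | (r / 8 ≤ ‖x‖ ∧ ‖x‖ < r') ∧
    inner ℝ (outerNormal p x) x ≤ u * ‖x‖} with hS
  have hSm : MeasurableSet S := by
    have a1 : MeasurableSet {x : EuclideanSpace ℝ (Fin (m + 1)) | r / 8 ≤ ‖x‖} :=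
      measurableSet_le measurable_const measurable_norm
    have a2 : MeasurableSet {x : EuclideanSpace ℝ (Fin (m + 1)) | ‖x‖ < r'} :=
      measurableSet_lt measurable_norm measurable_const
    have a3 : MeasurableSet {x | inner ℝ (outerNormal p x) x ≤ u * ‖x‖} :=
      measurableSet_le (hνm.inner measurable_id) (by fun_prop)
    exact (hp.measurableSet_shell ε).inter ((a1.inter a2).inter a3)
  set g : EuclideanSpace ℝ (Fin (m + 1)) → ℝ≥0∞ := fun y => ENNReal.ofReal (B * Vt ‖y‖) with hg
  have hgm : Measurable g := by fun_prop
  have hmass : ∫⁻ y, g y ≤ ENNReal.ofReal 3 := by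
    have h1 := lintegral_comp_norm (m := m) (g := fun s => ENNReal.ofReal (B * Vt s)) (by fun_prop)
    refine (le_of_eq h1).trans (le_trans (le_of_eq ?_) (h.law.lintegral_expContinuation_le h'))
    rw [← lintegral_const_mul _ (by fun_prop)]
    refine setLIntegral_congr_fun measurableSet_Ioi fun s hs => ?_
    have hs0 : 0 < s := hs
    rw [← ENNReal.ofReal_mul (by positivity), ← ENNReal.ofReal_mul hω.le]
    congr 1; ring
  -- Up to time t the norm grows by at most 3r' / (2(m + 1)), and the continued profile has
  -- logarithmic slope at most 2m / r', so at most a factor e³ is lost. Beyond r' the original V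
  -- could drop to 0 at once, hence the continuation.
  have hpt : ∀ j ∈ Finset.range (⌊t / ε⌋₊ + 1), ∀ x ∈ S,
      ENNReal.ofReal (Real.exp (-3)) * ENNReal.ofReal (B * V ‖x‖) ≤
        g (normalFlow p (j * ε) x) := by
    intro j hj x hx
    have hjt : (j : ℝ) * ε ≤ t := by
      have h1 : (j : ℝ) ≤ ⌊t / ε⌋₊ := by
        exact_mod_cast Nat.lt_succ_iff.1 (Finset.mem_range.1 hj)
      have h2 := h1.trans (Nat.floor_le (by positivity))
      rwa [le_div_iff₀ hε] at h2
    have hj0 : 0 ≤ (j : ℝ) * ε := by positivity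
    obtain ⟨hx1, ⟨hx2, hx3⟩, hx4⟩ := hx
    have hflow : ‖normalFlow p (j * ε) x‖ ≤ ‖x‖ + 3 * ‖x‖ / (2 * (m + 1)) := by
      refine norm_normalFlow_le hx1.1 hx4 hj0 ?_ ?_
      · rcases le_total 0 u with hu | hu
        · have := mul_le_mul_of_nonneg_right hjt (by positivity : 0 ≤ ((m : ℝ) + 1) * u)
          linarith
        · have : ((m : ℝ) + 1) * u ≤ 0 := mul_nonpos_of_nonneg_of_nonpos (by positivity) hu
          exact (mul_nonpos_of_nonneg_of_nonpos hj0 this).trans (norm_nonneg x)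
      · have := mul_le_mul_of_nonneg_right hjt (Real.sqrt_nonneg ((m : ℝ) + 1))
        linarith
    rw [hg, ← ENNReal.ofReal_mul (Real.exp_pos _).le]
    refine ENNReal.ofReal_le_ofReal ?_
    have hVx := h.law.profile.nonneg ‖x‖
    suffices hsuff : V ‖x‖ * Real.exp (-3) ≤ Vt ‖normalFlow p (j * ε) x‖ by
      have := mul_le_mul_of_nonneg_left hsuff hB.le
      linarith
    rcases le_total ‖x‖ ‖normalFlow p (j * ε) x‖ with hle | hle
    · refine le_trans ?_ (h'.exp_mul_le_expContinuation h.law.profile (norm_nonneg x) hle)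
      refine mul_le_mul_of_nonneg_left (Real.exp_le_exp.2 (neg_le_neg ?_)) hVx
      have h1 : (‖normalFlow p (j * ε) x‖ - ‖x‖) / r' ≤ 3 / (2 * (m + 1)) := by
        rw [div_le_iff₀ hr']
        have : 3 * ‖x‖ / (2 * ((m : ℝ) + 1)) ≤ 3 / (2 * (m + 1)) * r' := by
          rw [div_mul_eq_mul_div]; gcongr
        linarith
      have h2 := mul_le_mul_of_nonneg_left h1 (by positivity : (0 : ℝ) ≤ (2 * m : ℕ))
      refine h2.trans ?_
      push_cast
      rw [mul_div_assoc', div_le_iff₀ (by positivity)]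
      linarith [Nat.cast_nonneg (α := ℝ) m]
    · have h1 : Vt ‖normalFlow p (j * ε) x‖ = V ‖normalFlow p (j * ε) x‖ := by
        rw [hVt, expContinuation, if_pos (hle.trans_lt hx3)]
      rw [h1]
      refine le_trans ?_ (h.law.profile.anti hle)
      exact mul_le_of_le_one_right hVx (Real.exp_le_one_iff.2 (by norm_num))
  -- More than t/ε disjoint copies of S, each of weight at least e^{-3} γ(S), share a total mass of
  -- at most 3.
  have hsum : ((⌊t / ε⌋₊ + 1 : ℕ) : ℝ≥0∞) * (ENNReal.ofReal (Real.exp (-3)) * γ S) ≤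
      ENNReal.ofReal 3 := by
    calc ((⌊t / ε⌋₊ + 1 : ℕ) : ℝ≥0∞) * (ENNReal.ofReal (Real.exp (-3)) * γ S)
        = ∑ j ∈ Finset.range (⌊t / ε⌋₊ + 1), ENNReal.ofReal (Real.exp (-3)) * γ S := by
          rw [Finset.sum_const, Finset.card_range, nsmul_eq_mul]
      _ ≤ ∑ j ∈ Finset.range (⌊t / ε⌋₊ + 1), ∫⁻ x in shell p ε, g (normalFlow p (j * ε) x) := by
          refine Finset.sum_le_sum fun j hj => ?_
          refine le_trans ?_ (lintegral_mono_set (Set.inter_subset_left : S ⊆ shell p ε))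
          rw [h.apply_eq hSm, ← lintegral_const_mul _ (by fun_prop)]
          exact setLIntegral_mono (hgm.comp (hp.measurable_normalFlow _)) (hpt j hj)
      _ ≤ ∑' j : ℕ, ∫⁻ x in shell p ε, g (normalFlow p (j * ε) x) := ENNReal.sum_le_tsum _
      _ ≤ ∫⁻ y, g y := hp.tsum_setLIntegral_normalFlow_le hε hgm
      _ ≤ _ := hmass
  have hN : ENNReal.ofReal (t / ε) ≤ ((⌊t / ε⌋₊ + 1 : ℕ) : ℝ≥0∞) := by
    rw [← ENNReal.ofReal_natCast]
    refine ENNReal.ofReal_le_ofReal ?_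
    push_cast
    exact (Nat.lt_floor_add_one _).le
  have hfin : ENNReal.ofReal (t / ε * Real.exp (-3)) * γ S ≤ ENNReal.ofReal 3 := by
    rw [ENNReal.ofReal_mul (by positivity), mul_assoc]
    exact (mul_le_mul_left hN _).trans hsum
  have hc : 0 < t / ε * Real.exp (-3) := by positivity
  have e : ENNReal.ofReal (ε * (3 * Real.exp 3 / t)) =
      ENNReal.ofReal 3 / ENNReal.ofReal (t / ε * Real.exp (-3)) := by
    rw [← ENNReal.ofReal_div_of_pos hc, Real.exp_neg]
    congr 1
    field_simp
  rw [e, ENNReal.le_div_iff_mul_le (Or.inl (by simpa using hc)) (Or.inl ENNReal.ofReal_ne_top),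
    mul_comm]
  exact hfin

theorem measure_shell_le (h : IsRadialMeasure γ B V r v) (hp : IsMetricProj Q p) (hε : 0 < ε) :
    γ (shell p ε) ≤ ENNReal.ofReal
      (ε * (2000 * √((m + 1) * peak (B * sphereArea m) m r v / r))) := by
  have hr := h.law.mode.r_pos
  have hM := h.law.peak_pos
  have hn : (0 : ℝ) < m + 1 := by positivity
  have hMr1 := h.law.peak_mul_le
  have hMr2 := h.law.one_le_peak_mul
  obtain ⟨r', v', h'⟩ := h.law.exists_isMode (k := 2 * m) (by simpa using h.law.m_ne)
  have hlow := h.measure_low_le hp hε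
  have hhigh := h.measure_high_le hp hε h'
  set M := peak (B * sphereArea m) m r v with hMdef
  set Λ := √((m + 1) * M / r) with hΛ
  have hΛpos : 0 < Λ := Real.sqrt_pos.2 (by positivity)
  have hΛsq : Λ ^ 2 = (m + 1) * M / r := Real.sq_sqrt (by positivity)
  -- This balances the two main terms: M / u = Λ for the transversal part and n u / r = Λ for the
  -- tangential one.
  set u := M / Λ with hu
  have hupos : 0 < u := by positivity
  -- The inverse of a sum, so that both time restrictions hold and 1/t splits into two terms of
  -- order Λ.
  set t := (8 * ((m + 1) * u) / r + 8 * √((m : ℝ) + 1) / r)⁻¹ with ht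
  have hsq : 0 < √((m : ℝ) + 1) := Real.sqrt_pos.2 hn
  have htpos : 0 < t := by positivity
  have ht1 : t * ((m + 1) * u) ≤ r / 8 := by
    rw [ht, inv_mul_le_iff₀ (by positivity)]
    have e : (8 * ((m + 1) * u) / r + 8 * √((m : ℝ) + 1) / r) * (r / 8) =
      (m + 1) * u + √((m : ℝ) + 1) := by field_simp
    rw [e]; linarith
  have ht2 : t * √((m : ℝ) + 1) ≤ r / 8 := by
    rw [ht, inv_mul_le_iff₀ (by positivity)]
    have e : (8 * ((m + 1) * u) / r + 8 * √((m : ℝ) + 1) / r) * (r / 8) =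
      (m + 1) * u + √((m : ℝ) + 1) := by field_simp
    rw [e]
    have : 0 ≤ (m + 1) * u := by positivity
    linarith
  have htrans := h.measure_transversal_le (ε := ε) hp hupos
  have htang := h.measure_tangential_le hp hε h' htpos ht1 ht2
  have hcover : shell p ε ⊆ (shell p ε ∩ {x | ‖x‖ ≤ r / 8}) ∪ ((shell p ε ∩ {x | r' ≤ ‖x‖}) ∪
      ((shell p ε ∩ {x | u * ‖x‖ ≤ inner ℝ (outerNormal p x) x}) ∪ (shell p ε ∩
        {x | (r / 8 ≤ ‖x‖ ∧ ‖x‖ < r') ∧ inner ℝ (outerNormal p x) x ≤ u * ‖x‖}))) := by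
    intro x hx
    by_cases c1 : ‖x‖ ≤ r / 8
    · exact Or.inl ⟨hx, c1⟩
    by_cases c2 : r' ≤ ‖x‖
    · exact Or.inr (Or.inl ⟨hx, c2⟩)
    by_cases c3 : u * ‖x‖ ≤ inner ℝ (outerNormal p x) x
    · exact Or.inr (Or.inr (Or.inl ⟨hx, c3⟩))
    · exact Or.inr (Or.inr (Or.inr ⟨hx, ⟨(not_le.1 c1).le, not_le.1 c2⟩, (not_le.1 c3).le⟩))
  refine (measure_mono hcover).trans ?_
  refine (measure_union_le _ _).trans ((add_le_add hlow ((measure_union_le _ _).trans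
    (add_le_add hhigh ((measure_union_le _ _).trans (add_le_add htrans htang))))).trans ?_)
  rw [← ENNReal.ofReal_mul hε.le, ← ENNReal.ofReal_mul hε.le,
    ← ENNReal.ofReal_add (by positivity) (by positivity),
    ← ENNReal.ofReal_add (by positivity) (by positivity),
    ← ENNReal.ofReal_add (by positivity) (by positivity)]
  refine ENNReal.ofReal_le_ofReal ?_
  -- This uses Mr ≤ n; the opposite bound 1 ≤ 4Mr gives √n / r ≤ 2Λ below.
  have hMΛ : M ≤ Λ := by
    refine le_of_sq_le_sq ?_ hΛpos.le
    rw [hΛsq, le_div_iff₀ hr]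
    nlinarith
  have hMu : M * (ε / u) = ε * Λ := by rw [hu]; field_simp
  have hsΛ : √((m : ℝ) + 1) / r ≤ 2 * Λ := by
    refine le_of_sq_le_sq ?_ (by positivity)
    rw [mul_pow, hΛsq, div_pow, Real.sq_sqrt hn.le, div_le_iff₀ (by positivity)]
    have e : 2 ^ 2 * ((m + 1) * M / r) * r ^ 2 = (m + 1) * (4 * (M * r)) := by field_simp; ring
    rw [e]
    nlinarith
  have huΛ : (m + 1) * u / r = Λ := by
    have : (m + 1) * u / r = Λ ^ 2 / Λ := by rw [hΛsq, hu]; field_simp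
    rw [this]; field_simp
  have htinv : 1 / t ≤ 24 * Λ := by
    have e : 1 / t = 8 * ((m + 1) * u / r) + 8 * (√((m : ℝ) + 1) / r) := by
      rw [ht, one_div, inv_inv]; ring
    rw [e, huΛ]; linarith
  have hexp : Real.exp 3 ≤ 21 := by
    have e : Real.exp 3 = Real.exp 1 ^ 3 := by rw [← Real.exp_nat_mul]; norm_num
    rw [e]
    have h1 := Real.exp_one_lt_d9.le
    have := pow_le_pow_left₀ (Real.exp_pos 1).le h1 3
    refine this.trans (by norm_num)
  have h3 : 3 * Real.exp 3 / t ≤ 1512 * Λ := by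
    have e : 3 * Real.exp 3 / t = 3 * Real.exp 3 * (1 / t) := by ring
    rw [e]
    calc 3 * Real.exp 3 * (1 / t) ≤ 3 * 21 * (24 * Λ) := by gcongr
      _ = _ := by ring
  rw [hMu]
  have h4 : ε * M + (ε * (2 * M) + (ε * Λ + ε * (3 * Real.exp 3 / t))) =
      ε * (3 * M + Λ + 3 * Real.exp 3 / t) := by ring
  rw [h4]
  exact mul_le_mul_of_nonneg_left (by linarith) hε.le

theorem maxSurfaceArea_le (h : IsRadialMeasure γ B V r v) :
    maxSurfaceArea γ ≤ ENNReal.ofReal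
      (2000 * √((m + 1) * peak (B * sphereArea m) m r v / r)) := by
  refine iSup₂_le fun Q hQ => ?_
  set Λ := 2000 * √((m + 1) * peak (B * sphereArea m) m r v / r)
  have hΛ : 0 ≤ Λ := by positivity
  have key : ∀ ε : ℝ, 0 < ε →
      γ ((Q + ε • Metric.closedBall (0 : EuclideanSpace ℝ (Fin (m + 1))) 1) \ Q) /
        ENNReal.ofReal ε ≤ ENNReal.ofReal Λ := by
    intro ε hε
    refine ENNReal.div_le_of_le_mul' ?_
    rcases Q.eq_empty_or_nonempty with rfl | hne
    · simp
    -- Q need not be closed. Projecting onto its closure costs only the frontier, which is Lebesgue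
    -- null by convexity.
    obtain ⟨p, hp⟩ := exists_isMetricProj hQ.closure isClosed_closure hne.closure
    have hnull : γ (frontier Q) = 0 := by
      rw [h.eq_withDensity]
      exact withDensity_absolutelyContinuous _ _ (hQ.addHaar_frontier volume)
    have hsub : (Q + ε • Metric.closedBall (0 : EuclideanSpace ℝ (Fin (m + 1))) 1) \ Q ⊆
        shell p ε ∪ frontier Q := by
      rintro x ⟨hx, hxQ⟩
      by_cases hxc : x ∈ closure Q
      · exact Or.inr ⟨hxc, fun hi => hxQ (interior_subset hi)⟩
      · exact Or.inl (hp.diff_subset_shell hε.le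
          ⟨Set.add_subset_add_right subset_closure hx, hxc⟩)
    refine (measure_mono hsub).trans ((measure_union_le _ _).trans ?_)
    rw [hnull, add_zero, ← ENNReal.ofReal_mul hε.le]
    exact h.measure_shell_le hp hε
  rw [surfaceArea]
  refine (liminf_le_liminf (v := fun _ => ENNReal.ofReal Λ) ?_).trans (le_of_eq (liminf_const _))
  filter_upwards [self_mem_nhdsWithin] with ε hε using key ε hε

end IsRadialMeasure

/-! ### The law of the angle to a fixed direction -/

section AngleLaw

/-- A rotation of `ℝ^(k+2)` onto `ℝ × ℝ^(k+1)` that takes a given unit vector to the first axis. -/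
theorem exists_linearIsometryEquiv_prod (k : ℕ) {e : EuclideanSpace ℝ (Fin (k + 2))}
    (he : ‖e‖ = 1) :
    ∃ L : EuclideanSpace ℝ (Fin (k + 2)) ≃ₗᵢ[ℝ] WithLp 2 (ℝ × EuclideanSpace ℝ (Fin (k + 1))),
      L e = WithLp.toLp 2 (1, 0) := by
  have hfin : Module.finrank ℝ (EuclideanSpace ℝ (Fin (k + 2))) =
      Module.finrank ℝ (WithLp 2 (ℝ × EuclideanSpace ℝ (Fin (k + 1)))) := by
    rw [(WithLp.linearEquiv 2 ℝ (ℝ × EuclideanSpace ℝ (Fin (k + 1)))).finrank_eq,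
      Module.finrank_prod]
    simp
    ring
  set L₀ : EuclideanSpace ℝ (Fin (k + 2)) ≃ₗᵢ[ℝ] WithLp 2 (ℝ × EuclideanSpace ℝ (Fin (k + 1))) :=
    (stdOrthonormalBasis ℝ _).equiv (stdOrthonormalBasis ℝ _) (finCongr hfin)
  have hn : ‖L₀ e‖ = ‖(WithLp.toLp 2 (1, 0) : WithLp 2 (ℝ × EuclideanSpace ℝ (Fin (k + 1))))‖ := by
    rw [L₀.norm_map, he]
    simp
  exact ⟨L₀.trans (Submodule.reflection _), by
    rw [LinearIsometryEquiv.trans_apply]; exact Submodule.reflection_sub hn⟩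

/-- After rotating e to the first axis, polar coordinates in the orthogonal ℝ^(k+1) leave a planar
integral over the axial coordinate and the distance s to the axis. -/
theorem lintegral_inner_norm (k : ℕ) {e : EuclideanSpace ℝ (Fin (k + 2))} (he : ‖e‖ = 1)
    {F : ℝ → ℝ → ℝ≥0∞} (hF : Measurable (Function.uncurry F)) :
    ∫⁻ z, F (inner ℝ e z) ‖z‖ = ENNReal.ofReal (sphereArea k) * ∫⁻ q : ℝ × ℝ,
      (Set.Ioi (0 : ℝ)).indicator (fun s => ENNReal.ofReal (s ^ k) * F q.1 √(q.1 ^ 2 + s ^ 2)) q.2 := by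
  obtain ⟨L, hL⟩ := exists_linearIsometryEquiv_prod k he
  have hF' : ∀ {α : Type} [MeasurableSpace α] {f g : α → ℝ}, Measurable f → Measurable g →
      Measurable fun a => F (f a) (g a) := fun hf hg => hF.comp (hf.prodMk hg)
  have h1 : ∀ z, F (inner ℝ e z) ‖z‖ =
      (fun q : ℝ × EuclideanSpace ℝ (Fin (k + 1)) => F q.1 √(q.1 ^ 2 + ‖q.2‖ ^ 2))
        (WithLp.ofLp (L z)) := by
    intro z
    have e1 : inner ℝ e z = (WithLp.ofLp (L z)).1 := by
      rw [← L.inner_map_map, hL, WithLp.prod_inner_apply]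
      simp
    have e2 : ‖z‖ = √((WithLp.ofLp (L z)).1 ^ 2 + ‖(WithLp.ofLp (L z)).2‖ ^ 2) := by
      rw [← L.norm_map, eq_comm, Real.sqrt_eq_iff_eq_sq (by positivity) (norm_nonneg _),
        WithLp.prod_norm_sq_eq_of_L2]
      simp
    simp only
    rw [← e2, ← e1]
  simp_rw [h1]
  have hm : Measurable fun q : ℝ × EuclideanSpace ℝ (Fin (k + 1)) =>
      F q.1 √(q.1 ^ 2 + ‖q.2‖ ^ 2) := hF' (by fun_prop) (by fun_prop)
  have hmp := (WithLp.volume_preserving_ofLp ℝ (EuclideanSpace ℝ (Fin (k + 1)))).comp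
    L.measurePreserving
  have h2 := hmp.lintegral_comp hm
  refine h2.trans ?_
  rw [Measure.volume_eq_prod, lintegral_prod _ hm.aemeasurable, Measure.volume_eq_prod,
    lintegral_prod, ← lintegral_const_mul]
  · refine lintegral_congr fun a => ?_
    rw [lintegral_comp_norm (m := k) (g := fun s => F a √(a ^ 2 + s ^ 2))
      (hF' (by fun_prop) (by fun_prop))]
    show _ = _ * ∫⁻ s, (Set.Ioi (0 : ℝ)).indicator
      (fun s => ENNReal.ofReal (s ^ k) * F a √(a ^ 2 + s ^ 2)) s
    rw [lintegral_indicator measurableSet_Ioi]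
  · refine Measurable.lintegral_prod_right' (f := fun q : ℝ × ℝ => (Set.Ioi (0 : ℝ)).indicator
      (fun s => ENNReal.ofReal (s ^ k) * F q.1 √(q.1 ^ 2 + s ^ 2)) q.2) ?_
    exact Measurable.indicator (s := {q : ℝ × ℝ | 0 < q.2}) (f := fun q : ℝ × ℝ =>
      ENNReal.ofReal (q.2 ^ k) * F q.1 √(q.1 ^ 2 + q.2 ^ 2))
      (Measurable.mul (by fun_prop) (hF' (by fun_prop) (by fun_prop)))
      (measurableSet_lt measurable_const measurable_snd)
  · exact (Measurable.indicator (s := {q : ℝ × ℝ | 0 < q.2}) (f := fun q : ℝ × ℝ =>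
      ENNReal.ofReal (q.2 ^ k) * F q.1 √(q.1 ^ 2 + q.2 ^ 2))
      (Measurable.mul (by fun_prop) (hF' (by fun_prop) (by fun_prop)))
      (measurableSet_lt measurable_const measurable_snd)).aemeasurable

/-- The angle between a fixed axis and a uniform point of the ball has density proportional to
`sin ^ k` on `(0, π)`. -/
theorem setLIntegral_ball_angle (k : ℕ) {e : EuclideanSpace ℝ (Fin (k + 2))} (he : ‖e‖ = 1)
    {G : ℝ → ℝ≥0∞} (hG : Measurable G) :
    ∫⁻ z in Metric.ball 0 1, G (inner ℝ e z / ‖z‖) =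
      ENNReal.ofReal (sphereArea k / (k + 2)) *
        ∫⁻ α in Set.Ioo 0 Real.pi, ENNReal.ofReal (Real.sin α ^ k) * G (Real.cos α) := by
  have h0 : ∫⁻ z in Metric.ball (0 : EuclideanSpace ℝ (Fin (k + 2))) 1, G (inner ℝ e z / ‖z‖) =
      ∫⁻ z : EuclideanSpace ℝ (Fin (k + 2)),
        (fun a ρ : ℝ => (Set.Iio (1 : ℝ)).indicator (fun ρ => G (a / ρ)) ρ) (inner ℝ e z) ‖z‖ := by
    rw [← lintegral_indicator measurableSet_ball]
    refine lintegral_congr fun z => ?_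
    simp only [Set.indicator, Metric.mem_ball, dist_zero_right, Set.mem_Iio]
  have hFm : Measurable (Function.uncurry
      (fun a ρ : ℝ => (Set.Iio (1 : ℝ)).indicator (fun ρ => G (a / ρ)) ρ)) :=
    Measurable.indicator (s := {q : ℝ × ℝ | q.2 < 1}) (f := fun q : ℝ × ℝ => G (q.1 / q.2))
      (by fun_prop) (measurableSet_lt measurable_snd measurable_const)
  rw [h0, lintegral_inner_norm k he hFm, ← lintegral_comp_polarCoord_symm]
  -- In planar polar coordinates the integrand separates: the Jacobian ρ and (ρ sin α) ^ k give ρ ^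
  -- (k + 1) times sin ^ k α. The lower half-plane contributes nothing.
  have h1 : ∫⁻ p in polarCoord.target, ENNReal.ofReal p.1 • (fun q : ℝ × ℝ =>
      (Set.Ioi (0 : ℝ)).indicator (fun s => ENNReal.ofReal (s ^ k) *
        (Set.Iio (1 : ℝ)).indicator (fun ρ => G (q.1 / ρ)) √(q.1 ^ 2 + s ^ 2)) q.2)
          (polarCoord.symm p) =
      ∫⁻ p in polarCoord.target, (Set.Iio (1 : ℝ)).indicator
        (fun ρ => ENNReal.ofReal (ρ ^ (k + 1))) p.1 *
        (Set.Ioi (0 : ℝ)).indicator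
          (fun α => ENNReal.ofReal (Real.sin α ^ k) * G (Real.cos α)) p.2 := by
    refine setLIntegral_congr_fun polarCoord.open_target.measurableSet fun p hp => ?_
    obtain ⟨hρ, hα⟩ := hp
    have hρ0 : 0 < p.1 := hρ
    have hsq : √((p.1 * Real.cos p.2) ^ 2 + (p.1 * Real.sin p.2) ^ 2) = p.1 := by
      rw [mul_pow, mul_pow, ← mul_add, Real.cos_sq_add_sin_sq, mul_one, Real.sqrt_sq hρ0.le]
    simp only [polarCoord_symm_apply]
    by_cases hα0 : 0 < p.2
    · have hsin : 0 < Real.sin p.2 := Real.sin_pos_of_pos_of_lt_pi hα0 hα.2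
      rw [Set.indicator_of_mem (show p.1 * Real.sin p.2 ∈ Set.Ioi (0 : ℝ) from mul_pos hρ0 hsin),
        Set.indicator_of_mem (show p.2 ∈ Set.Ioi (0 : ℝ) from hα0), hsq]
      by_cases hρ1 : p.1 < 1
      · rw [Set.indicator_of_mem (show p.1 ∈ Set.Iio (1 : ℝ) from hρ1),
          Set.indicator_of_mem (show p.1 ∈ Set.Iio (1 : ℝ) from hρ1), mul_pow,
          ENNReal.ofReal_mul (by positivity), pow_succ, ENNReal.ofReal_mul (by positivity),
          mul_div_cancel_left₀ _ hρ0.ne', smul_eq_mul]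
        ring
      · rw [Set.indicator_of_notMem (show p.1 ∉ Set.Iio (1 : ℝ) from hρ1),
          Set.indicator_of_notMem (show p.1 ∉ Set.Iio (1 : ℝ) from hρ1)]
        simp
    · have hsin : Real.sin p.2 ≤ 0 :=
        Real.sin_nonpos_of_nonpos_of_neg_pi_le (not_lt.1 hα0) hα.1.le
      rw [Set.indicator_of_notMem (show p.1 * Real.sin p.2 ∉ Set.Ioi (0 : ℝ) from
          not_lt.2 (mul_nonpos_of_nonneg_of_nonpos hρ0.le hsin)),
        Set.indicator_of_notMem (show p.2 ∉ Set.Ioi (0 : ℝ) from hα0)]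
      simp
  rw [h1, polarCoord_target, Measure.volume_eq_prod, ← Measure.prod_restrict,
    lintegral_prod_mul (by
      exact ((Measurable.indicator (by fun_prop) measurableSet_Iio).aemeasurable)) (by
      exact ((Measurable.indicator (by fun_prop) measurableSet_Ioi).aemeasurable)),
    lintegral_indicator measurableSet_Iio, Measure.restrict_restrict measurableSet_Iio,
    lintegral_indicator measurableSet_Ioi, Measure.restrict_restrict measurableSet_Ioi,
    Set.Iio_inter_Ioi, setLIntegral_congr (Ioo_ae_eq_Ioc (a := (0 : ℝ)) (b := 1)),
    lintegral_Ioc_pow _ zero_le_one, ← mul_assoc, ← ENNReal.ofReal_mul (sphereArea_pos k).le]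
  have hset : Set.Ioi 0 ∩ Set.Ioo (-Real.pi) Real.pi = Set.Ioo 0 Real.pi := by
    ext α
    simp only [Set.mem_inter_iff, Set.mem_Ioi, Set.mem_Ioo]
    constructor
    · rintro ⟨h1, h2, h3⟩; exact ⟨h1, h3⟩
    · rintro ⟨h1, h3⟩; exact ⟨h1, by linarith [Real.pi_pos], h3⟩
  rw [hset]
  congr 2
  push_cast
  field_simp
  ring

/-- The angles with cosine in (b, c] fill an interval of length at least c - b since cosine is
1-Lipschitz, and sin α ≥ √(1 - c²) on it. -/
theorem le_lintegral_slab (k : ℕ) {b c : ℝ} (hb : 0 ≤ b) (hbc : b < c) (hc : c < 1) :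
    ENNReal.ofReal ((c - b) * √(1 - c ^ 2) ^ k) ≤
      ∫⁻ α in Set.Ioo 0 Real.pi, ENNReal.ofReal (Real.sin α ^ k) *
        (Set.Ioc b c).indicator 1 (Real.cos α) := by
  have hb1 : b < 1 := hbc.trans hc
  have hc0 : 0 < c := hb.trans_lt hbc
  have hsub : Set.Ico (Real.arccos c) (Real.arccos b) ⊆ Set.Ioo 0 Real.pi := by
    intro α hα
    refine ⟨lt_of_lt_of_le (Real.arccos_pos.2 hc) hα.1, lt_of_lt_of_le hα.2 (Real.arccos_le_pi b)⟩
  refine le_trans ?_ (lintegral_mono_set hsub)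
  have h1 : ∀ α ∈ Set.Ico (Real.arccos c) (Real.arccos b),
      ENNReal.ofReal (√(1 - c ^ 2) ^ k) ≤
        ENNReal.ofReal (Real.sin α ^ k) * (Set.Ioc b c).indicator 1 (Real.cos α) := by
    intro α hα
    have hα' := hsub hα
    have hcos1 : Real.cos α ≤ c := by
      rw [← Real.cos_arccos (by linarith : -1 ≤ c) hc.le]
      exact Real.cos_le_cos_of_nonneg_of_le_pi (Real.arccos_nonneg c) hα'.2.le hα.1
    have hcos2 : b < Real.cos α := by
      rw [← Real.cos_arccos (by linarith : -1 ≤ b) hb1.le]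
      exact Real.cos_lt_cos_of_nonneg_of_le_pi hα'.1.le (Real.arccos_le_pi b) hα.2
    rw [Set.indicator_of_mem (show Real.cos α ∈ Set.Ioc b c from ⟨hcos2, hcos1⟩), Pi.one_apply, mul_one]
    refine ENNReal.ofReal_le_ofReal (pow_le_pow_left₀ (Real.sqrt_nonneg _) ?_ k)
    have hsin : 0 ≤ Real.sin α := Real.sin_nonneg_of_nonneg_of_le_pi hα'.1.le hα'.2.le
    rw [Real.sqrt_le_left hsin, Real.sin_sq]
    have : Real.cos α ^ 2 ≤ c ^ 2 := pow_le_pow_left₀ (hb.trans hcos2.le) hcos1 2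
    linarith
  refine le_trans ?_ (setLIntegral_mono (Measurable.mul (by fun_prop)
    ((measurable_one.indicator measurableSet_Ioc).comp Real.measurable_cos)) h1)
  rw [setLIntegral_const, Real.volume_Ico, ← ENNReal.ofReal_mul (by positivity)]
  refine ENNReal.ofReal_le_ofReal ?_
  rw [mul_comm]
  refine mul_le_mul_of_nonneg_left ?_ (by positivity)
  have h2 := Real.abs_cos_sub_cos_le (Real.arccos c) (Real.arccos b)
  rw [Real.cos_arccos (by linarith) hc.le, Real.cos_arccos (by linarith) hb1.le,
    abs_of_pos (by linarith), abs_sub_comm] at h2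
  have h3 : Real.arccos c ≤ Real.arccos b := Real.arccos_le_arccos hbc.le
  rwa [abs_of_nonneg (by linarith)] at h2

/-- On the cap cos α / b ≥ 1; inserting this factor turns the integrand into the derivative of sin ^
(k + 1) α / ((k + 1) b). -/
theorem lintegral_cap_le (k : ℕ) {b : ℝ} (hb : 0 < b) (hb1 : b < 1) :
    ∫⁻ α in Set.Ioo 0 Real.pi, ENNReal.ofReal (Real.sin α ^ k) *
        (Set.Ioi b).indicator 1 (Real.cos α) ≤
      ENNReal.ofReal (√(1 - b ^ 2) ^ (k + 1) / ((k + 1) * b)) := by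
  set β := Real.arccos b with hβ
  have hβ0 : 0 ≤ β := Real.arccos_nonneg b
  have hβπ : β ≤ Real.pi / 2 := Real.arccos_le_pi_div_two.2 hb.le
  have h1 : ∀ α ∈ Set.Ioo 0 Real.pi, ENNReal.ofReal (Real.sin α ^ k) *
      (Set.Ioi b).indicator 1 (Real.cos α) ≤ (Set.Ioc 0 β).indicator
        (fun α => ENNReal.ofReal (1 / b * (Real.sin α ^ k * Real.cos α))) α := by
    intro α hα
    by_cases hcos : b < Real.cos α
    · have hαβ : α ≤ β := by
        by_contra hcon
        have := Real.cos_le_cos_of_nonneg_of_le_pi hβ0 hα.2.le (not_le.1 hcon).le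
        rw [hβ, Real.cos_arccos (by linarith) hb1.le] at this
        linarith
      have hsin : 0 ≤ Real.sin α := Real.sin_nonneg_of_nonneg_of_le_pi hα.1.le hα.2.le
      rw [Set.indicator_of_mem (show Real.cos α ∈ Set.Ioi b from hcos),
        Set.indicator_of_mem (show α ∈ Set.Ioc 0 β from ⟨hα.1, hαβ⟩), Pi.one_apply, mul_one]
      refine ENNReal.ofReal_le_ofReal ?_
      have : 1 ≤ 1 / b * Real.cos α := by
        rw [one_div, inv_mul_eq_div, one_le_div hb]; exact hcos.le
      calc Real.sin α ^ k = Real.sin α ^ k * 1 := by ring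
        _ ≤ Real.sin α ^ k * (1 / b * Real.cos α) := by gcongr
        _ = _ := by ring
    · rw [Set.indicator_of_notMem (show Real.cos α ∉ Set.Ioi b from hcos), mul_zero]
      exact zero_le
  refine (setLIntegral_mono (Measurable.indicator (by fun_prop) measurableSet_Ioc) h1).trans ?_
  refine (setLIntegral_le_lintegral _ _).trans ?_
  rw [lintegral_indicator measurableSet_Ioc, ← ofReal_integral_eq_lintegral_ofReal]
  · refine ENNReal.ofReal_le_ofReal (le_of_eq ?_)
    rw [← intervalIntegral.integral_of_le hβ0, intervalIntegral.integral_const_mul,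
      intervalIntegral.integral_eq_sub_of_hasDerivAt
        (f := fun α => Real.sin α ^ (k + 1) / (k + 1))]
    · rw [Real.sin_zero, hβ, Real.sin_arccos, zero_pow (Nat.succ_ne_zero k)]
      field_simp
      ring
    · intro α _
      have := ((Real.hasDerivAt_sin α).pow (k + 1)).div_const ((k : ℝ) + 1)
      have e : Real.sin α ^ k * Real.cos α =
          ((k + 1 : ℕ) : ℝ) * Real.sin α ^ (k + 1 - 1) * Real.cos α / (k + 1) := by
        rw [Nat.add_sub_cancel]
        push_cast
        field_simp
      rw [e]
      exact this
    · exact (Continuous.intervalIntegrable (by fun_prop) _ _)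
  · exact (Continuous.integrableOn_Ioc (by fun_prop))
  · filter_upwards [ae_restrict_mem measurableSet_Ioc] with α hα
    have hsin : 0 ≤ Real.sin α :=
      Real.sin_nonneg_of_nonneg_of_le_pi hα.1.le (by linarith [hα.2, Real.pi_pos])
    have hcos : 0 ≤ Real.cos α :=
      Real.cos_nonneg_of_neg_pi_div_two_le_of_le (by linarith [hα.1, Real.pi_pos])
        (by linarith [hα.2])
    show 0 ≤ 1 / b * (Real.sin α ^ k * Real.cos α)
    positivity

/-- The uniform probability measure on the unit ball. -/
def ballMeasure (d : ℕ) : Measure (EuclideanSpace ℝ (Fin d)) :=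
  (volume (Metric.ball (0 : EuclideanSpace ℝ (Fin d)) 1))⁻¹ •
    volume.restrict (Metric.ball (0 : EuclideanSpace ℝ (Fin d)) 1)

instance (d : ℕ) : IsProbabilityMeasure (ballMeasure d) := by
  refine ⟨?_⟩
  rw [ballMeasure, Measure.smul_apply, Measure.restrict_apply MeasurableSet.univ, Set.univ_inter,
    smul_eq_mul, ENNReal.inv_mul_cancel]
  · exact (Metric.measure_ball_pos volume _ one_pos).ne'
  · exact measure_ball_lt_top.ne

/-- The value of κ is left open: the number of facets will be chosen proportional to 1/κ, and κ
cancels. A uniform point of the ball serves as a random direction because the facet inequalities are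
homogeneous in it. -/
theorem exists_lintegral_ballMeasure_angle (k : ℕ) : ∃ κ : ℝ, 0 < κ ∧
    ∀ e : EuclideanSpace ℝ (Fin (k + 2)), ‖e‖ = 1 → ∀ G : ℝ → ℝ≥0∞, Measurable G →
      ∫⁻ z, G (inner ℝ e z / ‖z‖) ∂ballMeasure (k + 2) = ENNReal.ofReal κ *
        ∫⁻ α in Set.Ioo 0 Real.pi, ENNReal.ofReal (Real.sin α ^ k) * G (Real.cos α) := by
  have h0 := (Metric.measure_ball_pos volume (0 : EuclideanSpace ℝ (Fin (k + 2))) one_pos).ne'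
  have h1 := (measure_ball_lt_top (μ := volume) (x := (0 : EuclideanSpace ℝ (Fin (k + 2))))
    (r := 1)).ne
  have hω := sphereArea_pos k
  refine ⟨(volume (Metric.ball (0 : EuclideanSpace ℝ (Fin (k + 2))) 1)).toReal⁻¹ *
    (sphereArea k / (k + 2)), ?_, fun e he G hG => ?_⟩
  · have := ENNReal.toReal_pos h0 h1
    positivity
  · rw [ballMeasure, lintegral_smul_measure, setLIntegral_ball_angle k he hG, smul_eq_mul,
      ENNReal.ofReal_mul (by positivity), ENNReal.ofReal_inv_of_pos (ENNReal.toReal_pos h0 h1),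
      ENNReal.ofReal_toReal h1, mul_assoc]

end AngleLaw

/-! ### Facets of polytopes -/

section Polytope

variable {E : Type*} [NormedAddCommGroup E] [InnerProductSpace ℝ E] {N : ℕ}

/-- The polytope with outer normal directions `z j`, all of whose facets have distance `τ` to `0`. -/
def polytope (τ : ℝ) (z : Fin N → E) : Set E := {x | ∀ j, inner ℝ x (z j) ≤ τ * ‖z j‖}

/-- The points at height in `(0, δ]` above the `i`-th facet of `polytope τ z`, and staying `η` away
from the halfspaces cut off by the other facets. -/
def facetSlab (τ δ η : ℝ) (z : Fin N → E) (i : Fin N) : Set E :=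
  {x | (τ * ‖z i‖ < inner ℝ x (z i) ∧ inner ℝ x (z i) ≤ (τ + δ) * ‖z i‖) ∧
    ∀ j, j ≠ i → inner ℝ x (z j) ≤ (τ - η) * ‖z j‖}

theorem convex_polytope (τ : ℝ) (z : Fin N → E) : Convex ℝ (polytope τ z) := by
  intro x hx y hy a b ha hb hab j
  rw [inner_add_left, real_inner_smul_left, real_inner_smul_left]
  have h1 := mul_le_mul_of_nonneg_left (hx j) ha
  have h2 := mul_le_mul_of_nonneg_left (hy j) hb
  have : a * (τ * ‖z j‖) + b * (τ * ‖z j‖) = τ * ‖z j‖ := by rw [← add_mul, hab, one_mul]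
  linarith

theorem norm_pos_of_mem_facetSlab {τ δ η : ℝ} {z : Fin N → E} {i : Fin N} {x : E}
    (hx : x ∈ facetSlab τ δ η z i) : 0 < ‖z i‖ := by
  refine norm_pos_iff.2 fun h0 => ?_
  have := hx.1.1
  simp [h0] at this

/-- Moving x back to its facet along the normal changes the other constraints by at most δ ≤ η,
which is the slack required of them. -/
theorem facetSlab_subset {τ δ η : ℝ} (hδ : 0 < δ) (hδη : δ ≤ η) (z : Fin N → E) (i : Fin N) :
    facetSlab τ δ η z i ⊆ (polytope τ z + δ • Metric.closedBall (0 : E) 1) \ polytope τ z := by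
  intro x hx
  have hz := norm_pos_of_mem_facetSlab hx
  obtain ⟨⟨h1, h2⟩, h3⟩ := hx
  refine ⟨?_, fun hmem => absurd (hmem i) (not_le.2 h1)⟩
  set s := inner ℝ x (z i) / ‖z i‖ - τ with hs
  have hs0 : 0 < s := by rw [hs, sub_pos, lt_div_iff₀ hz]; exact h1
  have hsδ : s ≤ δ := by
    have : inner ℝ x (z i) / ‖z i‖ ≤ τ + δ := by rw [div_le_iff₀ hz]; exact h2
    rw [hs]; linarith
  set θ := ‖z i‖⁻¹ • z i with hθ
  have hθn : ‖θ‖ = 1 := by rw [hθ, norm_smul, norm_inv, norm_norm, inv_mul_cancel₀ hz.ne']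
  refine Set.mem_add.2 ⟨x - s • θ, fun j => ?_, s • θ, ?_, by abel⟩
  · rw [inner_sub_left, real_inner_smul_left]
    by_cases hji : j = i
    · subst hji
      have e : inner ℝ θ (z j) = ‖z j‖ := by
        rw [hθ, real_inner_smul_left, real_inner_self_eq_norm_sq]; field_simp
      rw [e, hs, sub_mul, div_mul_cancel₀ _ hz.ne']
      linarith
    · have h4 := h3 j hji
      have h5 : -‖z j‖ ≤ inner ℝ θ (z j) := by
        have := neg_le_of_abs_le (abs_real_inner_le_norm θ (z j))
        rwa [hθn, one_mul] at this
      have h6 := mul_le_mul_of_nonneg_left h5 hs0.le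
      have h7 := mul_le_mul_of_nonneg_right (hsδ.trans hδη) (norm_nonneg (z j))
      linarith
  · refine Set.mem_smul_set.2 ⟨(s / δ) • θ, ?_, ?_⟩
    · rw [Metric.mem_closedBall, dist_zero_right, norm_smul, hθn, mul_one, Real.norm_eq_abs,
        abs_of_pos (by positivity)]
      exact (div_le_one hδ).2 hsδ
    · rw [smul_smul, mul_div_cancel₀ _ hδ.ne']

theorem pairwise_disjoint_facetSlab {τ δ η : ℝ} (hη : 0 ≤ η) (z : Fin N → E) :
    Pairwise (Function.onFun Disjoint (facetSlab τ δ η z)) := by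
  intro i j hij
  refine Set.disjoint_left.2 fun x hi hj => ?_
  have h1 := hi.1.1
  have h2 := hj.2 i hij
  nlinarith [norm_nonneg (z i)]

theorem measurableSet_facetSlab [MeasurableSpace E] [BorelSpace E] [FiniteDimensional ℝ E]
    (τ δ η : ℝ) (i : Fin N) :
    MeasurableSet {q : (Fin N → E) × E | q.2 ∈ facetSlab τ δ η q.1 i} := by
  have e : {q : (Fin N → E) × E | q.2 ∈ facetSlab τ δ η q.1 i} =
      ({q | τ * ‖q.1 i‖ < inner ℝ q.2 (q.1 i)} ∩ {q | inner ℝ q.2 (q.1 i) ≤ (τ + δ) * ‖q.1 i‖}) ∩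
      ⋂ j : Fin N, ⋂ _ : j ≠ i, {q | inner ℝ q.2 (q.1 j) ≤ (τ - η) * ‖q.1 j‖} := by
    ext q
    simp [facetSlab]
  have hm : ∀ j : Fin N, Measurable fun q : (Fin N → E) × E => inner ℝ q.2 (q.1 j) := fun j =>
    measurable_snd.inner ((measurable_pi_apply j).comp measurable_fst)
  rw [e]
  refine ((measurableSet_lt (by fun_prop) (hm i)).inter
    (measurableSet_le (hm i) (by fun_prop))).inter ?_
  exact MeasurableSet.iInter fun j => MeasurableSet.iInter fun _ =>
    measurableSet_le (hm j) (by fun_prop)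

theorem measurableSet_facetSlab_right [MeasurableSpace E] [BorelSpace E] [FiniteDimensional ℝ E]
    (τ δ η : ℝ) (z : Fin N → E) (i : Fin N) : MeasurableSet (facetSlab τ δ η z i) :=
  measurable_prodMk_left (x := z) (measurableSet_facetSlab τ δ η i)

end Polytope

/-! ### From slabs of fixed height to the Minkowski surface area -/

namespace IsRadialMeasure

variable {m : ℕ} {γ : Measure (EuclideanSpace ℝ (Fin (m + 1)))} {B : ℝ} {V : ℝ → ℝ} {r v : ℝ}

/-- Translating a set closer to the origin increases its measure. -/
theorem measure_le_of_sub_mem (h : IsRadialMeasure γ B V r v)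
    {S S' : Set (EuclideanSpace ℝ (Fin (m + 1)))} (hS : MeasurableSet S) (hS' : MeasurableSet S')
    {a : EuclideanSpace ℝ (Fin (m + 1))} (hn : ∀ x ∈ S, ‖x - a‖ ≤ ‖x‖)
    (ha : ∀ x ∈ S, x - a ∈ S') : γ S ≤ γ S' := by
  have hB := h.B_pos
  rw [h.apply_eq hS, h.apply_eq hS', ← lintegral_indicator hS, ← lintegral_indicator hS',
    ← lintegral_sub_right_eq_self (S'.indicator _) a]
  refine lintegral_mono fun x => ?_
  by_cases hx : x ∈ S
  · rw [Set.indicator_of_mem hx, Set.indicator_of_mem (ha x hx)]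
    exact ENNReal.ofReal_le_ofReal
      (mul_le_mul_of_nonneg_left (h.law.profile.anti (hn x hx)) hB.le)
  · rw [Set.indicator_of_notMem hx]
    exact zero_le

/-- Cut the slab into l layers and slide each one down the normal to the lowest position. The norms
decrease, so the measure increases; the slide is at most ε, which reduces the slack against the
other facets from 2ε to ε. -/
theorem measure_facetSlab_le (h : IsRadialMeasure γ B V r v) {N : ℕ} {τ ε : ℝ} (hτ : 0 ≤ τ)
    (hε : 0 < ε) (z : Fin N → EuclideanSpace ℝ (Fin (m + 1))) (i : Fin N) {l : ℕ} (hl : l ≠ 0) :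
    γ (facetSlab τ ε (2 * ε) z i) ≤ l * γ (facetSlab τ (ε / l) ε z i) := by
  have hl0 : (0 : ℝ) < l := by exact_mod_cast Nat.pos_of_ne_zero hl
  set S : ℕ → Set (EuclideanSpace ℝ (Fin (m + 1))) := fun q => facetSlab τ ε (2 * ε) z i ∩
    {x | (τ + q * (ε / l)) * ‖z i‖ < inner ℝ x (z i) ∧
      inner ℝ x (z i) ≤ (τ + (q + 1) * (ε / l)) * ‖z i‖} with hSdef
  have hSm : ∀ q, MeasurableSet (S q) := fun q => by
    have a1 : MeasurableSet {x : EuclideanSpace ℝ (Fin (m + 1)) |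
        (τ + q * (ε / l)) * ‖z i‖ < inner ℝ x (z i)} :=
      measurableSet_lt measurable_const (measurable_id.inner measurable_const)
    have a2 : MeasurableSet {x : EuclideanSpace ℝ (Fin (m + 1)) |
        inner ℝ x (z i) ≤ (τ + (q + 1) * (ε / l)) * ‖z i‖} :=
      measurableSet_le (measurable_id.inner measurable_const) measurable_const
    exact (measurableSet_facetSlab_right _ _ _ z i).inter (a1.inter a2)
  have hcover : facetSlab τ ε (2 * ε) z i ⊆ ⋃ q ∈ Finset.range l, S q := by
    intro x hx
    have hz := norm_pos_of_mem_facetSlab hx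
    obtain ⟨⟨h1, h2⟩, h3⟩ := hx
    set s := inner ℝ x (z i) / ‖z i‖ - τ with hs
    have hs0 : 0 < s := by rw [hs, sub_pos, lt_div_iff₀ hz]; exact h1
    have hsε : s ≤ ε := by
      have : inner ℝ x (z i) / ‖z i‖ ≤ τ + ε := by rw [div_le_iff₀ hz]; exact h2
      rw [hs]; linarith
    have hin : inner ℝ x (z i) = (τ + s) * ‖z i‖ := by rw [hs]; field_simp; ring
    have hc0 : 0 < s / (ε / l) := by positivity
    have hceil : 0 < ⌈s / (ε / l)⌉₊ := Nat.ceil_pos.2 hc0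
    obtain ⟨q, hq⟩ := Nat.exists_eq_succ_of_ne_zero hceil.ne'
    have hq1 : s ≤ (q + 1) * (ε / l) := by
      have := Nat.le_ceil (s / (ε / l))
      rw [hq, div_le_iff₀ (by positivity)] at this
      exact_mod_cast this
    have hq2 : q * (ε / l) < s := by
      have : q < ⌈s / (ε / l)⌉₊ := by omega
      have := Nat.lt_ceil.1 this
      rwa [lt_div_iff₀ (by positivity)] at this
    have hql : q < l := by
      have h5 : (q : ℝ) * (ε / l) < ε := hq2.trans_le hsε
      rw [mul_div_assoc', div_lt_iff₀ hl0] at h5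
      have : (q : ℝ) < l := by nlinarith
      exact_mod_cast this
    refine Set.mem_iUnion₂.2 ⟨q, Finset.mem_range.2 hql, ⟨⟨h1, h2⟩, h3⟩, ?_, ?_⟩
    · rw [hin]; exact mul_lt_mul_of_pos_right (by linarith) hz
    · rw [hin]; exact mul_le_mul_of_nonneg_right (by linarith) hz.le
  have hq : ∀ q ∈ Finset.range l, γ (S q) ≤ γ (facetSlab τ (ε / l) ε z i) := by
    intro q hq
    have hql : (q : ℝ) ≤ l := by exact_mod_cast (Finset.mem_range.1 hq).le
    set c := q * (ε / l) with hc
    have hc0 : 0 ≤ c := by positivity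
    have hcε : c ≤ ε := by
      rw [hc, mul_div_assoc', div_le_iff₀ hl0]; nlinarith
    refine h.measure_le_of_sub_mem (hSm q) (measurableSet_facetSlab_right _ _ _ z i)
      (a := c • (‖z i‖⁻¹ • z i)) ?_ ?_
    · rintro x ⟨hx, hx1, -⟩
      have hz := norm_pos_of_mem_facetSlab hx
      have hθn : ‖(‖z i‖⁻¹ • z i)‖ = 1 := by
        rw [norm_smul, norm_inv, norm_norm, inv_mul_cancel₀ hz.ne']
      refine le_of_sq_le_sq ?_ (norm_nonneg _)
      rw [norm_sub_sq_real, real_inner_smul_right, real_inner_smul_right, norm_smul, hθn, mul_one,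
        Real.norm_eq_abs, sq_abs]
      have h4 : c ≤ ‖z i‖⁻¹ * inner ℝ x (z i) := by
        rw [inv_mul_eq_div, le_div_iff₀ hz]
        nlinarith
      nlinarith
    · rintro x ⟨hx, hx1, hx2⟩
      have hz := norm_pos_of_mem_facetSlab hx
      have hθn : ‖(‖z i‖⁻¹ • z i)‖ = 1 := by
        rw [norm_smul, norm_inv, norm_norm, inv_mul_cancel₀ hz.ne']
      have e : inner ℝ (‖z i‖⁻¹ • z i) (z i) = ‖z i‖ := by
        rw [real_inner_smul_left, real_inner_self_eq_norm_sq]; field_simp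
      refine ⟨⟨?_, ?_⟩, fun j hj => ?_⟩
      · rw [inner_sub_left, real_inner_smul_left _ _ c, e]; linarith
      · rw [inner_sub_left, real_inner_smul_left _ _ c, e]; linarith
      · rw [inner_sub_left, real_inner_smul_left _ _ c]
        have h4 := hx.2 j hj
        have h5 : -‖z j‖ ≤ inner ℝ (‖z i‖⁻¹ • z i) (z j) := by
          have := neg_le_of_abs_le (abs_real_inner_le_norm (‖z i‖⁻¹ • z i) (z j))
          rwa [hθn, one_mul] at this
        have h6 := mul_le_mul_of_nonneg_left h5 hc0
        have h7 := mul_le_mul_of_nonneg_right hcε (norm_nonneg (z j))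
        linarith
  calc γ (facetSlab τ ε (2 * ε) z i) ≤ γ (⋃ q ∈ Finset.range l, S q) := measure_mono hcover
    _ ≤ ∑ q ∈ Finset.range l, γ (S q) := measure_biUnion_finset_le _ _
    _ ≤ ∑ q ∈ Finset.range l, γ (facetSlab τ (ε / l) ε z i) := Finset.sum_le_sum hq
    _ = _ := by rw [Finset.sum_const, Finset.card_range, nsmul_eq_mul]

/-- The surface area of a polytope is bounded below by the normalized measure of the slabs above
its facets, at a fixed height. -/
theorem sum_measure_facetSlab_le (h : IsRadialMeasure γ B V r v) {N : ℕ} {τ ε : ℝ} (hτ : 0 ≤ τ)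
    (hε : 0 < ε) (z : Fin N → EuclideanSpace ℝ (Fin (m + 1))) :
    (∑ i, γ (facetSlab τ ε (2 * ε) z i)) / ENNReal.ofReal (2 * ε) ≤
      surfaceArea γ (polytope τ z) := by
  rw [surfaceArea]
  refine le_liminf_of_le (by isBoundedDefault) ?_
  filter_upwards [Ioo_mem_nhdsGT hε] with δ hδ
  have hδ0 := hδ.1
  -- Then ε / l ≤ δ, so the thin slabs fit into the δ-neighbourhood, while l δ ≤ ε + δ ≤ 2ε, the
  -- denominator in the statement.
  set l := ⌈ε / δ⌉₊ with hl
  have hl0 : 0 < l := Nat.ceil_pos.2 (by positivity)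
  have hlR : (0 : ℝ) < l := by exact_mod_cast hl0
  have h1 : ε / l ≤ δ := by
    rw [div_le_iff₀ hlR]
    have := Nat.le_ceil (ε / δ)
    rw [div_le_iff₀ hδ0] at this
    linarith
  have h2 : l * δ ≤ 2 * ε := by
    have := (Nat.ceil_lt_add_one (by positivity : 0 ≤ ε / δ)).le
    have := mul_le_mul_of_nonneg_right this hδ0.le
    rw [add_mul, div_mul_cancel₀ _ hδ0.ne'] at this
    linarith [hδ.2]
  have h3 : ∑ i, γ (facetSlab τ (ε / l) ε z i) ≤
      γ ((polytope τ z + δ • Metric.closedBall (0 : EuclideanSpace ℝ (Fin (m + 1))) 1) \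
        polytope τ z) := by
    have hdisj := pairwise_disjoint_facetSlab (τ := τ) (δ := ε / l) hε.le z
    rw [← tsum_fintype (L := .unconditional _), ← measure_iUnion hdisj
      fun i => measurableSet_facetSlab_right _ _ _ z i]
    refine measure_mono (Set.iUnion_subset fun i => ?_)
    have hsub : facetSlab τ (ε / l) ε z i ⊆ facetSlab τ δ ε z i := by
      rintro x ⟨⟨a1, a2⟩, a3⟩
      exact ⟨⟨a1, a2.trans (mul_le_mul_of_nonneg_right (by linarith) (norm_nonneg _))⟩, a3⟩
    exact hsub.trans (facetSlab_subset hδ0 hδ.2.le z i)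
  have h4 : ∑ i, γ (facetSlab τ ε (2 * ε) z i) ≤ l * γ ((polytope τ z +
      δ • Metric.closedBall (0 : EuclideanSpace ℝ (Fin (m + 1))) 1) \ polytope τ z) := by
    refine (Finset.sum_le_sum fun i _ => h.measure_facetSlab_le hτ hε z i hl0.ne').trans ?_
    rw [← Finset.mul_sum]
    exact mul_le_mul_right h3 _
  refine ENNReal.div_le_of_le_mul ?_
  refine h4.trans ?_
  rw [div_eq_mul_inv, mul_assoc, mul_comm]
  refine mul_le_mul_right ?_ _
  rw [← ENNReal.ofReal_inv_of_pos hδ0, ← ENNReal.ofReal_mul (by positivity),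
    ← ENNReal.ofReal_natCast]
  refine ENNReal.ofReal_le_ofReal ?_
  rw [inv_mul_eq_div, le_div_iff₀ hδ0]
  exact h2

end IsRadialMeasure

/-! ### Random polytopes -/

section RandomPolytope

variable {E : Type*} [NormedAddCommGroup E] [InnerProductSpace ℝ E] [MeasurableSpace E]

/-- For a fixed x the condition constrains each direction separately, so the event is a product set:
one slab condition and N - 1 halfspace conditions. -/
theorem pi_mem_facetSlab (μ : Measure E) [IsProbabilityMeasure μ] {N : ℕ} (τ δ η : ℝ) (i : Fin N)
    (x : E) :
    Measure.pi (fun _ : Fin N => μ) {z | x ∈ facetSlab τ δ η z i} =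
      μ {z | τ * ‖z‖ < inner ℝ x z ∧ inner ℝ x z ≤ (τ + δ) * ‖z‖} *
        μ {z | inner ℝ x z ≤ (τ - η) * ‖z‖} ^ (N - 1) := by
  have e : {z : Fin N → E | x ∈ facetSlab τ δ η z i} = Set.univ.pi fun j =>
      if j = i then {z | τ * ‖z‖ < inner ℝ x z ∧ inner ℝ x z ≤ (τ + δ) * ‖z‖}
      else {z | inner ℝ x z ≤ (τ - η) * ‖z‖} := by
    ext z
    simp only [facetSlab, Set.mem_ofPred_eq, Set.mem_univ_pi]
    constructor
    · rintro ⟨h1, h2⟩ j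
      by_cases hj : j = i
      · subst hj; simpa using h1
      · simpa [hj] using h2 j hj
    · intro hz
      refine ⟨by simpa using hz i, fun j hj => by simpa [hj] using hz j⟩
  rw [e, Measure.pi_pi, ← Finset.mul_prod_erase _ _ (Finset.mem_univ i), if_pos rfl,
    Finset.prod_congr rfl (g := fun _ => μ {z | inner ℝ x z ≤ (τ - η) * ‖z‖})
      (fun j hj => by rw [if_neg (Finset.ne_of_mem_erase hj)]),
    Finset.prod_const, Finset.card_erase_of_mem (Finset.mem_univ i), Finset.card_univ,
    Fintype.card_fin]

/-- Some choice of facet directions does at least as well as independent random directions. -/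
theorem exists_le_sum_measure_facetSlab [FiniteDimensional ℝ E] [BorelSpace E] (μ γ : Measure E) [IsProbabilityMeasure μ]
    [IsProbabilityMeasure γ] (N : ℕ) (τ δ η : ℝ) :
    ∃ z : Fin N → E, N * ∫⁻ x, μ {z | τ * ‖z‖ < inner ℝ x z ∧ inner ℝ x z ≤ (τ + δ) * ‖z‖} *
        μ {z | inner ℝ x z ≤ (τ - η) * ‖z‖} ^ (N - 1) ∂γ ≤
      ∑ i, γ (facetSlab τ δ η z i) := by
  have hint : ∫⁻ z : Fin N → E, ∑ i, γ (facetSlab τ δ η z i) ∂(Measure.pi fun _ => μ) =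
      N * ∫⁻ x, μ {z | τ * ‖z‖ < inner ℝ x z ∧ inner ℝ x z ≤ (τ + δ) * ‖z‖} *
        μ {z | inner ℝ x z ≤ (τ - η) * ‖z‖} ^ (N - 1) ∂γ := by
    have hm : ∀ i : Fin N, Measurable fun z : Fin N → E => γ (facetSlab τ δ η z i) := fun i =>
      measurable_measure_prodMk_left (measurableSet_facetSlab τ δ η i)
    rw [lintegral_finsetSum _ fun i _ => hm i]
    have hi : ∀ i : Fin N, ∫⁻ z : Fin N → E, γ (facetSlab τ δ η z i) ∂(Measure.pi fun _ => μ) =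
        ∫⁻ x, μ {z | τ * ‖z‖ < inner ℝ x z ∧ inner ℝ x z ≤ (τ + δ) * ‖z‖} *
          μ {z | inner ℝ x z ≤ (τ - η) * ‖z‖} ^ (N - 1) ∂γ := by
      intro i
      -- Fubini exchanges the random directions with the point x.
      have h1 := Measure.prod_apply (μ := Measure.pi fun _ : Fin N => μ) (ν := γ)
        (measurableSet_facetSlab τ δ η i)
      have h2 := Measure.prod_apply_symm (μ := Measure.pi fun _ : Fin N => μ) (ν := γ)
        (measurableSet_facetSlab τ δ η i)
      refine (h1.symm.trans h2).trans (lintegral_congr fun x => ?_)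
      exact pi_mem_facetSlab μ τ δ η i x
    simp_rw [hi]
    rw [Finset.sum_const, Finset.card_univ, Fintype.card_fin, nsmul_eq_mul]
  rw [← hint]
  refine exists_lintegral_le (ne_top_of_le_ne_top (ENNReal.natCast_ne_top N) ?_)
  calc ∫⁻ z : Fin N → E, ∑ i, γ (facetSlab τ δ η z i) ∂(Measure.pi fun _ => μ)
      ≤ ∫⁻ z : Fin N → E, N ∂(Measure.pi fun _ => μ) := by
        refine lintegral_mono fun z => ?_
        calc ∑ i, γ (facetSlab τ δ η z i) ≤ ∑ _i : Fin N, 1 :=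
              Finset.sum_le_sum fun i _ => prob_le_one
          _ = N := by simp
    _ = N := by simp

end RandomPolytope

/-! ### Probabilities for a single random facet and the numerical constants -/

theorem le_ballMeasure_slab {k : ℕ} {κ : ℝ} (hκ : 0 < κ)
    (hκa : ∀ e : EuclideanSpace ℝ (Fin (k + 2)), ‖e‖ = 1 → ∀ G : ℝ → ℝ≥0∞, Measurable G →
      ∫⁻ z, G (inner ℝ e z / ‖z‖) ∂ballMeasure (k + 2) = ENNReal.ofReal κ *
        ∫⁻ α in Set.Ioo 0 Real.pi, ENNReal.ofReal (Real.sin α ^ k) * G (Real.cos α))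
    {x : EuclideanSpace ℝ (Fin (k + 2))} (hx : 0 < ‖x‖) {τ δ : ℝ} (hτ : 0 ≤ τ) (hδ : 0 < δ)
    (hc : (τ + δ) / ‖x‖ < 1) :
    ENNReal.ofReal (κ * (δ / ‖x‖ * √(1 - ((τ + δ) / ‖x‖) ^ 2) ^ k)) ≤
      ballMeasure (k + 2) {z | τ * ‖z‖ < inner ℝ x z ∧ inner ℝ x z ≤ (τ + δ) * ‖z‖} := by
  have he : ‖(‖x‖⁻¹ • x)‖ = 1 := by
    rw [norm_smul, norm_inv, norm_norm, inv_mul_cancel₀ hx.ne']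
  have hS : MeasurableSet {z : EuclideanSpace ℝ (Fin (k + 2)) |
      τ * ‖z‖ < inner ℝ x z ∧ inner ℝ x z ≤ (τ + δ) * ‖z‖} := by
    have a1 : MeasurableSet {z : EuclideanSpace ℝ (Fin (k + 2)) | τ * ‖z‖ < inner ℝ x z} :=
      measurableSet_lt (by fun_prop) (measurable_const.inner measurable_id)
    have a2 : MeasurableSet {z : EuclideanSpace ℝ (Fin (k + 2)) |
        inner ℝ x z ≤ (τ + δ) * ‖z‖} :=
      measurableSet_le (measurable_const.inner measurable_id) (by fun_prop)
    exact a1.inter a2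
  have e : ∀ z : EuclideanSpace ℝ (Fin (k + 2)),
      {z | τ * ‖z‖ < inner ℝ x z ∧ inner ℝ x z ≤ (τ + δ) * ‖z‖}.indicator (1 : EuclideanSpace ℝ (Fin (k + 2)) → ℝ≥0∞) z =
        (Set.Ioc (τ / ‖x‖) ((τ + δ) / ‖x‖)).indicator 1 (inner ℝ (‖x‖⁻¹ • x) z / ‖z‖) := by
    intro z
    simp only [Set.indicator_apply, Pi.one_apply]
    refine if_congr ?_ rfl rfl
    rw [Set.mem_ofPred_eq, Set.mem_Ioc, real_inner_smul_left]
    rcases (norm_nonneg z).eq_or_lt with hz | hz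
    · have : z = 0 := norm_eq_zero.1 hz.symm
      subst this
      have : ¬ τ / ‖x‖ < 0 := not_lt.2 (by positivity)
      simp [this]
    · rw [inv_mul_eq_div, div_div, div_lt_div_iff₀ hx (by positivity),
        div_le_div_iff₀ (by positivity) hx]
      constructor
      · rintro ⟨h1, h2⟩; constructor <;> nlinarith
      · rintro ⟨h1, h2⟩; constructor <;> nlinarith
  rw [← lintegral_indicator_one hS, lintegral_congr e,
    hκa _ he _ (measurable_one.indicator measurableSet_Ioc), ENNReal.ofReal_mul hκ.le]
  refine mul_le_mul_right ?_ _
  have h1 := le_lintegral_slab k (b := τ / ‖x‖) (c := (τ + δ) / ‖x‖) (by positivity)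
    (by gcongr; linarith) hc
  refine le_trans (le_of_eq ?_) h1
  rw [add_div, add_sub_cancel_left]

theorem le_ballMeasure_halfspace {k : ℕ} {κ : ℝ} (hκ : 0 < κ)
    (hκa : ∀ e : EuclideanSpace ℝ (Fin (k + 2)), ‖e‖ = 1 → ∀ G : ℝ → ℝ≥0∞, Measurable G →
      ∫⁻ z, G (inner ℝ e z / ‖z‖) ∂ballMeasure (k + 2) = ENNReal.ofReal κ *
        ∫⁻ α in Set.Ioo 0 Real.pi, ENNReal.ofReal (Real.sin α ^ k) * G (Real.cos α))
    {x : EuclideanSpace ℝ (Fin (k + 2))} {τ b : ℝ} (hb : 0 < b) (hb1 : b < 1)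
    (hx : 0 < ‖x‖) (hbx : b * ‖x‖ ≤ τ) :
    1 - ENNReal.ofReal (κ * (√(1 - b ^ 2) ^ (k + 1) / ((k + 1) * b))) ≤
      ballMeasure (k + 2) {z | inner ℝ x z ≤ τ * ‖z‖} := by
  have he : ‖(‖x‖⁻¹ • x)‖ = 1 := by
    rw [norm_smul, norm_inv, norm_norm, inv_mul_cancel₀ hx.ne']
  have hS : MeasurableSet {z : EuclideanSpace ℝ (Fin (k + 2)) |
      b < inner ℝ (‖x‖⁻¹ • x) z / ‖z‖} :=
    measurableSet_lt measurable_const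
      ((measurable_const.inner measurable_id).div measurable_id.norm)
  have hcap : ballMeasure (k + 2) {z | b < inner ℝ (‖x‖⁻¹ • x) z / ‖z‖} ≤
      ENNReal.ofReal (κ * (√(1 - b ^ 2) ^ (k + 1) / ((k + 1) * b))) := by
    have e : ∀ z : EuclideanSpace ℝ (Fin (k + 2)),
        {z | b < inner ℝ (‖x‖⁻¹ • x) z / ‖z‖}.indicator (1 : EuclideanSpace ℝ (Fin (k + 2)) → ℝ≥0∞) z =
        (Set.Ioi b).indicator 1 (inner ℝ (‖x‖⁻¹ • x) z / ‖z‖) := fun z => rfl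
    rw [← lintegral_indicator_one hS, lintegral_congr e,
      hκa _ he _ (measurable_one.indicator measurableSet_Ioi), ENNReal.ofReal_mul hκ.le]
    exact mul_le_mul_right (lintegral_cap_le k hb hb1) _
  have hsub : {z : EuclideanSpace ℝ (Fin (k + 2)) | b < inner ℝ (‖x‖⁻¹ • x) z / ‖z‖}ᶜ ⊆
      {z | inner ℝ x z ≤ τ * ‖z‖} := by
    intro z hz
    have hz : inner ℝ (‖x‖⁻¹ • x) z / ‖z‖ ≤ b := not_lt.1 hz
    rcases (norm_nonneg z).eq_or_lt with h0 | h0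
    · have : z = 0 := norm_eq_zero.1 h0.symm
      subst this
      simp
    · rw [real_inner_smul_left, inv_mul_eq_div, div_div, div_le_iff₀ (by positivity)] at hz
      rw [Set.mem_ofPred_eq]
      nlinarith
  calc _ ≤ 1 - ballMeasure (k + 2) {z | b < inner ℝ (‖x‖⁻¹ • x) z / ‖z‖} :=
        tsub_le_tsub_left hcap _
    _ = ballMeasure (k + 2) {z | b < inner ℝ (‖x‖⁻¹ • x) z / ‖z‖}ᶜ := (prob_compl_eq_one_sub hS).symm
    _ ≤ _ := measure_mono hsub

/-- The ratio t = (1 - c²)/(1 - b²) is at least 1 - 2(c² - b²), so t ^ k ≥ 1/2 by Bernoulli, and √t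
≥ t because t ≤ 1. -/
theorem half_mul_sqrt_pow_le {b c : ℝ} {k : ℕ} (hb : 0 ≤ b) (hbc : b ≤ c) (hc : c ≤ 1 / 2)
    (h : k * (c ^ 2 - b ^ 2) ≤ 1 / 4) :
    1 / 2 * √(1 - b ^ 2) ^ k ≤ √(1 - c ^ 2) ^ k := by
  have hb2 : b ^ 2 ≤ c ^ 2 := pow_le_pow_left₀ hb hbc 2
  have hc2 : c ^ 2 ≤ 1 / 4 := by nlinarith
  have hB : 0 < 1 - b ^ 2 := by linarith
  have hC : 0 < 1 - c ^ 2 := by linarith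
  set t := (1 - c ^ 2) / (1 - b ^ 2) with ht
  have ht0 : 0 < t := by positivity
  have ht1 : t ≤ 1 := by rw [ht, div_le_one hB]; linarith
  have htl : 1 + -(2 * (c ^ 2 - b ^ 2)) ≤ t := by
    rw [ht, le_div_iff₀ hB]; nlinarith
  have hpow : 1 / 2 ≤ t ^ k := by
    have h1 := one_add_mul_le_pow (a := -(2 * (c ^ 2 - b ^ 2))) (by nlinarith) k
    have h2 : (1 + -(2 * (c ^ 2 - b ^ 2))) ^ k ≤ t ^ k :=
      pow_le_pow_left₀ (by nlinarith) htl k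
    linarith
  have hst : t ≤ √t := by
    rw [Real.le_sqrt' ht0]; nlinarith
  have e : √(1 - c ^ 2) = √t * √(1 - b ^ 2) := by
    rw [← Real.sqrt_mul ht0.le, ht, div_mul_cancel₀ _ hB.ne']
  rw [e, mul_pow]
  refine mul_le_mul_of_nonneg_right ?_ (by positivity)
  exact hpow.trans (pow_le_pow_left₀ ht0.le hst k)

/-- The cosines (τ + ε)/ρ and (τ - 2ε)/(r + 8/M) have sum at most 20τ/r and difference at most
128τ/(Mr²) + 24ε/r. After multiplication by n the first product is 2560/16384 = 5/32 by the size of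
τ, the second at most 480/6400 = 3/40, together below 1/4. Hence sin ^ n of the angle varies by a
bounded factor over the whole spherical shell. -/
theorem facet_angle_bounds {n r M τ ε ρ : ℝ} (hn : 0 < n) (hr : 0 < r) (hM : 0 < M)
    (hMr : M * r ≤ n) (hτ : 0 < τ) (hτe : 16384 * n * τ ^ 2 = M * r ^ 3) (hε : 0 < ε)
    (hετ : 4 * ε ≤ τ) (hεr : 6400 * (n * τ * ε) ≤ r ^ 2) (hρ : r / 8 < ρ) (hρr : |ρ - r| < 8 / M) :
    (τ - 2 * ε) / (r + 8 / M) ≤ (τ + ε) / ρ ∧ (τ + ε) / ρ ≤ 1 / 2 ∧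
      n * (((τ + ε) / ρ) ^ 2 - ((τ - 2 * ε) / (r + 8 / M)) ^ 2) ≤ 1 / 4 := by
  have hρ0 : 0 < ρ := by linarith
  have h8 : 0 < 8 / M := by positivity
  obtain ⟨ha, hb⟩ := abs_lt.1 hρr
  set R := r + 8 / M with hR
  have hR0 : 0 < R := by positivity
  have hτr : 128 * τ ≤ r := by
    have h1 : (128 * τ) ^ 2 ≤ r ^ 2 := by
      have : n * (128 * τ) ^ 2 ≤ n * r ^ 2 := by nlinarith [sq_nonneg r, pow_pos hr 2]
      exact le_of_mul_le_mul_left this hn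
    exact le_of_sq_le_sq h1 hr.le
  have hc1 : (τ + ε) / ρ ≤ 10 * τ / r := by
    rw [div_le_div_iff₀ hρ0 hr]; nlinarith
  have hc2 : 10 * τ / r ≤ 1 / 2 := by rw [div_le_iff₀ hr]; linarith
  have hbc : (τ - 2 * ε) / R ≤ (τ + ε) / ρ :=
    div_le_div₀ (by linarith) (by linarith) hρ0 (by linarith)
  have hb0 : 0 ≤ (τ - 2 * ε) / R := div_nonneg (by linarith) hR0.le
  refine ⟨hbc, hc1.trans hc2, ?_⟩
  have hdiff : (τ + ε) / ρ - (τ - 2 * ε) / R ≤ 128 * τ / (M * r ^ 2) + 24 * ε / r := by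
    have e1 : (τ + ε) / ρ - (τ - 2 * ε) / R = τ * ((R - ρ) / (ρ * R)) + ε / ρ + 2 * ε / R := by
      field_simp
      ring
    have h1 : (R - ρ) / (ρ * R) ≤ (16 / M) / (r / 8 * r) := by
      refine div_le_div₀ (by positivity) ?_ (by positivity) ?_
      · have : 16 / M = 8 / M + 8 / M := by ring
        linarith
      · exact mul_le_mul hρ.le (by linarith) hr.le hρ0.le
    have h2 : ε / ρ ≤ 8 * ε / r := by rw [div_le_div_iff₀ hρ0 hr]; nlinarith
    have h3 : 2 * ε / R ≤ 16 * ε / r := by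
      rw [div_le_div_iff₀ hR0 hr]; nlinarith
    have h4 := mul_le_mul_of_nonneg_left h1 hτ.le
    have e2 : τ * ((16 / M) / (r / 8 * r)) = 128 * τ / (M * r ^ 2) := by
      field_simp
      ring
    have e3 : 24 * ε / r = 8 * ε / r + 16 * ε / r := by ring
    linarith
  have hsum : (τ + ε) / ρ + (τ - 2 * ε) / R ≤ 20 * τ / r := by
    have : 20 * τ / r = 10 * τ / r + 10 * τ / r := by ring
    linarith
  have hprod : ((τ + ε) / ρ) ^ 2 - ((τ - 2 * ε) / R) ^ 2 ≤
      20 * τ / r * (128 * τ / (M * r ^ 2) + 24 * ε / r) := by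
    rw [sq_sub_sq]
    exact mul_le_mul hsum hdiff (by linarith) (by positivity)
  refine (mul_le_mul_of_nonneg_left hprod hn.le).trans ?_
  have e4 : n * (20 * τ / r * (128 * τ / (M * r ^ 2) + 24 * ε / r)) =
      2560 * (n * τ ^ 2) / (M * r ^ 3) + 480 * (n * τ * ε) / r ^ 2 := by
    field_simp
    ring
  have h5 : 2560 * (n * τ ^ 2) / (M * r ^ 3) ≤ 5 / 32 := by
    rw [div_le_iff₀ (by positivity)]; linarith
  have h6 : 480 * (n * τ * ε) / r ^ 2 ≤ 3 / 40 := by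
    rw [div_le_iff₀ (by positivity)]; linarith
  rw [e4]
  linarith

/-- With N = ⌈1/(2P)⌉ the exponent N - 1 is below 1/(2P), and Bernoulli gives 1 - (N - 1)P ≥ 1/2.
The case N = 1 is separate since P may exceed 1. -/
theorem exists_nat_half_le {P : ℝ} (hP : 0 < P) :
    ∃ N : ℕ, 1 / (2 * P) ≤ N ∧
      ENNReal.ofReal (1 / 2) ≤ (1 - ENNReal.ofReal P) ^ (N - 1) := by
  refine ⟨⌈1 / (2 * P)⌉₊, Nat.le_ceil _, ?_⟩
  have h0 : 0 < ⌈1 / (2 * P)⌉₊ := Nat.ceil_pos.2 (by positivity)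
  obtain ⟨q, hq⟩ := Nat.exists_eq_succ_of_ne_zero h0.ne'
  rw [hq, Nat.succ_sub_one]
  have h1 : (q : ℝ) < 1 / (2 * P) := Nat.lt_ceil.1 (by omega)
  rw [lt_div_iff₀ (by positivity)] at h1
  rcases Nat.eq_zero_or_pos q with rfl | hq0
  · rw [pow_zero, ENNReal.ofReal_le_one]; norm_num
  · have hq1 : (1 : ℝ) ≤ q := by exact_mod_cast hq0
    have hP1 : P ≤ 1 / 2 := by nlinarith
    rw [← ENNReal.ofReal_one, ← ENNReal.ofReal_sub _ hP.le, ← ENNReal.ofReal_pow (by linarith)]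
    refine ENNReal.ofReal_le_ofReal ?_
    have h2 := one_add_mul_le_pow (a := -P) (by linarith) q
    rw [← sub_eq_add_neg] at h2
    nlinarith

/-- Multiplying the number of facets by the slab probability cancels κ, and s ^ k against s ^ (k +
1) with s ≤ 1, leaving a multiple of n b ε / R. With b of order rΛ/n and R ≤ 33r this is of order
Λε. -/
theorem facet_count_bound {k N : ℕ} {r R n Λ ε b s κ : ℝ} (hr : 0 < r) (hR0 : 0 < R)
    (hR33 : R ≤ 33 * r) (hn : 0 < n) (hkn : n ≤ 2 * (k + 1)) (hΛ : 0 < Λ) (hε : 0 < ε)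
    (hb : 0 < b) (hbl : r ^ 2 * Λ / (128 * n) / (2 * R) ≤ b) (hs0 : 0 < s) (hs1 : s ≤ 1)
    (hκ : 0 < κ) (hN : 1 / (2 * (κ * (s ^ (k + 1) / ((k + 1) * b)))) ≤ N) :
    1 / 40000000 * Λ ≤
      N * (κ * (ε / R * (1 / 2 * s ^ k)) * (1 / 2) * (1 / 4)) / (2 * ε) := by
  have h1 : (k + 1) * b * ε / (4 * R) ≤ N * (κ * (ε / R * (1 / 2 * s ^ k))) := by
    refine le_trans ?_ (mul_le_mul_of_nonneg_right hN (by positivity))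
    have e : 1 / (2 * (κ * (s ^ (k + 1) / ((k + 1) * b)))) * (κ * (ε / R * (1 / 2 * s ^ k))) =
        (k + 1) * b * ε / (4 * R) / s := by
      field_simp; ring
    rw [e]
    exact le_div_self (by positivity) hs0 hs1
  have h2 : Λ / 40000000 ≤ (k + 1) * b / (64 * R) := by
    have h3 : n / 2 * (r ^ 2 * Λ / (128 * n) / (2 * R)) ≤ (k + 1) * b :=
      mul_le_mul (by linarith) hbl (by positivity) (by positivity)
    have h4 : n / 2 * (r ^ 2 * Λ / (128 * n) / (2 * R)) / (64 * R) ≤ (k + 1) * b / (64 * R) :=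
      div_le_div_of_nonneg_right h3 (by positivity)
    refine le_trans ?_ h4
    have e : n / 2 * (r ^ 2 * Λ / (128 * n) / (2 * R)) / (64 * R) =
        r ^ 2 * Λ / (32768 * R ^ 2) := by
      field_simp; norm_num
    have hR2 : R ^ 2 ≤ (33 * r) ^ 2 := pow_le_pow_left₀ hR0.le hR33 2
    have h5 := mul_le_mul_of_nonneg_left hR2 hΛ.le
    have h6 : 0 < r ^ 2 * Λ := by positivity
    rw [e, div_le_div_iff₀ (by norm_num) (by positivity)]
    linarith
  rw [le_div_iff₀ (by positivity)]
  have h5 := mul_le_mul_of_nonneg_right h2 hε.le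
  have e : (k + 1) * b / (64 * R) * ε = (k + 1) * b * ε / (4 * R) / 16 := by
    field_simp; norm_num
  linarith

namespace IsRadialMeasure

variable {m : ℕ} {γ : Measure (EuclideanSpace ℝ (Fin (m + 1)))} {B : ℝ} {V : ℝ → ℝ} {r v : ℝ}

theorem le_maxSurfaceArea (h : IsRadialMeasure γ B V r v) :
    ENNReal.ofReal (1 / 40000000 * √((m + 1) * peak (B * sphereArea m) m r v / r)) ≤
      maxSurfaceArea γ := by
  have hprob := h.isProbabilityMeasure
  have hr := h.law.mode.r_pos
  have hM := h.law.peak_pos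
  have hMr := h.law.peak_mul_le
  have hMr' := h.law.one_le_peak_mul
  have hJ := h.hasRadialDensity.le_prob_near_mode h.law
  obtain ⟨k, rfl⟩ := Nat.exists_eq_succ_of_ne_zero h.law.m_ne
  set M := peak (B * sphereArea k.succ) k.succ r v
  obtain ⟨κ, hκ, hκa⟩ := exists_lintegral_ballMeasure_angle k
  set n : ℝ := ((k.succ : ℕ) : ℝ) + 1 with hn
  have hkn : (k : ℝ) + 2 = n := by rw [hn, Nat.cast_succ]; ring
  have hk0 : (0 : ℝ) ≤ k := Nat.cast_nonneg k
  have hn0 : 0 < n := by linarith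
  set Λ := √(n * M / r) with hΛ
  have hΛ0 : 0 < Λ := by positivity
  have hΛ2 : Λ ^ 2 = n * M / r := Real.sq_sqrt (by positivity)
  -- Equivalently 128² n τ² = M r³: the largest order at which the cap probabilities remain
  -- comparable over the shell ||x| - r| < 8/M.
  set τ := r ^ 2 * Λ / (128 * n) with hτ
  have hτ0 : 0 < τ := by positivity
  have hτe : 16384 * n * τ ^ 2 = M * r ^ 3 := by
    rw [hτ, div_pow, mul_pow, hΛ2]; field_simp; norm_num
  set ε := min (τ / 4) (r ^ 2 / (6400 * (n * τ))) with hε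
  have hε0 : 0 < ε := by positivity
  have hετ : 4 * ε ≤ τ := by linarith [min_le_left (τ / 4) (r ^ 2 / (6400 * (n * τ)))]
  have hεr : 6400 * (n * τ * ε) ≤ r ^ 2 := by
    have := min_le_right (τ / 4) (r ^ 2 / (6400 * (n * τ)))
    rw [le_div_iff₀ (by positivity)] at this
    linarith
  set R := r + 8 / M with hR
  have h8 : 0 < 8 / M := by positivity
  have hR0 : 0 < R := by positivity
  have hR33 : R ≤ 33 * r := by
    have : 8 / M ≤ 32 * r := by rw [div_le_iff₀ hM]; linarith
    linarith
  -- The smallest cosine that matters: R bounds the norms in the shell, and facets must be avoided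
  -- by a margin 2ε. The corresponding P bounds the probability that a random halfspace comes too
  -- close to x.
  set b := (τ - 2 * ε) / R with hb
  have hb0 : 0 < b := div_pos (by linarith) hR0
  have hbl : τ / (2 * R) ≤ b := by
    rw [hb, div_le_div_iff₀ (by positivity) hR0]; nlinarith
  have hang := fun ρ (h1 : r / 8 < ρ) (h2 : |ρ - r| < 8 / M) =>
    facet_angle_bounds hn0 hr hM hMr hτ0 hτe hε0 hετ hεr h1 h2
  have hb1 : b ≤ 1 / 2 := by
    obtain ⟨h1, h2, -⟩ := hang r (by linarith) (by simpa using h8)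
    exact h1.trans h2
  have hs0 : 0 < √(1 - b ^ 2) := Real.sqrt_pos.2 (by nlinarith)
  have hs1 : √(1 - b ^ 2) ≤ 1 := Real.sqrt_le_one.2 (by nlinarith)
  set s := √(1 - b ^ 2)
  set P := κ * (s ^ (k + 1) / ((k + 1) * b)) with hP
  have hP0 : 0 < P := by positivity
  obtain ⟨N, hN, hNP⟩ := exists_nat_half_le hP0
  set q := κ * (ε / R * (1 / 2 * s ^ k)) with hq
  have hq0 : 0 < q := by positivity
  have hpt : ∀ x : EuclideanSpace ℝ (Fin (k + 2)), x ∈ {x : EuclideanSpace ℝ (Fin (k + 2)) |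
      r / 8 < ‖x‖ ∧ |‖x‖ - r| < 8 / M} → ENNReal.ofReal (q * (1 / 2)) ≤
      ballMeasure (k + 2) {z | τ * ‖z‖ < inner ℝ x z ∧ inner ℝ x z ≤ (τ + ε) * ‖z‖} *
        ballMeasure (k + 2) {z | inner ℝ x z ≤ (τ - 2 * ε) * ‖z‖} ^ (N - 1) := by
    rintro x ⟨hx1, hx2⟩
    obtain ⟨h1, h2, h3⟩ := hang _ hx1 hx2
    have hx0 : 0 < ‖x‖ := by linarith
    have hxR : ‖x‖ ≤ R := by linarith [(abs_lt.1 hx2).2]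
    have hcb : 0 ≤ ((τ + ε) / ‖x‖) ^ 2 - b ^ 2 := sub_nonneg.2 (pow_le_pow_left₀ hb0.le h1 2)
    rw [ENNReal.ofReal_mul hq0.le]
    refine mul_le_mul' ?_ ?_
    · refine le_trans (ENNReal.ofReal_le_ofReal ?_)
        (le_ballMeasure_slab hκ hκa hx0 hτ0.le hε0 (by linarith))
      refine mul_le_mul_of_nonneg_left (mul_le_mul ?_ ?_ (by positivity) (by positivity)) hκ.le
      · exact div_le_div_of_nonneg_left hε0.le hx0 hxR
      · exact half_mul_sqrt_pow_le hb0.le h1 h2 (by nlinarith)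
    · refine hNP.trans (pow_le_pow_left' ?_ _)
      refine le_ballMeasure_halfspace hκ hκa hb0 (by linarith) hx0 ?_
      rw [hb, div_mul_eq_mul_div, div_le_iff₀ hR0]
      exact mul_le_mul_of_nonneg_left hxR (by linarith)
  obtain ⟨z, hz⟩ := exists_le_sum_measure_facetSlab (ballMeasure (k + 2)) γ N τ ε (2 * ε)
  have hJm : MeasurableSet {x : EuclideanSpace ℝ (Fin (k + 2)) |
      r / 8 < ‖x‖ ∧ |‖x‖ - r| < 8 / M} := by
    have a1 : MeasurableSet {x : EuclideanSpace ℝ (Fin (k + 2)) | r / 8 < ‖x‖} :=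
      measurableSet_lt measurable_const measurable_norm
    have a2 : MeasurableSet {x : EuclideanSpace ℝ (Fin (k + 2)) | |‖x‖ - r| < 8 / M} :=
      measurableSet_lt (by fun_prop) measurable_const
    exact a1.inter a2
  have hsum : ENNReal.ofReal (N * (q * (1 / 2) * (1 / 4))) ≤
      ∑ i, γ (facetSlab τ ε (2 * ε) z i) := by
    refine le_trans ?_ hz
    rw [ENNReal.ofReal_mul (Nat.cast_nonneg N), ENNReal.ofReal_natCast,
      ENNReal.ofReal_mul (by positivity)]
    refine mul_le_mul_right ?_ _
    calc ENNReal.ofReal (q * (1 / 2)) * ENNReal.ofReal (1 / 4)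
        ≤ ENNReal.ofReal (q * (1 / 2)) * γ {x : EuclideanSpace ℝ (Fin (k + 2)) |
            r / 8 < ‖x‖ ∧ |‖x‖ - r| < 8 / M} := mul_le_mul_right hJ _
      _ = ∫⁻ _ in {x : EuclideanSpace ℝ (Fin (k + 2)) | r / 8 < ‖x‖ ∧ |‖x‖ - r| < 8 / M},
            ENNReal.ofReal (q * (1 / 2)) ∂γ := (setLIntegral_const _ _).symm
      _ ≤ _ := (setLIntegral_mono' hJm hpt).trans (setLIntegral_le_lintegral _ _)
  have hreal := facet_count_bound (k := k) hr hR0 hR33 hn0 (by linarith) hΛ0 hε0 hb0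
    hbl hs0 hs1 hκ hN
  calc ENNReal.ofReal (1 / 40000000 * Λ)
      ≤ ENNReal.ofReal (N * (q * (1 / 2) * (1 / 4)) / (2 * ε)) := ENNReal.ofReal_le_ofReal hreal
    _ ≤ (∑ i, γ (facetSlab τ ε (2 * ε) z i)) / ENNReal.ofReal (2 * ε) := by
        rw [ENNReal.ofReal_div_of_pos (by positivity)]
        exact ENNReal.div_le_div_right hsum _
    _ ≤ surfaceArea γ (polytope τ z) := h.sum_measure_facetSlab_le hτ0.le hε0 z
    _ ≤ maxSurfaceArea γ := le_iSup₂_of_le (polytope τ z) (convex_polytope τ z) le_rfl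

end IsRadialMeasure

/-! ### From potentials to profiles -/

/-- The function `e^{-φ}`, extended to the negative half-line by its value at `0`. -/
def potentialProfile (φ : ℝ≥0 → ℝ≥0∞) (s : ℝ) : ℝ :=
  (EReal.exp (-(φ s.toNNReal : EReal))).toReal

theorem exp_neg_coe_ne_top (a : ℝ≥0∞) : EReal.exp (-(a : EReal)) ≠ ∞ := by
  rw [Ne, EReal.exp_eq_top_iff, EReal.neg_eq_top_iff]
  exact EReal.coe_ennreal_ne_bot a

theorem weight_eq (n : ℕ) (φ : ℝ≥0 → ℝ≥0∞) (x : EuclideanSpace ℝ (Fin n)) :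
    weight n φ x = ENNReal.ofReal (potentialProfile φ ‖x‖) := by
  rw [weight, potentialProfile, ENNReal.ofReal_toReal (exp_neg_coe_ne_top _), norm_toNNReal]

theorem potentialProfile_of_eq_top {φ : ℝ≥0 → ℝ≥0∞} {s : ℝ} (h : φ s.toNNReal = ∞) :
    potentialProfile φ s = 0 := by
  simp [potentialProfile, h]

theorem potentialProfile_of_ne_top {φ : ℝ≥0 → ℝ≥0∞} {s : ℝ} (h : φ s.toNNReal ≠ ∞) :
    potentialProfile φ s = Real.exp (-(φ s.toNNReal).toReal) := by
  rw [potentialProfile, ← EReal.coe_ennreal_toReal h, ← EReal.coe_neg, EReal.exp_coe,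
    ENNReal.toReal_ofReal (Real.exp_pos _).le]

theorem isProfile_potentialProfile {φ : ℝ≥0 → ℝ≥0∞} (hmono : Monotone φ)
    (hconv : ConvexOn ℝ≥0 Set.univ φ) : IsProfile (potentialProfile φ) where
  nonneg := fun s => ENNReal.toReal_nonneg
  anti := fun x y hxy => by
    refine ENNReal.toReal_mono (exp_neg_coe_ne_top _) (EReal.exp_monotone ?_)
    rw [EReal.neg_le_neg_iff, EReal.coe_ennreal_le_coe_ennreal_iff]
    exact hmono (Real.toNNReal_le_toNNReal hxy)
  logConcave := fun {x y t} hx hy ht ht1 => by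
    by_cases h1 : φ x.toNNReal = ∞
    · rw [potentialProfile_of_eq_top h1, Real.zero_rpow (by linarith), zero_mul]
      exact ENNReal.toReal_nonneg
    by_cases h2 : φ y.toNNReal = ∞
    · rw [potentialProfile_of_eq_top h2, Real.zero_rpow ht.ne', mul_zero]
      exact ENNReal.toReal_nonneg
    have h1t : 0 ≤ 1 - t := by linarith
    have e : ((1 - t) * x + t * y).toNNReal =
        (1 - t).toNNReal • x.toNNReal + t.toNNReal • y.toNNReal := by
      rw [Real.toNNReal_add (by positivity) (by positivity), Real.toNNReal_mul h1t,
        Real.toNNReal_mul ht.le, smul_eq_mul, smul_eq_mul]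
    have hle : φ ((1 - t) * x + t * y).toNNReal ≤
        ENNReal.ofReal ((1 - t) * (φ x.toNNReal).toReal + t * (φ y.toNNReal).toReal) := by
      rw [e]
      refine (hconv.2 (Set.mem_univ _) (Set.mem_univ _) zero_le zero_le ?_).trans (le_of_eq ?_)
      · rw [← Real.toNNReal_add h1t ht.le, sub_add_cancel, Real.toNNReal_one]
      · rw [ENNReal.ofReal_add (by positivity) (by positivity), ENNReal.ofReal_mul h1t,
          ENNReal.ofReal_mul ht.le, ENNReal.ofReal_toReal h1, ENNReal.ofReal_toReal h2]
        rfl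
    have h3 := ne_top_of_le_ne_top ENNReal.ofReal_ne_top hle
    rw [potentialProfile_of_ne_top h1, potentialProfile_of_ne_top h2,
      potentialProfile_of_ne_top h3, ← Real.exp_mul, ← Real.exp_mul, ← Real.exp_add,
      Real.exp_le_exp]
    have := ENNReal.toReal_le_of_le_ofReal (by positivity) hle
    linarith

theorem lintegral_weight_ne {n : ℕ} {φ : ℝ≥0 → ℝ≥0∞} (h : IsProbabilityMeasure (radialMeasure n φ)) :
    ∫⁻ y, weight n φ y ≠ 0 ∧ ∫⁻ y, weight n φ y ≠ ∞ := by
  have h1 := h.measure_univ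
  rw [radialMeasure, Measure.smul_apply, withDensity_apply _ MeasurableSet.univ,
    Measure.restrict_univ, smul_eq_mul] at h1
  constructor <;> intro h0 <;> simp [h0] at h1

theorem radialMeasure_eq_withDensity {n : ℕ} {φ : ℝ≥0 → ℝ≥0∞}
    (h : IsProbabilityMeasure (radialMeasure n φ)) :
    radialMeasure n φ = volume.withDensity fun x =>
      ENNReal.ofReal ((∫⁻ y, weight n φ y)⁻¹.toReal * potentialProfile φ ‖x‖) := by
  obtain ⟨h0, h1⟩ := lintegral_weight_ne h
  have h2 : (∫⁻ y, weight n φ y)⁻¹ ≠ ∞ := ENNReal.inv_ne_top.2 h0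
  rw [radialMeasure, ← withDensity_smul' _ _ h2]
  congr 1
  ext x
  rw [Pi.smul_apply, smul_eq_mul, weight_eq, ENNReal.ofReal_mul ENNReal.toReal_nonneg,
    ENNReal.ofReal_toReal h2]

section Mass

variable {m : ℕ} {φ : ℝ≥0 → ℝ≥0∞}

/-- The normalizing constant of `radialMeasure n φ`. -/
def normalizer (n : ℕ) (φ : ℝ≥0 → ℝ≥0∞) : ℝ := (∫⁻ y, weight n φ y)⁻¹.toReal

theorem normalizer_pos {n : ℕ} (h : IsProbabilityMeasure (radialMeasure n φ)) :
    0 < normalizer n φ := by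
  obtain ⟨h0, h1⟩ := lintegral_weight_ne h
  exact ENNReal.toReal_pos (ENNReal.inv_ne_zero.2 h1) (ENNReal.inv_ne_top.2 h0)

theorem lintegral_radialDensity (hV : IsProfile (potentialProfile φ))
    (h : IsProbabilityMeasure (radialMeasure (m + 1) φ)) :
    ∫⁻ s in Set.Ioi 0, ENNReal.ofReal (radialDensity (normalizer (m + 1) φ * sphereArea m) m
      (potentialProfile φ) s) = 1 := by
  have hB := normalizer_pos h
  have hω := sphereArea_pos m
  have h1 := h.measure_univ
  have hm := hV.measurable
  rw [radialMeasure_eq_withDensity h, withDensity_apply _ MeasurableSet.univ,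
    Measure.restrict_univ, lintegral_comp_norm
      (g := fun s => ENNReal.ofReal ((∫⁻ y, weight (m + 1) φ y)⁻¹.toReal * potentialProfile φ s))
      (by fun_prop), ← lintegral_const_mul _ (by fun_prop)] at h1
  refine Eq.trans (setLIntegral_congr_fun measurableSet_Ioi fun s hs => ?_) h1
  have hs0 : (0 : ℝ) < s := hs
  have hVs := hV.nonneg s
  rw [← normalizer, ← ENNReal.ofReal_mul (by positivity), ← ENNReal.ofReal_mul hω.le,
    radialDensity]
  congr 1
  ring

/-- Total mass 1 rules out both obstructions to a mode: a profile vanishing on (0, ∞) would have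
mass 0, and a constant positive one infinite mass. -/
theorem exists_isMode_potentialProfile (hV : IsProfile (potentialProfile φ))
    (h : IsProbabilityMeasure (radialMeasure (m + 1) φ)) (hm : m ≠ 0) :
    ∃ r v, IsMode (potentialProfile φ) m r v := by
  have hB := normalizer_pos h
  have hω := sphereArea_pos m
  have hmass := lintegral_radialDensity hV h
  have h0 : ∃ s₀, 0 < s₀ ∧ 0 < potentialProfile φ s₀ := by
    by_contra! hcon
    rw [setLIntegral_congr_fun (g := fun _ => 0) measurableSet_Ioi fun s hs => ?_,
      lintegral_zero] at hmass
    · exact zero_ne_one hmass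
    · have : potentialProfile φ s = 0 := le_antisymm (hcon s hs) (hV.nonneg s)
      simp [radialDensity, this]
  obtain ⟨s₀, hs₀, hVs₀⟩ := h0
  have h1 : ∃ s₁, 0 < s₁ ∧ potentialProfile φ s₁ < potentialProfile φ 0 := by
    by_contra! hcon
    have hV0 : 0 < potentialProfile φ 0 := hVs₀.trans_le (hV.anti hs₀.le)
    have hle : ∫⁻ _ in Set.Ioi (1 : ℝ), ENNReal.ofReal
        (normalizer (m + 1) φ * sphereArea m * potentialProfile φ 0) ≤ 1 := by
      rw [← hmass]
      refine (setLIntegral_mono' measurableSet_Ioi fun s hs => ENNReal.ofReal_le_ofReal ?_).trans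
        (lintegral_mono_set (Set.Ioi_subset_Ioi zero_le_one))
      have hs1 : (1 : ℝ) < s := hs
      rw [radialDensity]
      have h2 := one_le_pow₀ hs1.le (n := m)
      have h3 := hcon s (by linarith)
      refine mul_le_mul ?_ h3 hV0.le (by positivity)
      exact le_mul_of_one_le_right (by positivity) h2
    rw [setLIntegral_const, Real.volume_Ioi, ENNReal.mul_top (by
      rw [Ne, ENNReal.ofReal_eq_zero, not_le]; positivity)] at hle
    exact absurd hle (by simp)
  obtain ⟨s₁, hs₁, hVs₁⟩ := h1
  exact hV.exists_isMode hs₀ hVs₀ hs₁ hVs₁ hm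

theorem isRadialMeasure_radialMeasure (hmono : Monotone φ) (hconv : ConvexOn ℝ≥0 Set.univ φ)
    (h : IsProbabilityMeasure (radialMeasure (m + 1) φ)) (hm : m ≠ 0) {r v : ℝ}
    (hmode : IsMode (potentialProfile φ) m r v) :
    IsRadialMeasure (radialMeasure (m + 1) φ) (normalizer (m + 1) φ) (potentialProfile φ) r v where
  B_pos := normalizer_pos h
  eq_withDensity := radialMeasure_eq_withDensity h
  law :=
    { profile := isProfile_potentialProfile hmono hconv
      mode := hmode
      A_pos := mul_pos (normalizer_pos h) (sphereArea_pos m)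
      m_ne := hm
      mass := lintegral_radialDensity (isProfile_potentialProfile hmono hconv) h }

end Mass

theorem IsRadialMeasure.bounds {m : ℕ} {γ : Measure (EuclideanSpace ℝ (Fin (m + 1)))} {B : ℝ}
    {V : ℝ → ℝ} {r v : ℝ} (h : IsRadialMeasure γ B V r v) :
    MemLp (fun x : EuclideanSpace ℝ (Fin (m + 1)) => ‖x‖) 2 γ ∧ 0 < ∫ x, ‖x‖ ∂γ ∧
    0 < variance (fun x : EuclideanSpace ℝ (Fin (m + 1)) => ‖x‖) γ ∧
    ENNReal.ofReal (1 / 400000000 * (√((m + 1 : ℕ) : ℝ) / (√(∫ x, ‖x‖ ∂γ) *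
        (variance (fun x : EuclideanSpace ℝ (Fin (m + 1)) => ‖x‖) γ) ^ (1 / 4 : ℝ))))
      ≤ maxSurfaceArea γ ∧
    maxSurfaceArea γ ≤ ENNReal.ofReal (80000 * (√((m + 1 : ℕ) : ℝ) / (√(∫ x, ‖x‖ ∂γ) *
        (variance (fun x : EuclideanSpace ℝ (Fin (m + 1)) => ‖x‖) γ) ^ (1 / 4 : ℝ)))) := by
  have hprob := h.isProbabilityMeasure
  have hD := h.hasRadialDensity
  have hM := h.law.peak_pos
  have hr := h.law.mode.r_pos
  obtain ⟨h1, h2⟩ := hD.sqrt_div_le h.law ((m + 1 : ℕ) : ℝ) (Nat.cast_nonneg _)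
  have e : ((m + 1 : ℕ) : ℝ) = m + 1 := Nat.cast_succ m
  refine ⟨hD.memLp h.law, lt_of_lt_of_le (by positivity) (hD.le_mean h.law),
    lt_of_lt_of_le (by positivity) (hD.le_variance h.law), ?_, ?_⟩
  · refine le_trans (ENNReal.ofReal_le_ofReal ?_) h.le_maxSurfaceArea
    rw [← e]
    linarith
  · refine h.maxSurfaceArea_le.trans (ENNReal.ofReal_le_ofReal ?_)
    rw [← e]
    linarith

/-! ### Power potentials -/

theorem lintegral_Ioi_pow_mul_exp_neg (m : ℕ) {b : ℝ} (hb : 0 < b) :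
    ∫⁻ s in Set.Ioi 0, ENNReal.ofReal (s ^ m * Real.exp (-(b * s))) =
      ENNReal.ofReal (m.factorial / b ^ (m + 1)) := by
  have hint : IntegrableOn (fun s : ℝ => s ^ m * Real.exp (-(b * s))) (Set.Ioi 0) := by
    have h1 := integrableOn_rpow_mul_exp_neg_mul_rpow (s := m) (p := 1) (b := b)
      (by linarith [(Nat.cast_nonneg m : (0 : ℝ) ≤ m)]) one_pos hb
    refine h1.congr_fun (fun s _ => ?_) measurableSet_Ioi
    simp only [Real.rpow_one, Real.rpow_natCast, neg_mul]
  rw [← ofReal_integral_eq_lintegral_ofReal hint ((ae_restrict_iff' measurableSet_Ioi).2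
    (ae_of_all _ fun s hs => mul_nonneg (pow_nonneg (le_of_lt hs) _) (Real.exp_pos _).le))]
  congr 1
  have h2 := Real.integral_rpow_mul_exp_neg_mul_Ioi (a := m + 1) (r := b) (by positivity) hb
  rw [Real.Gamma_nat_eq_factorial] at h2
  have e : ((m : ℝ) + 1) = ((m + 1 : ℕ) : ℝ) := by push_cast; ring
  calc ∫ s in Set.Ioi 0, s ^ m * Real.exp (-(b * s))
      = ∫ t in Set.Ioi 0, t ^ ((m : ℝ) + 1 - 1) * Real.exp (-(b * t)) := by
        refine setIntegral_congr_fun measurableSet_Ioi fun s _ => ?_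
        simp only [add_sub_cancel_right, Real.rpow_natCast]
    _ = _ := by
        rw [h2, e, Real.rpow_natCast, div_pow, one_pow]
        ring

theorem factorial_le_mul_sqrt {m : ℕ} (hm : m ≠ 0) :
    (m.factorial : ℝ) ≤ Real.exp 1 * √m * (m / Real.exp 1) ^ m := by
  obtain ⟨k, rfl⟩ := Nat.exists_eq_succ_of_ne_zero hm
  have h1 : Stirling.stirlingSeq k.succ ≤ Stirling.stirlingSeq 1 :=
    Stirling.stirlingSeq'_antitone (Nat.zero_le k)
  rw [Stirling.stirlingSeq_one, Stirling.stirlingSeq,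
    div_le_div_iff₀ (by positivity) (by positivity)] at h1
  have e : √(2 * ((k.succ : ℕ) : ℝ)) = √2 * √((k.succ : ℕ) : ℝ) := Real.sqrt_mul (by norm_num) _
  rw [e] at h1
  refine le_of_mul_le_mul_right ?_ (Real.sqrt_pos.2 (zero_lt_two (α := ℝ)))
  linarith

namespace IsRadialLaw

variable {A : ℝ} {m : ℕ} {V : ℝ → ℝ} {r v : ℝ}

/-- The radial density of a log-concave law is at least as peaked as a Gamma density. -/
theorem sqrt_le_peak_mul (h : IsRadialLaw A m V r v) :
    √m ≤ Real.exp 1 * (peak A m r v * r) := by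
  have hr := h.mode.r_pos
  have hM := h.peak_pos
  have hm : (0 : ℝ) < m := by exact_mod_cast Nat.pos_of_ne_zero h.m_ne
  have hv := h.mode.v_pos
  have hA := h.A_pos
  -- Integrating the tangent bound gives a Gamma integral, that is 1 ≤ Mr e^m m! / m^(m+1); by
  -- Stirling the last factor is at most e / √m.
  have h1 : (1 : ℝ≥0∞) ≤ ENNReal.ofReal (A * v * Real.exp m * (m.factorial / (m / r) ^ (m + 1))) := by
    rw [← h.mass, ENNReal.ofReal_mul (by positivity), ← lintegral_Ioi_pow_mul_exp_neg m
      (by positivity), ← lintegral_const_mul _ (by fun_prop)]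
    refine setLIntegral_mono' measurableSet_Ioi fun s hs => ?_
    have hs0 : (0 : ℝ) < s := hs
    rw [← ENNReal.ofReal_mul (by positivity)]
    refine ENNReal.ofReal_le_ofReal ?_
    rw [radialDensity]
    refine (mul_le_mul_of_nonneg_left (h.mode.upper s hs0.le) (by positivity)).trans (le_of_eq ?_)
    have e : Real.exp (-(m * (s / r - 1))) = Real.exp m * Real.exp (-(m / r * s)) := by
      rw [← Real.exp_add]; congr 1; ring
    rw [e]
    ring
  rw [ENNReal.one_le_ofReal] at h1
  have h2 := factorial_le_mul_sqrt h.m_ne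
  have e2 : A * v * Real.exp m * (m.factorial / (m / r) ^ (m + 1)) =
      peak A m r v * r * (Real.exp m * m.factorial / m ^ (m + 1)) := by
    rw [peak, div_pow]; field_simp; ring
  rw [e2] at h1
  have h3 : Real.exp m * m.factorial / m ^ (m + 1) ≤ Real.exp 1 / √m := by
    have hsq : √(m : ℝ) * √m = m := Real.mul_self_sqrt hm.le
    have hs0 : 0 < √(m : ℝ) := Real.sqrt_pos.2 hm
    have hexp : Real.exp m = Real.exp 1 ^ m := by rw [← Real.exp_nat_mul, mul_one]
    rw [div_le_div_iff₀ (by positivity) hs0]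
    have h4 := mul_le_mul_of_nonneg_left h2 (Real.exp_pos m).le
    have e3 : Real.exp m * (Real.exp 1 * √m * (m / Real.exp 1) ^ m) =
        Real.exp 1 * √m * m ^ m := by
      rw [hexp, div_pow]; field_simp
    rw [e3] at h4
    have h5 := mul_le_mul_of_nonneg_right h4 hs0.le
    calc Real.exp m * m.factorial * √m ≤ Real.exp 1 * √m * m ^ m * √m := h5
      _ = Real.exp 1 * m ^ m * (√m * √m) := by ring
      _ = Real.exp 1 * m ^ (m + 1) := by rw [hsq]; ring
  have h6 := h1.trans (mul_le_mul_of_nonneg_left h3 (by positivity))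
  have hs0 : 0 < √(m : ℝ) := Real.sqrt_pos.2 hm
  rw [mul_div_assoc', le_div_iff₀ hs0] at h6
  linarith

/-- A lower bound for the radial density on an interval to the right of the mode bounds its peak. -/
theorem peak_mul_le_of_le (h : IsRadialLaw A m V r v) {u c : ℝ} (hc : 0 < c)
    (hle : ∀ s, r < s → s ≤ r * (1 + u) →
      c * peak A m r v ≤ radialDensity A m V s) : c * (peak A m r v * r) * u ≤ 1 := by
  have hr := h.mode.r_pos
  have hM := h.peak_pos
  have h1 : ENNReal.ofReal (c * peak A m r v) * ENNReal.ofReal (r * u) ≤ 1 := by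
    have e : volume (Set.Ioc r (r * (1 + u))) = ENNReal.ofReal (r * u) := by
      rw [Real.volume_Ioc]; congr 1; ring
    rw [← e, ← setLIntegral_const, ← h.mass]
    refine (setLIntegral_mono' measurableSet_Ioc fun s hs =>
      ENNReal.ofReal_le_ofReal (hle s hs.1 hs.2)).trans (lintegral_mono_set fun s hs => ?_)
    exact hr.trans hs.1
  rw [← ENNReal.ofReal_mul (by positivity), ENNReal.ofReal_le_one] at h1
  linarith

end IsRadialLaw

/-- The potential `t ↦ t ^ p / p`. -/
def powerPotential (p : ℝ) (t : ℝ≥0) : ℝ≥0∞ := ENNReal.ofReal ((t : ℝ) ^ p / p)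

theorem powerMeasure_eq (n : ℕ) (p : ℝ) : powerMeasure n p = radialMeasure n (powerPotential p) :=
  rfl

theorem monotone_powerPotential {p : ℝ} (hp : 1 ≤ p) : Monotone (powerPotential p) := by
  intro s t hst
  have : (s : ℝ) ^ p ≤ (t : ℝ) ^ p :=
    Real.rpow_le_rpow s.coe_nonneg (NNReal.coe_le_coe.2 hst) (by linarith)
  exact ENNReal.ofReal_le_ofReal (div_le_div_of_nonneg_right this (by linarith))

theorem convexOn_powerPotential {p : ℝ} (hp : 1 ≤ p) :
    ConvexOn ℝ≥0 Set.univ (powerPotential p) := by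
  refine ⟨convex_univ, fun x _ y _ a b _ _ hab => ?_⟩
  have hp0 : 0 < p := by linarith
  have h1 := (convexOn_rpow hp).2 (Set.mem_Ici.2 x.coe_nonneg) (Set.mem_Ici.2 y.coe_nonneg)
    a.coe_nonneg b.coe_nonneg (by exact_mod_cast hab)
  have e : a • powerPotential p x + b • powerPotential p y =
      ENNReal.ofReal ((a * (x : ℝ) ^ p + b * (y : ℝ) ^ p) / p) := by
    have h2 : ∀ (c z : ℝ≥0), c • powerPotential p z = ENNReal.ofReal (c * ((z : ℝ) ^ p / p)) := by
      intro c z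
      rw [ENNReal.ofReal_mul c.coe_nonneg, ENNReal.ofReal_coe_nnreal]
      rfl
    rw [h2, h2, ← ENNReal.ofReal_add (by positivity) (by positivity)]
    congr 1
    ring
  rw [e]
  refine ENNReal.ofReal_le_ofReal (div_le_div_of_nonneg_right ?_ hp0.le)
  simpa using h1

theorem potentialProfile_powerPotential {p : ℝ} (hp : 1 ≤ p) {s : ℝ} (hs : 0 ≤ s) :
    potentialProfile (powerPotential p) s = Real.exp (-(s ^ p / p)) := by
  have : 0 ≤ s ^ p / p := div_nonneg (Real.rpow_nonneg hs p) (by linarith)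
  rw [potentialProfile_of_ne_top (φ := powerPotential p) ENNReal.ofReal_ne_top, powerPotential,
    Real.coe_toNNReal s hs,
    ENNReal.toReal_ofReal this]

/-- The maximum of m log s - s ^ p / p is at s ^ p = m; the tangent bound there is Bernoulli's
inequality for the real exponent p ≥ 1. -/
theorem isMode_powerPotential {p : ℝ} (hp : 1 ≤ p) {m : ℕ} (hm : m ≠ 0) :
    IsMode (potentialProfile (powerPotential p)) m ((m : ℝ) ^ (1 / p))
      (Real.exp (-(m / p))) := by
  have hm0 : (0 : ℝ) < m := by exact_mod_cast Nat.pos_of_ne_zero hm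
  have hp0 : 0 < p := by linarith
  have hr : 0 < (m : ℝ) ^ (1 / p) := Real.rpow_pos_of_pos hm0 _
  have hrp : ((m : ℝ) ^ (1 / p)) ^ p = m := by
    rw [← Real.rpow_mul hm0.le, one_div, inv_mul_cancel₀ hp0.ne', Real.rpow_one]
  refine ⟨hr, Real.exp_pos _, fun s hs => ?_, fun s hs hsr => ?_⟩
  · rw [potentialProfile_powerPotential hp hs, ← Real.exp_add, Real.exp_le_exp]
    have hq : 0 ≤ s / (m : ℝ) ^ (1 / p) := by positivity
    have h1 := one_add_mul_self_le_rpow_one_add (s := s / (m : ℝ) ^ (1 / p) - 1) (by linarith) hp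
    rw [add_sub_cancel, Real.div_rpow hs hr.le, hrp, le_div_iff₀ hm0] at h1
    have h2 : (m + m * (p * (s / (m : ℝ) ^ (1 / p) - 1))) / p ≤ s ^ p / p :=
      div_le_div_of_nonneg_right (by linarith) hp0.le
    have e : (m + m * (p * (s / (m : ℝ) ^ (1 / p) - 1))) / p =
        m / p + m * (s / (m : ℝ) ^ (1 / p) - 1) := by field_simp
    linarith
  · rw [potentialProfile_powerPotential hp hs, Real.exp_le_exp, neg_le_neg_iff]
    refine div_le_div_of_nonneg_right ?_ hp0.le
    calc s ^ p ≤ ((m : ℝ) ^ (1 / p)) ^ p := Real.rpow_le_rpow hs hsr.le hp0.le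
      _ = m := hrp

theorem isProbabilityMeasure_powerMeasure {p : ℝ} (hp : 1 ≤ p) {m : ℕ} (hm : m ≠ 0) :
    IsProbabilityMeasure (powerMeasure (m + 1) p) := by
  have hV := isProfile_potentialProfile (monotone_powerPotential hp) (convexOn_powerPotential hp)
  have hmeas := hV.measurable
  have hmode := isMode_powerPotential hp hm
  have hm0 : (0 : ℝ) < m := by exact_mod_cast Nat.pos_of_ne_zero hm
  set r := (m : ℝ) ^ (1 / p)
  set v := Real.exp (-(m / p))
  have hr := hmode.r_pos
  have hv := hmode.v_pos
  have e : ∫⁻ y, weight (m + 1) (powerPotential p) y = ENNReal.ofReal (sphereArea m) *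
      ∫⁻ s in Set.Ioi (0 : ℝ), ENNReal.ofReal (s ^ m) *
        ENNReal.ofReal (potentialProfile (powerPotential p) s) := by
    simp_rw [weight_eq]
    exact lintegral_comp_norm
      (g := fun s => ENNReal.ofReal (potentialProfile (powerPotential p) s)) (by fun_prop)
  have htop : ∫⁻ y, weight (m + 1) (powerPotential p) y ≠ ∞ := by
    rw [e]
    refine ENNReal.mul_ne_top ENNReal.ofReal_ne_top (ne_top_of_le_ne_top
      (b := ENNReal.ofReal (v * Real.exp m) * ENNReal.ofReal (m.factorial / (m / r) ^ (m + 1)))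
      (ENNReal.mul_ne_top ENNReal.ofReal_ne_top ENNReal.ofReal_ne_top) ?_)
    rw [← lintegral_Ioi_pow_mul_exp_neg m (by positivity), ← lintegral_const_mul _ (by fun_prop)]
    refine setLIntegral_mono' measurableSet_Ioi fun s hs => ?_
    have hs0 : (0 : ℝ) < s := hs
    rw [← ENNReal.ofReal_mul (by positivity), ← ENNReal.ofReal_mul (by positivity)]
    refine ENNReal.ofReal_le_ofReal ((mul_le_mul_of_nonneg_left (hmode.upper s hs0.le)
      (by positivity)).trans (le_of_eq ?_))
    have e : Real.exp (-(m * (s / r - 1))) = Real.exp m * Real.exp (-(m / r * s)) := by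
      rw [← Real.exp_add]; congr 1; ring
    rw [e]
    ring
  have hzero : ∫⁻ y, weight (m + 1) (powerPotential p) y ≠ 0 := by
    rw [Ne, lintegral_eq_zero_iff (by simp_rw [funext (weight_eq _ _)]; fun_prop)]
    intro h0
    have h1 : ∀ᵐ _ : EuclideanSpace ℝ (Fin (m + 1)), False := h0.mono fun x hx => by
      rw [weight_eq, potentialProfile_powerPotential hp (norm_nonneg x), Pi.zero_apply,
        ENNReal.ofReal_eq_zero] at hx
      exact absurd hx (not_le.2 (Real.exp_pos _))
    exact (NeZero.ne (volume : Measure (EuclideanSpace ℝ (Fin (m + 1)))))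
      (ae_eq_bot.1 (eventually_false_iff_eq_bot.1 h1))
  refine ⟨?_⟩
  rw [powerMeasure_eq, radialMeasure, Measure.smul_apply, withDensity_apply _ MeasurableSet.univ,
    Measure.restrict_univ, smul_eq_mul, ENNReal.inv_mul_cancel hzero htop]

theorem IsRotInvLogConcave.powerMeasure {p : ℝ} (hp : 1 ≤ p) {m : ℕ} (hm : m ≠ 0) :
    IsRotInvLogConcave (powerMeasure (m + 1) p) :=
  ⟨isProbabilityMeasure_powerMeasure hp hm, powerPotential p, monotone_powerPotential hp,
    convexOn_powerPotential hp, powerMeasure_eq _ _⟩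

theorem isRadialMeasure_powerMeasure {p : ℝ} (hp : 1 ≤ p) {m : ℕ} (hm : m ≠ 0) :
    IsRadialMeasure (powerMeasure (m + 1) p) (normalizer (m + 1) (powerPotential p))
      (potentialProfile (powerPotential p)) ((m : ℝ) ^ (1 / p)) (Real.exp (-(m / p))) :=
  isRadialMeasure_radialMeasure (monotone_powerPotential hp) (convexOn_powerPotential hp)
    (isProbabilityMeasure_powerMeasure hp hm) hm (isMode_powerPotential hp hm)

/-- The density stays above M/e up to r(1 + u) with u = 1/(p√m): at s = r e^y its logarithm has
dropped by m(e^{py} - 1 - py)/p ≤ m p y² ≤ m p u² ≤ 1, where py ≤ 1. The mass of that interval then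
bounds M. -/
theorem peak_mul_le_of_powerPotential {p : ℝ} (hp : 1 ≤ p) {m : ℕ} {A : ℝ}
    (h : IsRadialLaw A m (potentialProfile (powerPotential p)) ((m : ℝ) ^ (1 / p))
      (Real.exp (-(m / p)))) :
    peak A m ((m : ℝ) ^ (1 / p)) (Real.exp (-(m / p))) * (m : ℝ) ^ (1 / p) ≤ 3 * (p * √m) := by
  have hm0 : (0 : ℝ) < m := by exact_mod_cast Nat.pos_of_ne_zero h.m_ne
  have hm1 : (1 : ℝ) ≤ m := by exact_mod_cast Nat.one_le_iff_ne_zero.2 h.m_ne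
  have hp0 : 0 < p := by linarith
  have hr := h.mode.r_pos
  have hM := h.peak_pos
  have hA := h.A_pos
  have hrp : ((m : ℝ) ^ (1 / p)) ^ p = m := by
    rw [← Real.rpow_mul hm0.le, one_div, inv_mul_cancel₀ hp0.ne', Real.rpow_one]
  have hs0 : 0 < √(m : ℝ) := Real.sqrt_pos.2 hm0
  have hs1 : 1 ≤ √(m : ℝ) := Real.one_le_sqrt.2 hm1
  set r := (m : ℝ) ^ (1 / p)
  set u := 1 / (p * √m) with hu
  have hu0 : 0 < u := by positivity
  have hpu : p * u ≤ 1 := by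
    have : p * u = 1 / √m := by rw [hu]; field_simp
    rw [this, div_le_one hs0]
    exact hs1
  have hmu : m * p * u ^ 2 ≤ 1 := by
    have : m * p * u ^ 2 = 1 / p := by
      rw [hu, div_pow, mul_pow, Real.sq_sqrt hm0.le]; field_simp
    rw [this, div_le_one hp0]
    exact hp
  have hmain := h.peak_mul_le_of_le (u := u) (c := Real.exp (-1)) (Real.exp_pos _) (by
    intro s hs1 hs2
    have hs : 0 < s := hr.trans hs1
    set y := Real.log (s / r) with hy
    have hsr : 1 < s / r := (one_lt_div hr).2 hs1
    have hy0 : 0 < y := Real.log_pos hsr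
    have hyu : y ≤ u := by
      have h1 := Real.log_le_sub_one_of_pos (show 0 < s / r by positivity)
      have h2 : s / r ≤ 1 + u := by rw [div_le_iff₀ hr]; linarith
      linarith
    have hsy : s = r * Real.exp y := by
      rw [hy, Real.exp_log (by positivity), mul_div_cancel₀ _ hr.ne']
    have hpy : |p * y| ≤ 1 := by
      rw [abs_of_pos (by positivity)]
      exact (mul_le_mul_of_nonneg_left hyu hp0.le).trans hpu
    have h3 := (abs_le.1 (Real.abs_exp_sub_one_sub_id_le hpy)).2
    have hspow : s ^ p = m * Real.exp (p * y) := by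
      rw [hsy, Real.mul_rpow hr.le (Real.exp_pos y).le, hrp, ← Real.exp_mul, mul_comm y p]
    have hsm : s ^ m = r ^ m * Real.exp (m * y) := by
      rw [hsy, mul_pow, ← Real.exp_nat_mul]
    rw [radialDensity, potentialProfile_powerPotential hp hs.le, peak, hspow, hsm]
    have e : A * (r ^ m * Real.exp (m * y)) * Real.exp (-(m * Real.exp (p * y) / p)) =
        A * r ^ m * Real.exp (m * y - m * Real.exp (p * y) / p) := by
      rw [sub_eq_add_neg, Real.exp_add]; ring
    have e' : Real.exp (-1) * (A * r ^ m * Real.exp (-(m / p))) =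
        A * r ^ m * Real.exp (-1 - m / p) := by
      rw [sub_eq_add_neg, Real.exp_add]; ring
    rw [e, e']
    refine mul_le_mul_of_nonneg_left (Real.exp_le_exp.2 ?_) (by positivity)
    have h4 : m * Real.exp (p * y) / p ≤ m * (1 + p * y + (p * y) ^ 2) / p := by
      gcongr
      linarith
    have e2 : m * (1 + p * y + (p * y) ^ 2) / p = m / p + m * y + m * p * y ^ 2 := by
      field_simp
    have h5 : m * p * y ^ 2 ≤ m * p * u ^ 2 := by gcongr
    linarith)
  set M := peak A m r (Real.exp (-(m / p)))
  have e3 : Real.exp (-1) * (M * r) * u = M * r / (Real.exp 1 * (p * √m)) := by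
    rw [hu, Real.exp_neg]; field_simp
  rw [e3, div_le_one (by positivity)] at hmain
  refine hmain.trans (mul_le_mul_of_nonneg_right ?_ (by positivity))
  linarith [Real.exp_one_lt_d9]

theorem sqrt_mul_sqrt_eq_rpow {n : ℝ} (hn : 0 ≤ n) : √(n * √n) = n ^ (3 / 4 : ℝ) := by
  rw [Real.sqrt_mul hn, Real.sqrt_eq_rpow, Real.sqrt_eq_rpow, ← Real.rpow_mul hn]
  rcases hn.eq_or_lt with rfl | h0
  · norm_num [Real.zero_rpow]
  · rw [← Real.rpow_add h0]
    norm_num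

/-- Here Λ = √(n · Mr) / r with √n/4 ≤ Mr ≤ 3p√n and r ≤ n^{1/p} ≤ 2r. Only the upper constant
depends on p. -/
theorem powerMeasure_bounds {p : ℝ} (hp : 1 ≤ p) {m : ℕ} (hm : m ≠ 0) :
    ENNReal.ofReal (1 / 80000000 * ((m + 1 : ℕ) : ℝ) ^ (3 / 4 - 1 / p : ℝ)) ≤
        maxSurfaceArea (powerMeasure (m + 1) p) ∧
      maxSurfaceArea (powerMeasure (m + 1) p) ≤
        ENNReal.ofReal (4000 * √(3 * p) * ((m + 1 : ℕ) : ℝ) ^ (3 / 4 - 1 / p : ℝ)) := by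
  have h := isRadialMeasure_powerMeasure hp hm
  have hm0 : (0 : ℝ) < m := by exact_mod_cast Nat.pos_of_ne_zero hm
  have hm1 : (1 : ℝ) ≤ m := by exact_mod_cast Nat.one_le_iff_ne_zero.2 hm
  have hp0 : 0 < p := by linarith
  have hup := peak_mul_le_of_powerPotential hp h.law
  have hlow := h.law.sqrt_le_peak_mul
  have h1 := h.le_maxSurfaceArea
  have h2 := h.maxSurfaceArea_le
  have hr := h.law.mode.r_pos
  have hM := h.law.peak_pos
  set r := (m : ℝ) ^ (1 / p) with hrdef
  set M := peak (normalizer (m + 1) (powerPotential p) * sphereArea m) m r (Real.exp (-(m / p)))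
  have hn : ((m + 1 : ℕ) : ℝ) = m + 1 := Nat.cast_succ m
  rw [hn]
  set n : ℝ := m + 1 with hndef
  have hn0 : 0 < n := by positivity
  have hmn : m ≤ n := by linarith
  have hn2 : n ≤ 2 * m := by linarith
  have eΛ : √(n * M / r) = √(n * (M * r)) / r := by
    rw [show n * M / r = n * (M * r) / r ^ 2 by field_simp, Real.sqrt_div' _ (by positivity),
      Real.sqrt_sq hr.le]
  have ernp : n ^ (3 / 4 - 1 / p : ℝ) = √(n * √n) / n ^ (1 / p) := by
    rw [Real.rpow_sub hn0, sqrt_mul_sqrt_eq_rpow hn0.le]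
  have hnp : 0 < n ^ (1 / p) := Real.rpow_pos_of_pos hn0 _
  have hrn : r ≤ n ^ (1 / p) := Real.rpow_le_rpow hm0.le hmn (by positivity)
  have hnr : n ^ (1 / p) ≤ 2 * r := by
    calc n ^ (1 / p) ≤ (2 * m) ^ (1 / p) := Real.rpow_le_rpow hn0.le hn2 (by positivity)
      _ = 2 ^ (1 / p) * r := Real.mul_rpow (by norm_num) hm0.le
      _ ≤ 2 ^ (1 : ℝ) * r := by
          gcongr
          · norm_num
          · rw [div_le_one hp0]; exact hp
      _ = 2 * r := by rw [Real.rpow_one]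
  have hsn : 0 < √n := Real.sqrt_pos.2 hn0
  have hlow' : √n ≤ 4 * (M * r) := by
    have a1 : √n ≤ √2 * √m := by
      rw [← Real.sqrt_mul (by norm_num)]; exact Real.sqrt_le_sqrt hn2
    have a2 : √2 * √(m : ℝ) ≤ √2 * (Real.exp 1 * (M * r)) :=
      mul_le_mul_of_nonneg_left hlow (Real.sqrt_nonneg 2)
    have a3 : √2 * Real.exp 1 ≤ 4 := by
      have b1 : √2 ≤ 1.42 := by rw [Real.sqrt_le_left (by norm_num)]; norm_num
      have b2 := Real.exp_one_lt_d9
      have b3 := Real.exp_pos 1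
      nlinarith
    have a4 := mul_le_mul_of_nonneg_right a3 (show 0 ≤ M * r by positivity)
    linarith
  rw [eΛ] at h1 h2
  rw [ernp]
  constructor
  · refine le_trans (ENNReal.ofReal_le_ofReal ?_) h1
    have a1 : √(n * √n) ≤ 2 * √(n * (M * r)) := by
      have : √(n * √n) ≤ √(2 ^ 2 * (n * (M * r))) := by
        refine Real.sqrt_le_sqrt ?_
        have := mul_le_mul_of_nonneg_left hlow' hn0.le
        linarith
      rwa [Real.sqrt_mul (by norm_num : (0 : ℝ) ≤ 2 ^ 2), Real.sqrt_sq zero_le_two] at this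
    have a2 : √(n * √n) / n ^ (1 / p) ≤ 2 * √(n * (M * r)) / r :=
      div_le_div₀ (by positivity) a1 hr hrn
    rw [mul_div_assoc] at a2
    linarith
  · refine h2.trans (ENNReal.ofReal_le_ofReal ?_)
    have a1 : √(n * (M * r)) ≤ √(3 * p) * √(n * √n) := by
      rw [← Real.sqrt_mul (by positivity)]
      refine Real.sqrt_le_sqrt ?_
      have a2 : M * r ≤ 3 * (p * √n) := hup.trans (by gcongr)
      have := mul_le_mul_of_nonneg_left a2 hn0.le
      linarith
    have a3 : √(n * (M * r)) / r ≤ √(3 * p) * √(n * √n) / (n ^ (1 / p) / 2) :=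
      div_le_div₀ (by positivity) a1 (by positivity) (by linarith)
    have e : √(3 * p) * √(n * √n) / (n ^ (1 / p) / 2) =
        2 * (√(3 * p) * (√(n * √n) / n ^ (1 / p))) := by field_simp
    rw [e] at a3
    linarith

/-! ### The standard Gaussian measure -/

theorem powerMeasure_two_eq_stdGaussian {m : ℕ} (hm : m ≠ 0) :
    powerMeasure (m + 1) 2 = stdGaussian (EuclideanSpace ℝ (Fin (m + 1))) := by
  have h := isRadialMeasure_powerMeasure one_le_two hm
  have hprob := h.isProbabilityMeasure
  set B := normalizer (m + 1) (powerPotential 2)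
  set K : ℂ := B * (Real.pi / (1 / 2 : ℂ)) ^ ((Module.finrank ℝ (EuclideanSpace ℝ (Fin (m + 1))) : ℂ) / 2)
  have hchar : ∀ t : EuclideanSpace ℝ (Fin (m + 1)),
      charFun (powerMeasure (m + 1) 2) t = K * Complex.exp (-‖t‖ ^ 2 / 2) := by
    intro t
    have hB := h.B_pos
    have hV := h.law.profile.measurable
    rw [charFun_apply, h.eq_withDensity, integral_withDensity_eq_integral_toReal_smul
      (by fun_prop) (ae_of_all _ fun _ => ENNReal.ofReal_lt_top)]
    have e : ∀ x : EuclideanSpace ℝ (Fin (m + 1)),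
        (ENNReal.ofReal (B * potentialProfile (powerPotential 2) ‖x‖)).toReal •
          Complex.exp (inner ℝ x t * Complex.I) =
        B * Complex.exp (-(1 / 2 : ℂ) * ‖x‖ ^ 2 + Complex.I * inner ℝ t x) := by
      intro x
      rw [ENNReal.toReal_ofReal (mul_nonneg hB.le (h.law.profile.nonneg _)),
        potentialProfile_powerPotential one_le_two (norm_nonneg x), Complex.exp_add,
        real_inner_comm, Complex.real_smul]
      push_cast
      rw [Real.rpow_two]
      push_cast
      ring_nf
    simp_rw [e]
    rw [integral_const_mul, GaussianFourier.integral_cexp_neg_mul_sq_norm_add (by norm_num)]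
    rw [← mul_assoc]
    congr 2
    rw [Complex.I_sq]
    ring
  -- The constant is not evaluated: a characteristic function of a probability measure equals 1 at
  -- 0.
  have hK : K = 1 := by
    have := hchar 0
    simpa using this.symm
  refine Measure.ext_of_charFun (funext fun t => ?_)
  rw [hchar, hK, one_mul, charFun_stdGaussian]

end RadialSurface

end

/-! ### The main theorem -/

theorem theorem1 :
    (∃ c C : ℝ, 0 < c ∧ 0 < C ∧
      ∀ (n : ℕ), 2 ≤ n → ∀ γ : Measure (EuclideanSpace ℝ (Fin n)),
        RadialSurface.IsRotInvLogConcave γ →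
        MemLp (fun x : EuclideanSpace ℝ (Fin n) => ‖x‖) 2 γ ∧
        0 < ∫ x, ‖x‖ ∂γ ∧
        0 < variance (fun x : EuclideanSpace ℝ (Fin n) => ‖x‖) γ ∧
        ENNReal.ofReal (c * (√(n : ℝ) / (√(∫ x, ‖x‖ ∂γ) *
            (variance (fun x : EuclideanSpace ℝ (Fin n) => ‖x‖) γ) ^ (1 / 4 : ℝ))))
          ≤ RadialSurface.maxSurfaceArea γ ∧
        RadialSurface.maxSurfaceArea γ ≤
          ENNReal.ofReal (C * (√(n : ℝ) / (√(∫ x, ‖x‖ ∂γ) *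
            (variance (fun x : EuclideanSpace ℝ (Fin n) => ‖x‖) γ) ^ (1 / 4 : ℝ))))) ∧
    (∀ p : ℝ, 1 ≤ p → ∃ c C : ℝ, 0 < c ∧ 0 < C ∧
      ∀ (n : ℕ), 2 ≤ n →
        RadialSurface.IsRotInvLogConcave (RadialSurface.powerMeasure n p) ∧
        ENNReal.ofReal (c * (n : ℝ) ^ (3 / 4 - 1 / p : ℝ))
          ≤ RadialSurface.maxSurfaceArea (RadialSurface.powerMeasure n p) ∧
        RadialSurface.maxSurfaceArea (RadialSurface.powerMeasure n p)
          ≤ ENNReal.ofReal (C * (n : ℝ) ^ (3 / 4 - 1 / p : ℝ))) ∧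
    (∃ c C : ℝ, 0 < c ∧ 0 < C ∧
      ∀ (n : ℕ), 2 ≤ n →
        ENNReal.ofReal (c * (n : ℝ) ^ (1 / 4 : ℝ))
          ≤ RadialSurface.maxSurfaceArea (stdGaussian (EuclideanSpace ℝ (Fin n))) ∧
        RadialSurface.maxSurfaceArea (stdGaussian (EuclideanSpace ℝ (Fin n)))
          ≤ ENNReal.ofReal (C * (n : ℝ) ^ (1 / 4 : ℝ))) := by
  -- The exponent in the radial density is m = n - 1, and n ≥ 2 makes it positive, as an interior
  -- mode requires.
  have hsucc : ∀ n : ℕ, 2 ≤ n → ∃ m : ℕ, m ≠ 0 ∧ n = m + 1 := fun n hn =>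
    ⟨n - 1, by omega, by omega⟩
  refine ⟨⟨1 / 400000000, 80000, by norm_num, by norm_num, fun n hn γ hγ => ?_⟩,
    fun p hp => ⟨1 / 80000000, 4000 * √(3 * p), by norm_num, by positivity, fun n hn => ?_⟩,
    ⟨1 / 80000000, 4000 * √(3 * 2), by norm_num, by positivity, fun n hn => ?_⟩⟩
  · obtain ⟨m, hm, rfl⟩ := hsucc n hn
    obtain ⟨hprob, φ, hmono, hconv, rfl⟩ := hγ
    obtain ⟨r, v, hmode⟩ := RadialSurface.exists_isMode_potentialProfile
      (RadialSurface.isProfile_potentialProfile hmono hconv) hprob hm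
    exact (RadialSurface.isRadialMeasure_radialMeasure hmono hconv hprob hm hmode).bounds
  · obtain ⟨m, hm, rfl⟩ := hsucc n hn
    exact ⟨RadialSurface.IsRotInvLogConcave.powerMeasure hp hm,
      RadialSurface.powerMeasure_bounds hp hm⟩
  · obtain ⟨m, hm, rfl⟩ := hsucc n hn
    have h := RadialSurface.powerMeasure_bounds one_le_two hm
    rw [RadialSurface.powerMeasure_two_eq_stdGaussian hm,
      show (3 / 4 - 1 / 2 : ℝ) = 1 / 4 by norm_num] at h
    exact h
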